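/- Let $d\ge 1$, let $\alpha\in(0,2]$, $\kappa>0$ and $\beta\in\mathbb R$ satisfy $\alpha>\kappa\beta>\alpha-2$, with $\beta>1$ if $\alpha=2$, and let $\gamma\in[1,d]$. Let $\nu$ be a Lévy measure on $\mathbb R^d$ (that is, $\nu(\{0\})=0$ and $\int(1\wedge|y|^2)\,\nu(dy)<\infty$) which is symmetric, $\nu(-A)=\nu(A)$, and let $\mu$ be a Borel measure on the unit sphere $\mathbb S\subset\mathbb R^d$ which is nondegenerate (its support is contained in no proper linear subspace of $\mathbb R^d$) and is a $(\gamma-1)$-measure: for some constant $c$, $$\mu(\mathbb S\cap B(\theta,\rho))\le c\,\rho^{\gamma-1},\qquad \theta\in\mathbb S,\ \rho>0 .$$ Suppose that, for some constant $c>0$ and every Borel set $A\subset\mathbb R^d$, $c^{-1}I(A)\le\nu(A)\le c\,I(A)$, where $$I(A)=\int_{\mathbb S}\int_0^\infty \mathbf 1_A(s\theta)\,s^{-1-\alpha}\left[\log\left(1+s^{-\kappa}\right)\right]^{-\beta}\,ds\,\mu(d\theta).$$ Let $\{P_t,\ t\ge0\}$ be the convolution semigroup of probability measures with Lévy measure $\nu$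 and drift $b=0$, i.e. $\int e^{i\langle\xi,y\rangle}P_t(dy)=e^{-t\Phi(\xi)}$ with $$\Phi(\xi)=-\int\left(e^{i\langle\xi,y\rangle}-1-i\langle\xi,y\rangle\mathbf 1_{|y|<1}\right)\nu(dy).$$ Put $\Psi(r)=\sup_{|\xi|\le r}\operatorname{Re}\Phi(\xi)$, $\Psi^{-1}(s)=\sup\{r>0:\Psi(r)=s\}$ and $h(t)=1/\Psi^{-1}(1/t)$ for $t>0$. Then for every $t>0$ the measure $P_t$ is absolutely continuous with respect to the Lebesgue measure and has a continuous density $p_t$, and these densities satisfy the following estimates, in which each minimum is read as $1$ at $x=0$ (its limit as $x\to0$). 1. Short times. (a) If $\alpha\in(0,2)$, there is a constant $C_{20}>0$ such that for all $t\in(0,1)$ and $x\in\mathbb R^d$ $$p_t(x)\le C_{20}\,t^{-d/\alpha}\left(\log(1+1/t)\right)^{d\beta/\alpha}\min\left\{1,\ \frac{t^{1+\gamma/\alpha}\left[\log(1+|x|^{-\kappa})\right]^{-\beta}}{\left(\log(1+1/t)\right)^{\gamma\beta/\alpha}|x|^{\gamma+\alpha}}\right\}.$$ (b) If $\alpha=2$,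 there are constants $C_{21},C_{22},C_{23}>0$ such that for all $t\in(0,1)$ and $x\in\mathbb R^d$ $$p_t(x)\le C_{21}\,t^{-d/2}\left(\log(1+1/t)\right)^{d(\beta-1)/2}\min\left\{1,\ \frac{t^{1+\gamma/2}\left[\log(1+|x|^{-\kappa})\right]^{-\beta}}{\left(\log(1+1/t)\right)^{\gamma(\beta-1)/2}|x|^{\gamma+2}}+e^{-\frac{C_{22}|x|}{h(t)}\log\left(1+\frac{C_{23}|x|}{h(t)}\right)}\right\}.$$ 2. Large times. There is a constant $C_{24}>0$ such that for all $t>1$ and $x\in\mathbb R^d$ $$p_t(x)\le C_{24}\,t^{-d/(\alpha-\kappa\beta)}\min\left\{1,\ t^{1+\gamma/(\alpha-\kappa\beta)}|x|^{-\gamma-\alpha}\left[\log(1+|x|^{-\kappa})\right]^{-\beta}\right\}.$$ -/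

import Mathlib

open MeasureTheory
open scoped ENNReal Pointwise

noncomputable section

namespace LevyDensity

/-- The Euclidean space of dimension `d`. -/
abbrev E (d : ℕ) : Type := EuclideanSpace ℝ (Fin d)

/-- The unit sphere of the Euclidean space of dimension `d`. -/
abbrev S (d : ℕ) : Type := Metric.sphere (0 : E d) 1

/-- Lévy measures: no mass at the origin, and `∫ (1 ∧ |y|²) ν(dy) < ∞`. -/
structure IsLevyMeasure {d : ℕ} (ν : Measure (E d)) : Prop where
  zero_mass : ν {0} = 0
  lintegral_lt_top : ∫⁻ y, ENNReal.ofReal (min 1 (‖y‖ ^ 2)) ∂ν < ∞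

/-- The characteristic exponent
`Φ(ξ) = - ∫ (e^{i⟨ξ,y⟩} - 1 - i⟨ξ,y⟩ 1_{|y|<1}) ν(dy) - i⟨ξ,b⟩`. -/
def charExponent {d : ℕ} (ν : Measure (E d)) (b ξ : E d) : ℂ :=
  -(∫ y, (Complex.exp (Complex.I * ((inner ℝ ξ y : ℝ) : ℂ)) - 1
      - (Metric.ball (0 : E d) 1).indicator
          (fun z => Complex.I * ((inner ℝ ξ z : ℝ) : ℂ)) y) ∂ν)
    - Complex.I * ((inner ℝ ξ b : ℝ) : ℂ)

/-- `P t`, `t ≥ 0`, are the probability measures with Fourier transform `e^{-tΦ}`. The Fourier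
transform determines each `P t`; the convolution semigroup property follows, see
`IsLevySemigroup.conv`. -/
structure IsLevySemigroup {d : ℕ} (ν : Measure (E d)) (b : E d) (P : ℝ → Measure (E d)) :
    Prop where
  isProbabilityMeasure : ∀ t : ℝ, 0 ≤ t → IsProbabilityMeasure (P t)
  charFun_eq : ∀ t : ℝ, 0 ≤ t → ∀ ξ : E d,
    charFun (P t) ξ = Complex.exp (-((t : ℂ) * charExponent ν b ξ))

theorem IsLevySemigroup.conv {d : ℕ} {ν : Measure (E d)} {b : E d} {P : ℝ → Measure (E d)}
    (hP : IsLevySemigroup ν b P) {s t : ℝ} (hs : 0 ≤ s) (ht : 0 ≤ t) :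
    Measure.conv (P s) (P t) = P (s + t) := by
  have := hP.isProbabilityMeasure s hs
  have := hP.isProbabilityMeasure t ht
  have := hP.isProbabilityMeasure (s + t) (add_nonneg hs ht)
  apply Measure.ext_of_charFun
  funext ξ
  rw [charFun_conv, hP.charFun_eq s hs, hP.charFun_eq t ht,
    hP.charFun_eq (s + t) (add_nonneg hs ht), ← Complex.exp_add]
  congr 1
  push_cast
  ring

/-- `Ψ(r) = sup_{|ξ| ≤ r} Re Φ(ξ)`. -/
def Psi {d : ℕ} (ν : Measure (E d)) (b : E d) (r : ℝ) : ℝ :=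
  sSup ((fun ξ : E d => (charExponent ν b ξ).re) '' Metric.closedBall 0 r)

/-- `Ψ⁻¹(s) = sup {r > 0 : Ψ(r) = s}`. -/
def PsiInv {d : ℕ} (ν : Measure (E d)) (b : E d) (s : ℝ) : ℝ :=
  sSup {r : ℝ | 0 < r ∧ Psi ν b r = s}

/-- `h(t) = 1 / Ψ⁻¹(1/t)`. -/
def h {d : ℕ} (ν : Measure (E d)) (b : E d) (t : ℝ) : ℝ :=
  1 / PsiInv ν b (1 / t)

/-- `ν(-A) = ν(A)` for all Borel sets `A`. -/
def IsSymmetric {d : ℕ} (ν : Measure (E d)) : Prop :=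
  ∀ A : Set (E d), MeasurableSet A → ν (-A) = ν A

/-- The support of `μ` is contained in no proper linear subspace. -/
def IsNondegenerate {d : ℕ} (μ : Measure (S d)) : Prop :=
  ∀ V : Submodule ℝ (E d), ((fun θ : S d => (θ : E d)) '' μ.support) ⊆ (V : Set (E d)) → V = ⊤

/-- `μ(S ∩ B(θ, ρ)) ≤ c ρ^a` for all `θ` in the sphere and all `ρ > 0`, for some constant `c`. -/
def IsSphericalMeasureOfOrder {d : ℕ} (μ : Measure (S d)) (a : ℝ) : Prop :=
  ∃ c : ℝ, 0 < c ∧ ∀ (θ : S d) (ρ : ℝ), 0 < ρ →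
    μ (Metric.ball θ ρ) ≤ ENNReal.ofReal (c * ρ ^ a)

/-- `∫_S ∫_0^∞ 1_A(sθ) Q(s) ds μ(dθ)`. -/
def polarMass {d : ℕ} (μ : Measure (S d)) (Q : ℝ → ℝ) (A : Set (E d)) : ℝ≥0∞ :=
  ∫⁻ θ : S d, ∫⁻ s in Set.Ioi (0 : ℝ),
    A.indicator (fun _ => (1 : ℝ≥0∞)) (s • (θ : E d)) * ENNReal.ofReal (Q s) ∂volume ∂μ

/-- `ν(A) ≈ ∫_S ∫_0^∞ 1_A(sθ) Q(s) ds μ(dθ)`: two-sided comparability, with one constant for all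
Borel sets `A`. -/
def IsComparableToPolar {d : ℕ} (ν : Measure (E d)) (μ : Measure (S d)) (Q : ℝ → ℝ) : Prop :=
  ∃ c : ℝ, 0 < c ∧ ∀ A : Set (E d), MeasurableSet A →
    ENNReal.ofReal c⁻¹ * polarMass μ Q A ≤ ν A ∧ ν A ≤ ENNReal.ofReal c * polarMass μ Q A

/-- `[log(1 + s^{-κ})]^{-β}`, for `s > 0`. -/
def logFactor (κ β s : ℝ) : ℝ :=
  Real.log (1 + s ^ (-κ)) ^ (-β)

open Classical in
/-- `min {1, v}` for a quantity `v = v(x)` that is finite for `x ≠ 0` and has limit `+∞` at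
`x = 0`: at `x = 0` the minimum is `1`. -/
def minOne {d : ℕ} (x : E d) (v : ℝ) : ℝ :=
  if x = 0 then 1 else min 1 v

end LevyDensity

end

open LevyDensity

/-! Everything rests on one estimate at a length scale g, applied afterwards with a suitable g =
g(t). Symmetry makes the exponent the real integral `phi` of 1 - cos⟨ξ,y⟩, so P_t has characteristic
function exp(-`phi` N) with N = tν. Cut N at radius g. If exp(-`phi` N) decays on the frequency
scale 1/g and N has bounded mass beyond g, the part with small jumps alone inherits the decay, hence
has a bounded density. As its jumps are bounded, its exponent extends to complex frequencies; an
imaginary shift of length τ/g gains exp(-τ|x|/g) and costs exp(A τ² e^τ)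
(`norm_fourier_exp_neg_phi_le_exp`). Here τ = 1 gives an exponential kernel, and τ of the order
log(1 + |x|/g) gives Poisson-type decay.

The large jumps form a compound Poisson law, and the density of P_t is bounded by the small-jump
kernel integrated against it (`ofReal_charDensity_le_lintegral`). If the large jumps sum to less
than |x|/2, the small ones must cover the other half: this is the exponential term. Otherwise, among
n+1 jumps one has length at least |x|/(2(n+1)), and the kernel only sees the mass of balls of radius
about g at that distance from the origin; the polynomial loss in n is absorbed by 1/n!
(`lintegral_compoundPoisson_le`, `ScaleBounds.exists_charDensity_le`).

The input on ν is geometric. A ball of radius ρ at distance at least r is seen from the origin under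
an angle of order ρ/r, so the spherical condition bounds its mass by a multiple of r^{1-γ} Q(r) ρ^γ
(`polarMeasure_ball_le`). Nondegeneracy bounds the exponent below by |ξ|² times the truncated second
moment at 1/|ξ| (`polarMeasure_phi_ge`).

For α < 2, and for large times in all cases, g(t) makes t g Q(g) comparable to 1; the jump term then
dominates the exponential one (`LevyBounds.exists_density_le_minOne`). For α = 2 and t < 1 the
truncated moment exceeds s³Q(s) by a logarithm. It is computed from the primitive
[log(1+u^{-κ})]^{1-β}, the scale becomes g² = t L^{1-β} with L = log(1+1/t), and t g Q(g) is only of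
order 1/L, so the exponential term stays. It takes its final form through a lower bound of h(t) by a
multiple of g (`PsiInv_le`). -/

namespace LevyDensity

open Filter Topology FourierTransform

/-! ### Fourier inversion for integrable characteristic functions. -/

/-- Fubini: the Fourier transform of a product with a characteristic function. -/
theorem fourier_charFun_mul {d : ℕ} (P : Measure (E d)) [IsFiniteMeasure P] {F : E d → ℂ}
    (hF : Integrable F) (x : E d) :
    𝓕 (fun v => charFun P ((2 * Real.pi) • v) * F v) x = ∫ y, 𝓕 F (x - y) ∂P := by
  simp only [Real.fourier_eq']
  have hint : Integrable (Function.uncurry fun (y v : E d) =>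
      Complex.exp (((-2 * Real.pi * inner ℝ v (x - y) : ℝ) : ℂ) * Complex.I) • F v)
      (P.prod volume) := by
    refine (hF.comp_snd P).bdd_mul (c := 1) (Continuous.aestronglyMeasurable (by fun_prop)) ?_
    filter_upwards with z
    rw [Complex.norm_exp_ofReal_mul_I]
  rw [integral_integral_swap hint]
  congr 1
  ext v
  rw [charFun_apply, smul_eq_mul, mul_left_comm, ← integral_mul_const]
  congr 1
  ext y
  rw [smul_eq_mul, ← mul_assoc, ← Complex.exp_add]
  congr 2
  rw [inner_sub_right, inner_smul_right, real_inner_comm]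
  push_cast
  ring

theorem integrable_exp_neg_mul_sq_norm (d : ℕ) {b : ℝ} (hb : 0 < b) :
    Integrable (fun v : E d => Real.exp (-b * ‖v‖ ^ 2)) := by
  refine Integrable.of_integral_ne_zero ?_
  rw [GaussianFourier.integral_rexp_neg_mul_sq_norm hb]
  positivity

/-- The Gaussian kernel which is the Fourier transform of `exp (-‖v‖² / c)`. -/
noncomputable def gaussKernel (d : ℕ) (c : ℝ) (u : E d) : ℝ :=
  (Real.pi * c) ^ ((d : ℝ) / 2) * Real.exp (-(Real.pi ^ 2 * c) * ‖u‖ ^ 2)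

theorem lintegral_gaussKernel {d : ℕ} {c : ℝ} (hc : 0 < c) :
    ∫⁻ u, ENNReal.ofReal (gaussKernel d c u) = 1 := by
  rw [← ofReal_integral_eq_lintegral_ofReal]
  · have h2 : 0 < Real.pi ^ 2 * c := by positivity
    simp only [gaussKernel]
    rw [integral_const_mul, GaussianFourier.integral_rexp_neg_mul_sq_norm h2,
      finrank_euclideanSpace_fin,
      ← Real.mul_rpow (by positivity) (by positivity)]
    have : Real.pi * c * (Real.pi / (Real.pi ^ 2 * c)) = 1 := by
      field_simp
    simp [this]
  · exact (integrable_exp_neg_mul_sq_norm d (by positivity)).const_mul _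
  · exact Eventually.of_forall fun u => by simp only [gaussKernel, Pi.zero_apply]; positivity

theorem fourier_gauss {d : ℕ} {c : ℝ} (hc : 0 < c) (u : E d) :
    𝓕 (fun v : E d => Complex.exp (-(c : ℂ)⁻¹ * (‖v‖ : ℂ) ^ 2)) u = (gaussKernel d c u : ℂ) := by
  have h1 : 0 < ((c : ℂ)⁻¹).re := by
    rw [← Complex.ofReal_inv, Complex.ofReal_re]; positivity
  rw [fourier_gaussian_innerProductSpace h1, gaussKernel]
  push_cast
  rw [Complex.ofReal_cpow (by positivity)]
  simp
  left
  congr 1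
  ring

theorem integrable_gauss (d : ℕ) {c : ℝ} (hc : 0 < c) :
    Integrable (fun v : E d => Complex.exp (-(c : ℂ)⁻¹ * (‖v‖ : ℂ) ^ 2)) := by
  refine (integrable_exp_neg_mul_sq_norm d (inv_pos.mpr hc)).ofReal.congr
    (Eventually.of_forall fun v => ?_)
  simp

theorem fourier_charFun_mul_gauss {d : ℕ} (P : Measure (E d)) [IsFiniteMeasure P] {c : ℝ}
    (hc : 0 < c) (x : E d) :
    𝓕 (fun v => charFun P ((2 * Real.pi) • v) * Complex.exp (-(c : ℂ)⁻¹ * (‖v‖ : ℂ) ^ 2)) x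
      = ((∫ y, gaussKernel d c (x - y) ∂P : ℝ) : ℂ) := by
  rw [fourier_charFun_mul P (integrable_gauss d hc), ← integral_complex_ofReal]
  simp only [fourier_gauss hc]

theorem gaussKernel_nonneg {d : ℕ} {c : ℝ} (hc : 0 < c) (u : E d) : 0 ≤ gaussKernel d c u := by
  simp only [gaussKernel]; positivity

theorem continuous_gaussKernel (d : ℕ) (c : ℝ) : Continuous (gaussKernel d c) := by
  unfold gaussKernel; fun_prop

theorem integrable_gaussKernel_sub {d : ℕ} (P : Measure (E d)) [IsFiniteMeasure P] {c : ℝ}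
    (hc : 0 < c) (x : E d) : Integrable (fun y => gaussKernel d c (x - y)) P := by
  refine Integrable.of_bound (C := (Real.pi * c) ^ ((d : ℝ) / 2))
    (((continuous_gaussKernel d c).comp (by fun_prop)).aestronglyMeasurable)
    (Eventually.of_forall fun y => ?_)
  rw [Real.norm_of_nonneg (gaussKernel_nonneg hc _), gaussKernel]
  refine mul_le_of_le_one_right (by positivity) (Real.exp_le_one_iff.mpr ?_)
  have : 0 ≤ Real.pi ^ 2 * c * ‖x - y‖ ^ 2 := by positivity
  linarith

/-- The inverse Fourier transform of the characteristic function of `P`. -/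
noncomputable def charDensity {d : ℕ} (P : Measure (E d)) (x : E d) : ℝ :=
  (𝓕 (fun v => charFun P ((2 * Real.pi) • v)) x).re

theorem continuous_charDensity {d : ℕ} {P : Measure (E d)}
    (hint : Integrable fun v => charFun P ((2 * Real.pi) • v)) :
    Continuous (charDensity P) := by
  refine Complex.continuous_re.comp ?_
  exact VectorFourier.fourierIntegral_continuous Real.continuous_fourierChar
    (by exact continuous_inner) hint

section Inversion

variable {d : ℕ} {P : Measure (E d)} [IsProbabilityMeasure P]

/-- A Gaussian factor in frequency space is Gaussian smoothing of P in space. As c grows the factor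
tends to 1 boundedly, so reality, positivity and total mass pass from the smoothed measures to the
limit. -/
theorem tendsto_charDensity (hint : Integrable fun v => charFun P ((2 * Real.pi) • v)) (x : E d) :
    Tendsto (fun c : ℝ => ((∫ y, gaussKernel d c (x - y) ∂P : ℝ) : ℂ)) atTop
      (𝓝 (𝓕 (fun v => charFun P ((2 * Real.pi) • v)) x)) := by
  have hi : Integrable fun v : E d => Complex.exp (((-2 * Real.pi * inner ℝ v x : ℝ) : ℂ)
      * Complex.I) • charFun P ((2 * Real.pi) • v) := by
    refine hint.bdd_mul (c := 1) (Continuous.aestronglyMeasurable (by fun_prop)) ?_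
    filter_upwards with z
    rw [Complex.norm_exp_ofReal_mul_I]
  rw [Real.fourier_eq']
  refine (Real.tendsto_integral_cexp_sq_smul hi).congr' ?_
  filter_upwards [eventually_gt_atTop 0] with c hc
  rw [← fourier_charFun_mul_gauss P hc, Real.fourier_eq']
  congr 1
  ext v
  simp only [smul_eq_mul, Complex.ofReal_inv]
  ring

theorem ofReal_charDensity (hint : Integrable fun v => charFun P ((2 * Real.pi) • v)) (x : E d) :
    ((charDensity P x : ℝ) : ℂ) = 𝓕 (fun v => charFun P ((2 * Real.pi) • v)) x := by
  have h1 := tendsto_charDensity hint x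
  have h2 : Tendsto (fun c : ℝ => (((∫ y, gaussKernel d c (x - y) ∂P : ℝ) : ℂ)).im) atTop
      (𝓝 (𝓕 (fun v => charFun P ((2 * Real.pi) • v)) x).im) :=
    (Complex.continuous_im.tendsto _).comp h1
  simp only [Complex.ofReal_im] at h2
  have h3 := tendsto_nhds_unique h2 tendsto_const_nhds
  apply Complex.ext
  · rw [Complex.ofReal_re]; rfl
  · rw [Complex.ofReal_im, h3]

theorem tendsto_charDensity_real (hint : Integrable fun v => charFun P ((2 * Real.pi) • v))
    (x : E d) :
    Tendsto (fun c : ℝ => ∫ y, gaussKernel d c (x - y) ∂P) atTop (𝓝 (charDensity P x)) := by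
  have h1 := (Complex.continuous_re.tendsto _).comp (tendsto_charDensity hint x)
  exact h1

theorem charDensity_nonneg (hint : Integrable fun v => charFun P ((2 * Real.pi) • v)) (x : E d) :
    0 ≤ charDensity P x := by
  refine ge_of_tendsto (tendsto_charDensity_real hint x) ?_
  filter_upwards [eventually_gt_atTop 0] with c hc
  exact integral_nonneg fun y => gaussKernel_nonneg hc _

/-- Each smoothed measure has mass 1, and Fatou passes to the limit. The inequality suffices: it
makes the candidate density integrable, so that Fourier inversion for functions applies. -/
theorem lintegral_charDensity_le (hint : Integrable fun v => charFun P ((2 * Real.pi) • v)) :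
    ∫⁻ x, ENNReal.ofReal (charDensity P x) ≤ 1 := by
  let q : ℕ → E d → ℝ≥0∞ := fun n x =>
    ENNReal.ofReal (∫ y, gaussKernel d ((n : ℝ) + 1) (x - y) ∂P)
  have hq : ∀ n x, q n x = ∫⁻ y, ENNReal.ofReal (gaussKernel d ((n : ℝ) + 1) (x - y)) ∂P := by
    intro n x
    exact ofReal_integral_eq_lintegral_ofReal (integrable_gaussKernel_sub P (by positivity) x)
      (Eventually.of_forall fun y => gaussKernel_nonneg (by positivity) _)
  have hmeas : ∀ n, Measurable fun z : E d × E d =>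
      ENNReal.ofReal (gaussKernel d ((n : ℝ) + 1) (z.1 - z.2)) := fun n =>
    ((continuous_gaussKernel d _).comp (by fun_prop)).measurable.ennreal_ofReal
  have hlim : ∀ x, liminf (fun n => q n x) atTop = ENNReal.ofReal (charDensity P x) := by
    intro x
    refine Tendsto.liminf_eq ?_
    refine ENNReal.tendsto_ofReal ?_
    have h2 : Tendsto (fun n : ℕ => (n : ℝ) + 1) atTop atTop :=
      tendsto_atTop_add_const_right _ _ tendsto_natCast_atTop_atTop
    exact (tendsto_charDensity_real hint x).comp h2
  have hmq : ∀ n, Measurable (q n) := by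
    intro n
    simp only [funext (hq n)]
    exact (hmeas n).lintegral_prod_right'
  simp only [← hlim]
  refine (lintegral_liminf_le hmq).trans ?_
  refine le_of_eq ?_
  have : ∀ n, ∫⁻ x, q n x = 1 := by
    intro n
    simp only [hq]
    rw [lintegral_lintegral_swap (hmeas n).aemeasurable]
    have h3 : ∀ y : E d, ∫⁻ x, ENNReal.ofReal (gaussKernel d ((n : ℝ) + 1) (x - y)) = 1 := by
      intro y
      rw [lintegral_sub_right_eq_self fun x => ENNReal.ofReal (gaussKernel d ((n : ℝ) + 1) x)]
      exact lintegral_gaussKernel (by positivity)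
    simp [h3]
  simp [this]

/-- A probability measure with integrable characteristic function has a continuous density. -/
theorem eq_withDensity_charDensity
    (hint : Integrable fun v => charFun P ((2 * Real.pi) • v)) :
    P = volume.withDensity fun x => ENNReal.ofReal (charDensity P x) := by
  have hc := continuous_charDensity hint
  have hnn := charDensity_nonneg hint
  have hle := lintegral_charDensity_le hint
  have hfin : IsFiniteMeasure (volume.withDensity fun x => ENNReal.ofReal (charDensity P x)) :=
    isFiniteMeasure_withDensity (hle.trans_lt ENNReal.one_lt_top).ne
  have hpint : Integrable (charDensity P) := by
    refine ⟨hc.aestronglyMeasurable, ?_⟩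
    rw [hasFiniteIntegral_iff_ofReal (Eventually.of_forall hnn)]
    exact hle.trans_lt ENNReal.one_lt_top
  have hF : Integrable (𝓕 (fun v => charFun P ((2 * Real.pi) • v))) := by
    refine hpint.ofReal.congr (Eventually.of_forall fun x => ?_)
    exact ofReal_charDensity hint x
  have hcc : Continuous fun v => charFun P ((2 * Real.pi) • v) :=
    continuous_charFun.comp (by fun_prop)
  have hinv := hcc.fourierInv_fourier_eq hint hF
  apply Measure.ext_of_charFun
  funext ξ
  -- Inversion is evaluated at ξ/(2π) because `charFun` has no factor 2π in its phase, unlike `𝓕`.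
  have h1 := congrFun hinv ((2 * Real.pi)⁻¹ • ξ)
  rw [smul_smul, mul_inv_cancel₀ (by positivity), one_smul] at h1
  rw [← h1, Real.fourierInv_eq', charFun_apply,
    integral_withDensity_eq_integral_toReal_smul hc.measurable.ennreal_ofReal
      (Eventually.of_forall fun _ => ENNReal.ofReal_lt_top)]
  congr 1
  ext x
  rw [← ofReal_charDensity hint, ENNReal.toReal_ofReal (hnn x), smul_eq_mul, Complex.real_smul,
    mul_comm]
  congr 3
  rw [inner_smul_right]
  push_cast
  field_simp

end Inversion

/-! ### Exponents of measures with bounded support and their analytic continuation. -/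

/-- An integral of entire functions of a parameter is entire, if it is locally dominated. -/
theorem differentiable_integral_of_dominated {X : Type*} [MeasurableSpace X] {ρ : Measure X}
    {F : ℂ → X → ℂ} (hF : ∀ x, Differentiable ℂ fun z => F z x)
    (hm : ∀ z, AEStronglyMeasurable (F z) ρ)
    (hb : ∀ z₀, ∃ b : X → ℝ, Integrable b ρ ∧
      ∀ᵐ x ∂ρ, ∀ z ∈ Metric.closedBall z₀ 2, ‖F z x‖ ≤ b x) :
    Differentiable ℂ fun z => ∫ x, F z x ∂ρ := by
  intro z₀
  obtain ⟨b, hbi, hb⟩ := hb z₀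
  refine ((hasDerivAt_integral_of_dominated_loc_of_deriv_le (F := F)
    (F' := fun z x => deriv (fun z => F z x) z) (bound := b)
    (Metric.ball_mem_nhds z₀ one_pos) (Eventually.of_forall hm) ?_ ?_ ?_ hbi ?_).2).differentiableAt
  · refine hbi.mono' (hm z₀) ?_
    filter_upwards [hb] with x hx using hx z₀ (Metric.mem_closedBall_self (by norm_num))
  -- The derivative is measurable in x as a limit of difference quotients along 1/(n+1).
  · refine aestronglyMeasurable_of_tendsto_ae (u := atTop)
      (f := fun (n : ℕ) x => ((n : ℂ) + 1) * (F (z₀ + ((n : ℂ) + 1)⁻¹) x - F z₀ x))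
      (fun n => ((hm _).sub (hm _)).const_mul _) ?_
    filter_upwards with x
    have h1 := (hF x z₀).hasDerivAt.tendsto_slope
    have h2 : Tendsto (fun n : ℕ => z₀ + ((n : ℂ) + 1)⁻¹) atTop (𝓝[≠] z₀) := by
      rw [tendsto_nhdsWithin_iff]
      constructor
      · have : Tendsto (fun n : ℕ => ((n : ℂ) + 1)⁻¹) atTop (𝓝 0) := by
          have := tendsto_one_div_add_atTop_nhds_zero_nat (𝕜 := ℂ)
          simpa using this
        simpa using this.const_add z₀
      · filter_upwards with n
        have : (n : ℂ) + 1 ≠ 0 := Nat.cast_add_one_ne_zero n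
        simp [this]
    refine (h1.comp h2).congr fun n => ?_
    simp [slope_def_field, div_eq_mul_inv, mul_comm]
  · filter_upwards [hb] with x hx z hz
    have hz' : dist z z₀ < 1 := hz
    have h1 := Complex.norm_deriv_le_of_forall_mem_sphere_norm_le (c := z) (R := 1) (C := b x)
      (f := fun z => F z x) one_pos (hF x).diffContOnCl (fun w hw => hx w ?_)
    · simpa using h1
    · have h2 : dist w z = 1 := hw
      have := dist_triangle w z z₀
      exact Metric.mem_closedBall.mpr (by linarith)
  · filter_upwards with x z _ using (hF x z).hasDerivAt

/-- The cosine averages exp(iw) and exp(-iw); the linear terms cancel and two second-order Taylor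
remainders are left. -/
theorem Complex.norm_one_sub_cos_le (w : ℂ) : ‖1 - Complex.cos w‖ ≤ ‖w‖ ^ 2 * Real.exp ‖w‖ := by
  have h1 := Complex.norm_exp_sub_sum_le_norm_mul_exp (w * Complex.I) 2
  have h2 := Complex.norm_exp_sub_sum_le_norm_mul_exp (-w * Complex.I) 2
  simp only [Finset.sum_range_succ, Finset.sum_range_zero, norm_mul, Complex.norm_I, norm_neg,
    mul_one] at h1 h2
  have h3 : 1 - Complex.cos w = -(1 / 2) * (Complex.exp (w * Complex.I)
      - (0 + (w * Complex.I) ^ 0 / (Nat.factorial 0 : ℂ)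
        + (w * Complex.I) ^ 1 / (Nat.factorial 1 : ℂ)))
      + -(1 / 2) * (Complex.exp (-w * Complex.I)
      - (0 + (-w * Complex.I) ^ 0 / (Nat.factorial 0 : ℂ)
        + (-w * Complex.I) ^ 1 / (Nat.factorial 1 : ℂ))) := by
    rw [Complex.cos]
    simp
    ring
  rw [h3]
  refine (norm_add_le _ _).trans ?_
  rw [norm_mul, norm_mul]
  have : ‖(-(1 / 2) : ℂ)‖ = 1 / 2 := by simp
  rw [this]
  linarith

theorem cosh_sub_one_le (w : ℝ) : Real.cosh w - 1 ≤ w ^ 2 * Real.exp |w| := by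
  have h1 := Complex.norm_one_sub_cos_le (w * Complex.I)
  rw [Complex.cos_mul_I, ← Complex.ofReal_cosh, ← Complex.ofReal_one, ← Complex.ofReal_sub,
    Complex.norm_real] at h1
  simp only [norm_mul, Complex.norm_I, Complex.norm_real, mul_one, Real.norm_eq_abs, sq_abs] at h1
  rw [abs_sub_comm] at h1
  exact (le_abs_self _).trans h1

/-- The real characteristic exponent of a symmetric measure. -/
noncomputable def phi {d : ℕ} (σ : Measure (E d)) (ξ : E d) : ℝ :=
  ∫ y, (1 - Real.cos (inner ℝ ξ y)) ∂σ

/-- The analytic continuation of `phi` in the direction `η`. -/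
noncomputable def phiC {d : ℕ} (σ : Measure (E d)) (ξ η : E d) (z : ℂ) : ℂ :=
  ∫ y, (1 - Complex.cos ((inner ℝ ξ y : ℝ) + z * (inner ℝ η y : ℝ))) ∂σ

theorem phi_nonneg {d : ℕ} (σ : Measure (E d)) (ξ : E d) : 0 ≤ phi σ ξ :=
  integral_nonneg fun y => by
    have := Real.cos_le_one (inner ℝ ξ y)
    simp only [Pi.zero_apply]; linarith

theorem phiC_ofReal {d : ℕ} (σ : Measure (E d)) (ξ η : E d) (a : ℝ) :
    phiC σ ξ η a = phi σ (ξ + a • η) := by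
  rw [phiC, phi, ← integral_complex_ofReal]
  congr 1
  ext y
  rw [inner_add_left, inner_smul_left]
  push_cast
  simp

/-- The real part of the parameter moves into the base frequency, so only purely imaginary shifts
need an estimate. -/
theorem phiC_eq_shift {d : ℕ} (σ : Measure (E d)) (ξ η : E d) (a b : ℝ) :
    phiC σ ξ η (a + b * Complex.I) = phiC σ (ξ + a • η) η (b * Complex.I) := by
  simp only [phiC]
  congr 1
  ext y
  rw [inner_add_left, inner_smul_left]
  push_cast
  simp only [conj_trivial]
  congr 2
  ring

theorem measurable_phi {d : ℕ} (σ : Measure (E d)) [SFinite σ] : Measurable (phi σ) := by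
  have : StronglyMeasurable fun z : E d × E d => 1 - Real.cos (inner ℝ z.1 z.2) :=
    Continuous.stronglyMeasurable (by fun_prop)
  exact this.integral_prod_right.measurable

theorem measurable_phiC {d : ℕ} (σ : Measure (E d)) [SFinite σ] (η : E d) (z : ℂ) :
    Measurable fun ξ => phiC σ ξ η z := by
  have : StronglyMeasurable fun w : E d × E d =>
      1 - Complex.cos ((inner ℝ w.1 w.2 : ℝ) + z * (inner ℝ η w.2 : ℝ)) :=
    Continuous.stronglyMeasurable (by fun_prop)
  exact this.integral_prod_right.measurable

section BoundedSupport

variable {d : ℕ} {σ : Measure (E d)} {g : ℝ} (hsupp : ∀ᵐ y ∂σ, ‖y‖ ≤ g)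
  (hsq : Integrable (fun y : E d => ‖y‖ ^ 2) σ)

include hsupp

theorem ae_norm_one_sub_cos_le (ξ η : E d) (z : ℂ) {B : ℝ} (hB : ‖z‖ ≤ B) :
    ∀ᵐ y ∂σ, ‖1 - Complex.cos ((inner ℝ ξ y : ℝ) + z * (inner ℝ η y : ℝ))‖
      ≤ (‖ξ‖ + B * ‖η‖) ^ 2 * Real.exp ((‖ξ‖ + B * ‖η‖) * g) * ‖y‖ ^ 2 := by
  filter_upwards [hsupp] with y hy
  have hB0 : 0 ≤ B := (norm_nonneg z).trans hB
  have h1 : ‖((inner ℝ ξ y : ℝ) : ℂ) + z * (inner ℝ η y : ℝ)‖ ≤ (‖ξ‖ + B * ‖η‖) * ‖y‖ := by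
    refine (norm_add_le _ _).trans ?_
    rw [norm_mul, Complex.norm_real, Complex.norm_real]
    have h2 := norm_inner_le_norm (𝕜 := ℝ) ξ y
    have h3 := norm_inner_le_norm (𝕜 := ℝ) η y
    calc _ ≤ ‖ξ‖ * ‖y‖ + B * (‖η‖ * ‖y‖) := by gcongr
      _ = _ := by ring
  refine (Complex.norm_one_sub_cos_le _).trans ?_
  calc _ ≤ ((‖ξ‖ + B * ‖η‖) * ‖y‖) ^ 2 * Real.exp ((‖ξ‖ + B * ‖η‖) * g) := by
        gcongr
        exact h1.trans (by gcongr)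
    _ = _ := by ring

include hsq

theorem integrable_one_sub_cos (ξ η : E d) (z : ℂ) :
    Integrable (fun y => 1 - Complex.cos ((inner ℝ ξ y : ℝ) + z * (inner ℝ η y : ℝ))) σ :=
  (hsq.const_mul _).mono' (Continuous.aestronglyMeasurable (by fun_prop))
    (ae_norm_one_sub_cos_le hsupp ξ η z le_rfl)

theorem differentiable_phiC (ξ η : E d) : Differentiable ℂ (phiC σ ξ η) := by
  refine differentiable_integral_of_dominated (fun y => by fun_prop)
    (fun z => Continuous.aestronglyMeasurable (by fun_prop)) fun z₀ => ?_
  refine ⟨_, hsq.const_mul ((‖ξ‖ + (‖z₀‖ + 2) * ‖η‖) ^ 2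
    * Real.exp ((‖ξ‖ + (‖z₀‖ + 2) * ‖η‖) * g)), ?_⟩
  filter_upwards [hsupp] with y hy z hz
  have hz' : ‖z‖ ≤ ‖z₀‖ + 2 := by
    have := norm_le_norm_add_norm_sub' z z₀
    have h2 : ‖z - z₀‖ ≤ 2 := by simpa [dist_eq_norm] using hz
    linarith
  have hB0 : 0 ≤ ‖z₀‖ + 2 := by positivity
  -- Using the almost-everywhere bound for a Dirac mass at y makes it pointwise in y, hence valid
  -- for all z in the disc at once.
  have := ae_norm_one_sub_cos_le (σ := Measure.dirac y) (g := g)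
    ((ae_dirac_iff (by measurability)).mpr hy) ξ η z hz'
  rwa [ae_dirac_iff] at this
  exact measurableSet_le (by fun_prop) (by fun_prop)

theorem integrable_cosh_sub_one (η : E d) :
    Integrable (fun y => Real.cosh (inner ℝ η y) - 1) σ := by
  have h1 := (integrable_one_sub_cos hsupp hsq 0 η Complex.I).re.neg
  refine h1.congr (Eventually.of_forall fun y => ?_)
  simp [mul_comm Complex.I, Complex.cos_mul_I, ← Complex.ofReal_cosh]

theorem integrable_one_sub_cos_real (ξ : E d) :
    Integrable (fun y => 1 - Real.cos (inner ℝ ξ y)) σ := by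
  have h1 := (integrable_one_sub_cos hsupp hsq ξ 0 0).re
  refine h1.congr (Eventually.of_forall fun y => ?_)
  simp [← Complex.ofReal_cos]

/-- Re cos(u + iv) = cos u cosh v, and the difference of the two integrands is (cosh v - 1)(1 - cos
u) ≥ 0. The price of an imaginary shift is therefore independent of ξ. -/
theorem phi_sub_le_re_phiC (ξ η : E d) (b : ℝ) :
    phi σ ξ - ∫ y, (Real.cosh (b * inner ℝ η y) - 1) ∂σ ≤ (phiC σ ξ η (b * Complex.I)).re := by
  have h1 := integrable_one_sub_cos hsupp hsq ξ η (b * Complex.I)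
  have h2 := integrable_cosh_sub_one hsupp hsq (b • η)
  have h3 := integrable_one_sub_cos_real hsupp hsq ξ
  simp only [inner_smul_left, conj_trivial] at h2
  rw [phiC, phi, ← integral_sub h3 h2]
  have h4 : (∫ y, (1 - Complex.cos ((inner ℝ ξ y : ℝ) + b * Complex.I * (inner ℝ η y : ℝ))) ∂σ).re
      = ∫ y, (1 - Complex.cos ((inner ℝ ξ y : ℝ) + b * Complex.I * (inner ℝ η y : ℝ))).re ∂σ :=
    (integral_re h1).symm
  rw [h4]
  refine integral_mono (h3.sub h2) h1.re fun y => ?_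
  have h5 : ((inner ℝ ξ y : ℝ) : ℂ) + b * Complex.I * (inner ℝ η y : ℝ)
      = ((inner ℝ ξ y : ℝ) : ℂ) + ((b * inner ℝ η y : ℝ) : ℂ) * Complex.I := by
    push_cast; ring
  simp only [h5]
  rw [Complex.cos_add_mul_I, ← Complex.ofReal_cos, ← Complex.ofReal_cosh, ← Complex.ofReal_sin,
    ← Complex.ofReal_sinh, ← Complex.ofReal_mul, ← Complex.ofReal_mul]
  simp only [Complex.sub_re, Complex.one_re, Complex.ofReal_re, Complex.mul_re, Complex.I_re,
    Complex.I_im, Complex.ofReal_im, mul_zero, zero_mul, sub_zero]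
  have h6 := Real.cos_le_one (inner ℝ ξ y)
  have h7 := Real.one_le_cosh (b * inner ℝ η y)
  nlinarith

theorem integral_cosh_sub_one_le (η : E d) :
    ∫ y, (Real.cosh (inner ℝ η y) - 1) ∂σ
      ≤ ‖η‖ ^ 2 * Real.exp (‖η‖ * g) * ∫ y, ‖y‖ ^ 2 ∂σ := by
  rw [← integral_const_mul]
  refine integral_mono_ae (integrable_cosh_sub_one hsupp hsq η) (hsq.const_mul _) ?_
  filter_upwards [hsupp] with y hy
  have h1 : |inner ℝ η y| ≤ ‖η‖ * ‖y‖ := abs_real_inner_le_norm η y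
  calc _ ≤ (inner ℝ η y) ^ 2 * Real.exp |inner ℝ η y| := cosh_sub_one_le _
    _ = |inner ℝ η y| ^ 2 * Real.exp |inner ℝ η y| := by rw [sq_abs]
    _ ≤ (‖η‖ * ‖y‖) ^ 2 * Real.exp (‖η‖ * g) := by
        gcongr
        exact h1.trans (by gcongr)
    _ = _ := by ring

end BoundedSupport

/-! ### Contour shift for the density of the small jumps. -/

theorem integrable_decay (d : ℕ) :
    Integrable (fun v : E d => ((1 + ‖v‖) ^ (d + 1))⁻¹) := by
  have h := integrable_one_add_norm (E := E d) (μ := volume) (r := (d : ℝ) + 1) (by simp)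
  refine h.congr (Eventually.of_forall fun v => ?_)
  have : (0 : ℝ) < 1 + ‖v‖ := by positivity
  simp only
  rw [Real.rpow_neg this.le]
  congr 1
  exact_mod_cast Real.rpow_natCast _ (d + 1)

theorem integrable_decay_smul (d : ℕ) {g : ℝ} (hg : 0 < g) :
    Integrable (fun v : E d => ((1 + g * ‖v‖) ^ (d + 1))⁻¹) := by
  have h := (integrable_decay d).comp_smul hg.ne'
  refine h.congr (Eventually.of_forall fun v => ?_)
  simp only [norm_smul, Real.norm_of_nonneg hg.le]

/-- The integral of `(1 + ‖v‖)^(-d-1)`. -/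
noncomputable def decayMass (d : ℕ) : ℝ := ∫ v : E d, ((1 + ‖v‖) ^ (d + 1))⁻¹

theorem decayMass_nonneg (d : ℕ) : 0 ≤ decayMass d := integral_nonneg fun v => by
  simp only [Pi.zero_apply]; positivity

theorem integral_decay_smul (d : ℕ) {g : ℝ} (hg : 0 < g) :
    ∫ v : E d, ((1 + g * ‖v‖) ^ (d + 1))⁻¹ = (g ^ d)⁻¹ * decayMass d := by
  have h := Measure.integral_comp_smul_of_nonneg (volume : Measure (E d))
    (fun v : E d => ((1 + ‖v‖) ^ (d + 1))⁻¹) g (hR := hg.le)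
  rw [finrank_euclideanSpace_fin, smul_eq_mul] at h
  rw [decayMass, ← h]
  simp only [norm_smul, Real.norm_of_nonneg hg.le]

/-- A Peetre-type inequality: translating the argument of the decay function costs only a factor
depending on the translation. The factor 2π only helps. -/
theorem one_add_mul_norm_le {d : ℕ} {g : ℝ} (hg : 0 < g) (v w : E d) :
    1 + g * ‖v‖ ≤ (1 + g * ‖(2 * Real.pi) • v + w‖) * (1 + g * ‖w‖) := by
  have h1 : ‖v‖ ≤ ‖(2 * Real.pi) • v‖ := by
    rw [norm_smul, Real.norm_of_nonneg (by positivity)]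
    have : 1 ≤ 2 * Real.pi := by have := Real.pi_gt_three; linarith
    nlinarith [norm_nonneg v]
  have h2 : ‖(2 * Real.pi) • v‖ ≤ ‖(2 * Real.pi) • v + w‖ + ‖w‖ := by
    have := norm_sub_le ((2 * Real.pi) • v + w) w
    simpa using this
  have h3 : 0 ≤ g * ‖(2 * Real.pi) • v + w‖ * (g * ‖w‖) := by positivity
  nlinarith [mul_le_mul_of_nonneg_left (h1.trans h2) hg.le]

theorem decay_shift_le {d : ℕ} {g : ℝ} (hg : 0 < g) (v w : E d) :
    ((1 + g * ‖(2 * Real.pi) • v + w‖) ^ (d + 1))⁻¹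
      ≤ (1 + g * ‖w‖) ^ (d + 1) * ((1 + g * ‖v‖) ^ (d + 1))⁻¹ := by
  have h := pow_le_pow_left₀ (by positivity) (one_add_mul_norm_le hg v w) (d + 1)
  rw [mul_pow] at h
  rw [inv_le_iff_one_le_mul₀ (by positivity), mul_assoc, mul_comm, mul_assoc, inv_mul_eq_div,
    le_div_iff₀ (by positivity), one_mul]
  exact h

section Shift

variable {d : ℕ} {σ : Measure (E d)} {g A : ℝ}

/-- The integrand of the Fourier integral, continued analytically in the direction `η`. -/
noncomputable def shiftIntegrand (σ : Measure (E d)) (x η : E d) (z : ℂ) (v : E d) : ℂ :=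
  Complex.exp (-Complex.I * ((2 * Real.pi * inner ℝ v x : ℝ) + z * (inner ℝ η x : ℝ))
    - phiC σ ((2 * Real.pi) • v) η z)

/-- A real shift by a is the translation of v by aη/(2π), under which Lebesgue measure is invariant.
-/
theorem integral_shiftIntegrand_ofReal (x η : E d) (a : ℝ) :
    ∫ v, shiftIntegrand σ x η a v = ∫ v, shiftIntegrand σ x η 0 v := by
  have h : ∀ v, shiftIntegrand σ x η a v
      = shiftIntegrand σ x η 0 (v + (a / (2 * Real.pi)) • η) := by
    intro v
    have hpi : (2 * Real.pi) ≠ 0 := by positivity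
    have h0 := phiC_ofReal σ ((2 * Real.pi) • (v + (a / (2 * Real.pi)) • η)) η 0
    rw [Complex.ofReal_zero, zero_smul, add_zero] at h0
    simp only [shiftIntegrand]
    rw [phiC_ofReal, h0, smul_add, smul_smul, mul_div_cancel₀ _ hpi, inner_add_left,
      inner_smul_left, conj_trivial, mul_add (2 * Real.pi), ← mul_assoc (2 * Real.pi) (a / _),
      mul_div_cancel₀ _ hpi]
    push_cast
    ring_nf
  simp only [h]
  exact integral_add_right_eq_self (fun v => shiftIntegrand σ x η 0 v) _

theorem decay_two_pi (hg : 0 < g)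
    (hdec : ∀ ξ, Real.exp (-phi σ ξ) ≤ A * ((1 + g * ‖ξ‖) ^ (d + 1))⁻¹) (hA : 0 ≤ A) (v : E d) :
    Real.exp (-phi σ ((2 * Real.pi) • v)) ≤ A * ((1 + g * ‖v‖) ^ (d + 1))⁻¹ := by
  refine (hdec _).trans (mul_le_mul_of_nonneg_left ?_ hA)
  simpa using decay_shift_le hg v 0

theorem integrable_exp_neg_phi [SFinite σ] (hg : 0 < g) (hA : 0 ≤ A)
    (hdec : ∀ ξ, Real.exp (-phi σ ξ) ≤ A * ((1 + g * ‖ξ‖) ^ (d + 1))⁻¹) :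
    Integrable fun v : E d => Real.exp (-phi σ ((2 * Real.pi) • v)) := by
  refine ((integrable_decay_smul d hg).const_mul A).mono' ?_ (Eventually.of_forall fun v => ?_)
  · exact (((measurable_phi σ).comp (measurable_const_smul _)).neg.exp).aestronglyMeasurable
  · rw [Real.norm_of_nonneg (Real.exp_pos _).le]
    exact decay_two_pi hg hdec hA v

theorem integral_exp_neg_phi_le [SFinite σ] (hg : 0 < g) (hA : 0 ≤ A)
    (hdec : ∀ ξ, Real.exp (-phi σ ξ) ≤ A * ((1 + g * ‖ξ‖) ^ (d + 1))⁻¹) :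
    ∫ v : E d, Real.exp (-phi σ ((2 * Real.pi) • v)) ≤ A * ((g ^ d)⁻¹ * decayMass d) := by
  rw [← integral_decay_smul d hg, ← integral_const_mul]
  exact integral_mono (integrable_exp_neg_phi hg hA hdec)
    ((integrable_decay_smul d hg).const_mul A) fun v => decay_two_pi hg hdec hA v

variable (hsupp : ∀ᵐ y ∂σ, ‖y‖ ≤ g) (hsq : Integrable (fun y : E d => ‖y‖ ^ 2) σ)

include hsupp hsq

theorem norm_shiftIntegrand_le (x η v : E d) (a b : ℝ) :
    ‖shiftIntegrand σ x η (a + b * Complex.I) v‖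
      ≤ Real.exp (b * inner ℝ η x + ∫ y, (Real.cosh (b * inner ℝ η y) - 1) ∂σ)
        * Real.exp (-phi σ ((2 * Real.pi) • v + a • η)) := by
  rw [shiftIntegrand, Complex.norm_exp, ← Real.exp_add, phiC_eq_shift]
  refine Real.exp_le_exp.mpr ?_
  have h := phi_sub_le_re_phiC hsupp hsq ((2 * Real.pi) • v + a • η) η b
  rw [Complex.sub_re]
  have h2 : (-Complex.I * ((2 * Real.pi * inner ℝ v x : ℝ)
      + ((a : ℂ) + b * Complex.I) * (inner ℝ η x : ℝ))).re = b * inner ℝ η x := by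
    simp
  rw [h2]
  linarith

theorem norm_shiftIntegrand_le_of_mem (hg : 0 < g) (hA : 0 ≤ A)
    (hdec : ∀ ξ, Real.exp (-phi σ ξ) ≤ A * ((1 + g * ‖ξ‖) ^ (d + 1))⁻¹) (x η v : E d) {z : ℂ}
    {B : ℝ} (hB : ‖z‖ ≤ B) :
    ‖shiftIntegrand σ x η z v‖
      ≤ Real.exp (B * (‖η‖ * ‖x‖) + (B * ‖η‖) ^ 2 * Real.exp (B * ‖η‖ * g) * ∫ y, ‖y‖ ^ 2 ∂σ)
        * (A * ((1 + g * (B * ‖η‖)) ^ (d + 1) * ((1 + g * ‖v‖) ^ (d + 1))⁻¹)) := by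
  have hre : |z.re| ≤ B := (Complex.abs_re_le_norm z).trans hB
  have him : |z.im| ≤ B := (Complex.abs_im_le_norm z).trans hB
  have hB0 : 0 ≤ B := (norm_nonneg z).trans hB
  have hI : 0 ≤ ∫ y, ‖y‖ ^ 2 ∂σ := integral_nonneg fun y => by simp only [Pi.zero_apply]; positivity
  have h0 := norm_shiftIntegrand_le hsupp hsq x η v z.re z.im
  rw [Complex.re_add_im] at h0
  refine h0.trans (mul_le_mul (Real.exp_le_exp.mpr (add_le_add ?_ ?_)) ?_
    (Real.exp_pos _).le (Real.exp_pos _).le)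
  · refine (le_abs_self _).trans ?_
    rw [abs_mul]
    exact mul_le_mul him (abs_real_inner_le_norm η x) (abs_nonneg _) hB0
  · have h1 := integral_cosh_sub_one_le hsupp hsq (z.im • η)
    simp only [inner_smul_left, conj_trivial] at h1
    refine h1.trans ?_
    rw [norm_smul, Real.norm_eq_abs]
    gcongr
  · refine (hdec _).trans ?_
    gcongr
    refine (decay_shift_le hg v _).trans ?_
    gcongr
    rw [norm_smul, Real.norm_eq_abs]
    gcongr

theorem differentiable_integral_shiftIntegrand [SFinite σ] (hg : 0 < g) (hA : 0 ≤ A)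
    (hdec : ∀ ξ, Real.exp (-phi σ ξ) ≤ A * ((1 + g * ‖ξ‖) ^ (d + 1))⁻¹) (x η : E d) :
    Differentiable ℂ fun z => ∫ v, shiftIntegrand σ x η z v := by
  refine differentiable_integral_of_dominated (fun v => ?_) (fun z => ?_) fun z₀ => ?_
  · have := differentiable_phiC hsupp hsq ((2 * Real.pi) • v) η
    unfold shiftIntegrand
    fun_prop
  · have h1 : Measurable fun v : E d => phiC σ ((2 * Real.pi) • v) η z :=
      (measurable_phiC σ η z).comp (measurable_const_smul _)
    have h2 : Continuous fun v : E d =>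
        -Complex.I * ((2 * Real.pi * inner ℝ v x : ℝ) + z * (inner ℝ η x : ℝ)) := by fun_prop
    exact (h2.measurable.sub h1).cexp.aestronglyMeasurable
  · refine ⟨_, (((integrable_decay_smul d hg).const_mul
      ((1 + g * ((‖z₀‖ + 2) * ‖η‖)) ^ (d + 1))).const_mul A).const_mul
      (Real.exp ((‖z₀‖ + 2) * (‖η‖ * ‖x‖)
        + ((‖z₀‖ + 2) * ‖η‖) ^ 2 * Real.exp ((‖z₀‖ + 2) * ‖η‖ * g) * ∫ y, ‖y‖ ^ 2 ∂σ)),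
      Eventually.of_forall fun v z hz => ?_⟩
    refine norm_shiftIntegrand_le_of_mem hsupp hsq hg hA hdec x η v ?_
    have := norm_le_norm_add_norm_sub' z z₀
    have h2 : ‖z - z₀‖ ≤ 2 := by simpa [dist_eq_norm] using hz
    linarith

/-- In place of moving a contour: the integral is entire in z and constant at the points 1/(n+1),
which accumulate at 0, so the identity theorem makes it constant. -/
theorem integral_shiftIntegrand_eq [SFinite σ] (hg : 0 < g) (hA : 0 ≤ A)
    (hdec : ∀ ξ, Real.exp (-phi σ ξ) ≤ A * ((1 + g * ‖ξ‖) ^ (d + 1))⁻¹) (x η : E d) (z : ℂ) :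
    ∫ v, shiftIntegrand σ x η z v = ∫ v, shiftIntegrand σ x η 0 v := by
  have hd := differentiable_integral_shiftIntegrand hsupp hsq hg hA hdec x η
  have h1 : AnalyticOnNhd ℂ (fun z => ∫ v, shiftIntegrand σ x η z v) Set.univ :=
    hd.differentiableOn.analyticOnNhd isOpen_univ
  refine congrFun (h1.eq_of_frequently_eq (z₀ := 0) (analyticOnNhd_const
    (v := ∫ v, shiftIntegrand σ x η 0 v)) ?_) z
  have h2 : Tendsto (fun n : ℕ => (((1 / ((n : ℝ) + 1) : ℝ)) : ℂ)) atTop (𝓝[≠] 0) := by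
    rw [tendsto_nhdsWithin_iff]
    constructor
    · have := (Complex.continuous_ofReal.tendsto 0).comp
        (tendsto_one_div_add_atTop_nhds_zero_nat (𝕜 := ℝ))
      exact this
    · filter_upwards with n
      have : (1 / ((n : ℝ) + 1)) ≠ 0 := by positivity
      exact Complex.ofReal_ne_zero.mpr this
  refine h2.frequently (Eventually.frequently (Eventually.of_forall fun n => ?_))
  exact integral_shiftIntegrand_ofReal x η _

/-- Exponential decay of the Fourier transform of `exp (-phi)`, by a shift of the contour. -/
theorem norm_fourier_exp_neg_phi_le [SFinite σ] (hg : 0 < g) (hA : 0 ≤ A)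
    (hdec : ∀ ξ, Real.exp (-phi σ ξ) ≤ A * ((1 + g * ‖ξ‖) ^ (d + 1))⁻¹) (x η : E d) :
    ‖𝓕 (fun v => ((Real.exp (-phi σ ((2 * Real.pi) • v)) : ℝ) : ℂ)) x‖
      ≤ Real.exp (-inner ℝ η x + ‖η‖ ^ 2 * Real.exp (‖η‖ * g) * ∫ y, ‖y‖ ^ 2 ∂σ)
        * (A * ((g ^ d)⁻¹ * decayMass d)) := by
  have h1 : 𝓕 (fun v => ((Real.exp (-phi σ ((2 * Real.pi) • v)) : ℝ) : ℂ)) x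
      = ∫ v, shiftIntegrand σ x η 0 v := by
    rw [Real.fourier_eq']
    congr 1
    ext v
    have h0 := phiC_ofReal σ ((2 * Real.pi) • v) η 0
    rw [Complex.ofReal_zero, zero_smul, add_zero] at h0
    rw [shiftIntegrand, h0, smul_eq_mul, Complex.ofReal_exp, ← Complex.exp_add]
    congr 1
    push_cast
    ring
  have hint := integrable_exp_neg_phi hg hA hdec
  -- The value z = -i turns the oscillating phase into the gain exp(-⟨η,x⟩).
  rw [h1, ← integral_shiftIntegrand_eq hsupp hsq hg hA hdec x η (-Complex.I)]
  have h2 := integral_cosh_sub_one_le hsupp hsq η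
  have h3 : ∀ v, ‖shiftIntegrand σ x η (-Complex.I) v‖
      ≤ Real.exp (-inner ℝ η x + ‖η‖ ^ 2 * Real.exp (‖η‖ * g) * ∫ y, ‖y‖ ^ 2 ∂σ)
        * Real.exp (-phi σ ((2 * Real.pi) • v)) := by
    intro v
    have h4 := norm_shiftIntegrand_le hsupp hsq x η v 0 (-1)
    have h5 : ((0 : ℝ) : ℂ) + ((-1 : ℝ) : ℂ) * Complex.I = -Complex.I := by simp
    rw [h5, zero_smul, add_zero] at h4
    refine h4.trans ?_
    gcongr
    · simp
    · simpa using h2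
  refine (norm_integral_le_of_norm_le (hint.const_mul _) (Eventually.of_forall h3)).trans ?_
  rw [integral_const_mul]
  gcongr
  exact integral_exp_neg_phi_le hg hA hdec

/-- The contour shift along `x`, with a parameter `τ`. -/
theorem norm_fourier_exp_neg_phi_le_exp [SFinite σ] (hg : 0 < g) (hA : 0 ≤ A)
    (hdec : ∀ ξ, Real.exp (-phi σ ξ) ≤ A * ((1 + g * ‖ξ‖) ^ (d + 1))⁻¹)
    (hsq' : ∫ y, ‖y‖ ^ 2 ∂σ ≤ A * g ^ 2) (x : E d) {τ : ℝ} (hτ : 0 ≤ τ) :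
    ‖𝓕 (fun v => ((Real.exp (-phi σ ((2 * Real.pi) • v)) : ℝ) : ℂ)) x‖
      ≤ Real.exp (-τ * (‖x‖ / g) + A * τ ^ 2 * Real.exp τ)
        * (A * ((g ^ d)⁻¹ * decayMass d)) := by
  have hK := decayMass_nonneg d
  -- The shift has length τ/g and points along x; at x = 0 the convention 0⁻¹ = 0 gives the zero
  -- shift, which is harmless.
  refine (norm_fourier_exp_neg_phi_le hsupp hsq hg hA hdec x ((τ / g * ‖x‖⁻¹) • x)).trans ?_
  have h1 : ‖(τ / g * ‖x‖⁻¹) • x‖ ≤ τ / g := by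
    rw [norm_smul, Real.norm_of_nonneg (by positivity), mul_assoc]
    exact mul_le_of_le_one_right (by positivity) (inv_mul_le_one)
  have h2 : inner ℝ ((τ / g * ‖x‖⁻¹) • x) x = τ * (‖x‖ / g) := by
    rw [inner_smul_left, real_inner_self_eq_norm_sq, conj_trivial]
    rcases eq_or_ne ‖x‖ 0 with h | h
    · simp [h]
    · field_simp
  rw [h2]
  have hI : 0 ≤ ∫ y, ‖y‖ ^ 2 ∂σ := integral_nonneg fun y => by simp only [Pi.zero_apply]; positivity
  refine mul_le_mul_of_nonneg_right (Real.exp_le_exp.mpr (add_le_add (by linarith) ?_))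
    (by positivity)
  calc _ ≤ (τ / g) ^ 2 * Real.exp (τ / g * g) * (A * g ^ 2) := by gcongr
    _ = _ := by
      rw [div_mul_cancel₀ _ hg.ne']
      field_simp

end Shift

/-! ### The compound Poisson law of the large jumps. -/

section CompoundPoisson

variable {d : ℕ} (ρ : Measure (E d)) [IsFiniteMeasure ρ]

/-- Iterated convolutions of a measure. -/
noncomputable def convPow (ρ : Measure (E d)) : ℕ → Measure (E d)
  | 0 => Measure.dirac 0
  | n + 1 => Measure.conv (convPow ρ n) ρ

instance isFiniteMeasure_convPow : ∀ n, IsFiniteMeasure (convPow ρ n)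
  | 0 => by unfold convPow; infer_instance
  | n + 1 => by
      have := isFiniteMeasure_convPow n
      unfold convPow
      infer_instance

theorem lintegral_convPow_succ (n : ℕ) {f : E d → ℝ≥0∞} (hf : Measurable f) :
    ∫⁻ z, f z ∂(convPow ρ (n + 1)) = ∫⁻ x, ∫⁻ y, f (x + y) ∂ρ ∂(convPow ρ n) := by
  rw [convPow, Measure.lintegral_conv hf]

theorem convPow_univ : ∀ n, convPow ρ n Set.univ = ρ Set.univ ^ n
  | 0 => by simp [convPow]
  | n + 1 => by
      have h := lintegral_convPow_succ ρ n (f := fun _ => 1) measurable_const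
      simp only [lintegral_const, one_mul, convPow_univ n] at h
      rw [h, pow_succ, mul_comm]

theorem charFun_convPow (ξ : E d) : ∀ n, charFun (convPow ρ n) ξ = charFun ρ ξ ^ n
  | 0 => by simp [convPow]
  | n + 1 => by rw [convPow, charFun_conv, charFun_convPow ξ n, pow_succ]

/-- The compound Poisson distribution with Lévy measure `ρ`. -/
noncomputable def compoundPoisson (ρ : Measure (E d)) : Measure (E d) :=
  ENNReal.ofReal (Real.exp (-ρ.real Set.univ)) •
    Measure.sum fun n : ℕ => ENNReal.ofReal (1 / (n.factorial : ℝ)) • convPow ρ n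

theorem sum_convPow_univ : (Measure.sum fun n : ℕ =>
    ENNReal.ofReal (1 / (n.factorial : ℝ)) • convPow ρ n) Set.univ
      = ENNReal.ofReal (Real.exp (ρ.real Set.univ)) := by
  rw [Measure.sum_apply _ MeasurableSet.univ]
  have h1 : ∀ n : ℕ, (ENNReal.ofReal (1 / (n.factorial : ℝ)) • convPow ρ n) Set.univ
      = ENNReal.ofReal (ρ.real Set.univ ^ n / (n.factorial : ℝ)) := by
    intro n
    rw [Measure.smul_apply, convPow_univ, smul_eq_mul, ← ofReal_measureReal,
      ← ENNReal.ofReal_pow measureReal_nonneg, ← ENNReal.ofReal_mul (by positivity)]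
    congr 1
    ring
  simp only [h1]
  rw [← ENNReal.ofReal_tsum_of_nonneg (fun n => by positivity)
    (Real.summable_pow_div_factorial _), Real.exp_eq_exp_ℝ, NormedSpace.exp_eq_tsum_div]

instance isProbabilityMeasure_compoundPoisson : IsProbabilityMeasure (compoundPoisson ρ) := by
  constructor
  rw [compoundPoisson, Measure.smul_apply, sum_convPow_univ, smul_eq_mul,
    ← ENNReal.ofReal_mul (Real.exp_pos _).le, ← Real.exp_add]
  simp

theorem charFun_compoundPoisson (ξ : E d) :
    charFun (compoundPoisson ρ) ξ = Complex.exp (charFun ρ ξ - ρ.real Set.univ) := by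
  have hfin : IsFiniteMeasure (Measure.sum fun n : ℕ =>
      ENNReal.ofReal (1 / (n.factorial : ℝ)) • convPow ρ n) :=
    ⟨by rw [sum_convPow_univ]; exact ENNReal.ofReal_lt_top⟩
  have hi : Integrable (fun x : E d => Complex.exp ((inner ℝ x ξ : ℝ) * Complex.I))
      (Measure.sum fun n : ℕ => ENNReal.ofReal (1 / (n.factorial : ℝ)) • convPow ρ n) := by
    refine Integrable.of_bound (C := 1) (Continuous.aestronglyMeasurable (by fun_prop)) ?_
    exact Eventually.of_forall fun x => (Complex.norm_exp_ofReal_mul_I _).le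
  have hs := hasSum_integral_measure hi
  have h1 : ∀ n : ℕ, ∫ x, Complex.exp ((inner ℝ x ξ : ℝ) * Complex.I)
      ∂(ENNReal.ofReal (1 / (n.factorial : ℝ)) • convPow ρ n)
      = charFun ρ ξ ^ n / (n.factorial : ℂ) := by
    intro n
    rw [integral_smul_measure, ← charFun_apply, charFun_convPow,
      ENNReal.toReal_ofReal (by positivity), Complex.real_smul]
    push_cast
    ring
  simp only [h1] at hs
  have h2 := hs.unique (NormedSpace.expSeries_div_hasSum_exp (charFun ρ ξ))
  rw [compoundPoisson, charFun_apply, integral_smul_measure, h2,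
    ENNReal.toReal_ofReal (Real.exp_pos _).le, Complex.real_smul, sub_eq_add_neg, add_comm,
    Complex.exp_add, Complex.exp_eq_exp_ℂ]
  push_cast
  rw [Complex.exp_eq_exp_ℂ]

/-- A sum of n+1 jumps of norm at least (n+1)r contains a jump of norm at least r. That jump is
integrated first, with the sum of the others as a translation; this is why B must be uniform in w.
The other n jumps contribute total mass, and n+1 counts the choices. -/
theorem lintegral_convPow_le {q : E d → ℝ≥0∞} (hq : Measurable q) {r : ℝ} {B : ℝ≥0∞}
    (hB : ∀ w, ∫⁻ y in {y | r ≤ ‖y‖}, q (w - y) ∂ρ ≤ B) (n : ℕ) (w : E d) :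
    ∫⁻ y in {y | (n + 1) * r ≤ ‖y‖}, q (w - y) ∂(convPow ρ (n + 1))
      ≤ (n + 1) * ρ Set.univ ^ n * B := by
  have hms : ∀ s : ℝ, MeasurableSet {y : E d | s ≤ ‖y‖} := fun s =>
    measurableSet_le measurable_const measurable_norm
  have hqw : ∀ w, Measurable fun y => q (w - y) := fun w => hq.comp (measurable_const.sub measurable_id)
  have hind : ∀ (s : ℝ) (w : E d),
      Measurable ({y : E d | s ≤ ‖y‖}.indicator fun y => q (w - y)) := fun s w =>
    (hqw w).indicator (hms s)
  induction n generalizing w with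
  | zero =>
    have h : convPow ρ (0 + 1) = ρ := by simp [convPow]
    rw [h]
    simpa using hB w
  | succ n ih =>
    rw [← lintegral_indicator (hms _), lintegral_convPow_succ ρ _ (hind _ _)]
    -- Either the last jump y has norm at least r, or the sum x of the previous ones is long enough
    -- for the induction hypothesis.
    have hsplit : ∀ x y : E d, ({y : E d | ((n + 1 : ℕ) + 1 : ℝ) * r ≤ ‖y‖}.indicator
        (fun y => q (w - y))) (x + y)
        ≤ ({y : E d | r ≤ ‖y‖}.indicator (fun y => q ((w - x) - y))) y
          + ({y : E d | ((n : ℝ) + 1) * r ≤ ‖y‖}.indicator (fun x => q ((w - y) - x))) x := by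
      intro x y
      by_cases h : x + y ∈ {y : E d | ((n + 1 : ℕ) + 1 : ℝ) * r ≤ ‖y‖}
      · rw [Set.indicator_of_mem h]
        by_cases hy : r ≤ ‖y‖
        · rw [Set.indicator_of_mem (show y ∈ {y : E d | r ≤ ‖y‖} from hy), sub_sub]
          exact le_self_add
        · have hx : x ∈ {y : E d | ((n : ℝ) + 1) * r ≤ ‖y‖} := by
            have h1 := norm_add_le x y
            simp only [Set.mem_ofPred_eq, Nat.cast_add, Nat.cast_one] at h ⊢
            push Not at hy
            linarith
          rw [Set.indicator_of_mem hx, sub_sub, add_comm y x]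
          exact le_add_self
      · rw [Set.indicator_of_notMem h]
        exact zero_le
    have hm2 : Measurable fun z : E d × E d =>
        ({y : E d | ((n : ℝ) + 1) * r ≤ ‖y‖}.indicator (fun x => q ((w - z.2) - x))) z.1 := by
      have h1 : Measurable fun z : E d × E d => q ((w - z.2) - z.1) := by fun_prop
      exact h1.indicator ((hms (((n : ℝ) + 1) * r)).preimage measurable_fst)
    calc _ ≤ ∫⁻ x, ((∫⁻ y, ({y : E d | r ≤ ‖y‖}.indicator (fun y => q ((w - x) - y))) y ∂ρ)
          + ∫⁻ y, ({y : E d | ((n : ℝ) + 1) * r ≤ ‖y‖}.indicator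
            (fun x => q ((w - y) - x))) x ∂ρ) ∂(convPow ρ (n + 1)) := by
          refine lintegral_mono fun x => ?_
          rw [← lintegral_add_left (hind _ _)]
          exact lintegral_mono fun y => hsplit x y
      _ ≤ ∫⁻ x, (B + ∫⁻ y, ({y : E d | ((n : ℝ) + 1) * r ≤ ‖y‖}.indicator
            (fun x => q ((w - y) - x))) x ∂ρ) ∂(convPow ρ (n + 1)) := by
          refine lintegral_mono fun x => ?_
          gcongr
          rw [lintegral_indicator (hms _)]
          exact hB _
      _ = B * ρ Set.univ ^ (n + 1) + ∫⁻ y, ∫⁻ x, ({y : E d | ((n : ℝ) + 1) * r ≤ ‖y‖}.indicator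
            (fun x => q ((w - y) - x))) x ∂(convPow ρ (n + 1)) ∂ρ := by
          rw [lintegral_add_left measurable_const, lintegral_const, convPow_univ,
            lintegral_lintegral_swap hm2.aemeasurable]
      _ ≤ B * ρ Set.univ ^ (n + 1) + ∫⁻ _, (n + 1) * ρ Set.univ ^ n * B ∂ρ := by
          gcongr with y
          rw [lintegral_indicator (hms _)]
          exact ih _
      _ = _ := by
          rw [lintegral_const]
          push_cast
          ring

/-- With n+1 jumps the threshold for one jump is |x|/(2(n+1)), which costs a polynomial factor of
degree M. The Poisson weight and the count combine to (n+1)/(n+1)! = 1/n!, and the normalising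
exponential is bounded by 1. -/
theorem lintegral_compoundPoisson_le {q : E d → ℝ≥0∞} (hq : Measurable q) {A : ℝ}
    (hA : 0 ≤ A) (hρ : ρ Set.univ ≤ ENNReal.ofReal A) {M : ℕ} {x : E d} (hx : x ≠ 0) {B : ℝ≥0∞}
    (hB : ∀ n : ℕ, ∀ w, ∫⁻ y in {y | ‖x‖ / (2 * (n + 1)) ≤ ‖y‖}, q (w - y) ∂ρ
      ≤ ENNReal.ofReal ((2 * (n + 1)) ^ M) * B) :
    ∫⁻ y in {y | ‖x‖ / 2 ≤ ‖y‖}, q (x - y) ∂(compoundPoisson ρ)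
      ≤ (∑' n : ℕ, ENNReal.ofReal ((2 * (n + 1)) ^ M * A ^ n / (n.factorial : ℝ))) * B := by
  have hms : ∀ s : ℝ, MeasurableSet {y : E d | s ≤ ‖y‖} := fun s =>
    measurableSet_le measurable_const measurable_norm
  have hxpos : 0 < ‖x‖ := norm_pos_iff.mpr hx
  rw [compoundPoisson, Measure.restrict_smul, lintegral_smul_measure,
    Measure.restrict_sum _ (hms _), lintegral_sum_measure]
  have h1 : ENNReal.ofReal (Real.exp (-ρ.real Set.univ)) ≤ 1 := by
    rw [ENNReal.ofReal_le_one, Real.exp_le_one_iff]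
    have : 0 ≤ ρ.real Set.univ := measureReal_nonneg
    linarith
  rw [smul_eq_mul]
  refine (mul_le_of_le_one_left (zero_le) h1).trans ?_
  rw [tsum_eq_zero_add' ENNReal.summable, ← ENNReal.tsum_mul_right]
  -- With no jump the law sits at 0, outside the region of integration because x ≠ 0.
  have h0 : ∫⁻ y, q (x - y) ∂(ENNReal.ofReal (1 / (Nat.factorial 0 : ℝ)) • convPow ρ 0).restrict
      {y | ‖x‖ / 2 ≤ ‖y‖} = 0 := by
    rw [Measure.restrict_smul, lintegral_smul_measure, convPow, ← lintegral_indicator (hms _)]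
    have hqx : Measurable fun y => q (x - y) := hq.comp (measurable_const.sub measurable_id)
    rw [lintegral_dirac' _ (hqx.indicator (hms _)), Set.indicator_of_notMem]
    · simp
    · simp only [Set.mem_ofPred_eq, norm_zero, not_le]
      positivity
  rw [h0, zero_add]
  refine ENNReal.tsum_le_tsum fun n => ?_
  rw [Measure.restrict_smul, lintegral_smul_measure, smul_eq_mul]
  have h2 := lintegral_convPow_le ρ hq (hB n) n x
  have h3 : ((n : ℝ) + 1) * (‖x‖ / (2 * (n + 1))) = ‖x‖ / 2 := by
    field_simp
  rw [h3] at h2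
  calc _ ≤ ENNReal.ofReal (1 / ((n + 1).factorial : ℝ))
        * ((n + 1) * ENNReal.ofReal A ^ n * (ENNReal.ofReal ((2 * (n + 1)) ^ M) * B)) := by
        gcongr
        exact h2.trans (by gcongr)
    _ = _ := by
        have h4 : ((n : ℝ≥0∞) + 1) = ENNReal.ofReal ((n : ℝ) + 1) := by
          rw [ENNReal.ofReal_add (by positivity) (by positivity), ENNReal.ofReal_natCast,
            ENNReal.ofReal_one]
        rw [h4, ← ENNReal.ofReal_pow hA, ← ENNReal.ofReal_mul (by positivity), ← mul_assoc,
          ← mul_assoc, ← ENNReal.ofReal_mul (by positivity), ← ENNReal.ofReal_mul (by positivity)]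
        congr 2
        rw [Nat.factorial_succ]
        push_cast
        field_simp

end CompoundPoisson

/-! ### Summation over the number of jumps and over layers of the kernel. -/

/-- The polynomial is at most M! exp(2(n+1)), so the series is dominated by an exponential series in
e²A. -/
theorem summable_pow_mul_pow_div_factorial (M : ℕ) {A : ℝ} (hA : 0 ≤ A) :
    Summable fun n : ℕ => (2 * ((n : ℝ) + 1)) ^ M * A ^ n / (n.factorial : ℝ) := by
  have h := (Real.summable_pow_div_factorial (Real.exp 2 * A)).mul_left
    ((M.factorial : ℝ) * Real.exp 2)
  refine Summable.of_nonneg_of_le (fun n => by positivity) (fun n => ?_) h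
  have h1 := Real.pow_div_factorial_le_exp (x := 2 * ((n : ℝ) + 1)) (by positivity) M
  rw [div_le_iff₀ (by positivity)] at h1
  have h2 : Real.exp (2 * ((n : ℝ) + 1)) = Real.exp 2 ^ n * Real.exp 2 := by
    rw [← Real.exp_nat_mul, ← Real.exp_add]; congr 1; ring
  rw [h2] at h1
  calc _ ≤ (Real.exp 2 ^ n * Real.exp 2 * M.factorial) * A ^ n / (n.factorial : ℝ) := by gcongr
    _ = _ := by rw [mul_pow]; ring

/-- The mass of the layers `k ≤ v < k + 1` for the kernel `exp (-v)`. -/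
noncomputable def layerMass (γ : ℝ) : ℝ≥0∞ :=
  ∑' k : ℕ, ENNReal.ofReal (Real.exp (-k) * ((k : ℝ) + 1) ^ γ)

theorem layerMass_lt_top (γ : ℝ) : layerMass γ < ∞ := by
  obtain ⟨m, hm⟩ := exists_nat_ge γ
  have h := ((summable_nat_add_iff 1).mpr (Real.summable_pow_mul_exp_neg_nat_mul m one_pos)).mul_left
    (Real.exp 1)
  have h2 : Summable fun k : ℕ => Real.exp (-k) * ((k : ℝ) + 1) ^ γ := by
    refine Summable.of_nonneg_of_le (fun k => by positivity) (fun k => ?_) h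
    have h3 : ((k : ℝ) + 1) ^ γ ≤ ((k : ℝ) + 1) ^ m := by
      rw [← Real.rpow_natCast]
      exact Real.rpow_le_rpow_of_exponent_le (by linarith [Nat.cast_nonneg (α := ℝ) k]) hm
    have h4 : Real.exp (-k) = Real.exp 1 * Real.exp (-1 * ((k + 1 : ℕ) : ℝ)) := by
      rw [← Real.exp_add]; congr 1; push_cast; ring
    rw [h4]
    calc _ ≤ Real.exp 1 * Real.exp (-1 * ((k + 1 : ℕ) : ℝ)) * ((k : ℝ) + 1) ^ m := by gcongr
      _ = _ := by push_cast; ring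
  rw [layerMass, ← ENNReal.ofReal_tsum_of_nonneg (fun k => by positivity) h2]
  exact ENNReal.ofReal_lt_top

/-- On the layer k ≤ |w-y|/g < k+1 the kernel is at most e^{-k}, and the layer lies in the ball of
radius (k+1)g. Summing the ball masses leaves the convergent constant `layerMass`. -/
theorem lintegral_exp_neg_norm_le {d : ℕ} {N : Measure (E d)} {g γ r H : ℝ} (hg : 0 < g)
    (w : E d)
    (hN : ∀ ρ : ℝ, 0 < ρ → N (Metric.ball w ρ ∩ {y | r ≤ ‖y‖}) ≤ ENNReal.ofReal (H * ρ ^ γ)) :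
    ∫⁻ y in {y | r ≤ ‖y‖}, ENNReal.ofReal (Real.exp (-(‖w - y‖ / g))) ∂N
      ≤ layerMass γ * ENNReal.ofReal (H * g ^ γ) := by
  have hpt : ∀ y : E d, ENNReal.ofReal (Real.exp (-(‖w - y‖ / g)))
      ≤ ∑' k : ℕ, ENNReal.ofReal (Real.exp (-k)) *
        (Metric.ball w (((k : ℝ) + 1) * g)).indicator (fun _ => (1 : ℝ≥0∞)) y := by
    intro y
    have h0 : 0 ≤ ‖w - y‖ / g := by positivity
    refine le_trans ?_ (ENNReal.le_tsum ⌊‖w - y‖ / g⌋₊)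
    have hmem : y ∈ Metric.ball w (((⌊‖w - y‖ / g⌋₊ : ℝ) + 1) * g) := by
      rw [Metric.mem_ball, dist_comm, dist_eq_norm, ← div_lt_iff₀ hg]
      exact Nat.lt_floor_add_one _
    rw [Set.indicator_of_mem hmem, mul_one]
    refine ENNReal.ofReal_le_ofReal (Real.exp_le_exp.mpr (neg_le_neg ?_))
    exact Nat.floor_le h0
  calc _ ≤ ∫⁻ y in {y | r ≤ ‖y‖}, ∑' k : ℕ, ENNReal.ofReal (Real.exp (-k)) *
        (Metric.ball w (((k : ℝ) + 1) * g)).indicator (fun _ => (1 : ℝ≥0∞)) y ∂N :=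
        lintegral_mono hpt
    _ = ∑' k : ℕ, ENNReal.ofReal (Real.exp (-k)) *
        N (Metric.ball w (((k : ℝ) + 1) * g) ∩ {y | r ≤ ‖y‖}) := by
        rw [lintegral_tsum fun k => ((measurable_const.indicator
          Metric.isOpen_ball.measurableSet).const_mul _).aemeasurable]
        congr 1
        ext k
        rw [lintegral_const_mul _ (measurable_const.indicator Metric.isOpen_ball.measurableSet),
          lintegral_indicator_const Metric.isOpen_ball.measurableSet,
          Measure.restrict_apply Metric.isOpen_ball.measurableSet, one_mul]
    _ ≤ ∑' k : ℕ, ENNReal.ofReal (Real.exp (-k) * ((k : ℝ) + 1) ^ γ)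
        * ENNReal.ofReal (H * g ^ γ) := by
        refine ENNReal.tsum_le_tsum fun k => ?_
        refine (mul_le_mul_right (hN _ (by positivity)) _).trans (le_of_eq ?_)
        rw [← ENNReal.ofReal_mul (by positivity), ← ENNReal.ofReal_mul (by positivity),
          Real.mul_rpow (by positivity) hg.le]
        congr 1
        ring
    _ = _ := by rw [ENNReal.tsum_mul_right, layerMass]

/-! ### Splitting small and large jumps: the density bound at one scale. -/

theorem charFun_sub_eq_neg_phi {d : ℕ} (ρ : Measure (E d)) [IsFiniteMeasure ρ]
    [ρ.IsNegInvariant] (ξ : E d) :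
    charFun ρ ξ - ρ.real Set.univ = ((-phi ρ ξ : ℝ) : ℂ) := by
  have hi : ∀ s : ℝ, Integrable (fun x : E d => Complex.exp ((s * inner ℝ x ξ : ℝ) * Complex.I)) ρ := by
    intro s
    refine Integrable.of_bound (C := 1) (Continuous.aestronglyMeasurable (by fun_prop)) ?_
    exact Eventually.of_forall fun x => (Complex.norm_exp_ofReal_mul_I _).le
  have h1 : charFun ρ ξ = ∫ x, Complex.exp ((1 * inner ℝ x ξ : ℝ) * Complex.I) ∂ρ := by
    simp [charFun_apply]
  have h2 : charFun ρ ξ = ∫ x, Complex.exp ((-1 * inner ℝ x ξ : ℝ) * Complex.I) ∂ρ := by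
    rw [charFun_apply, ← integral_neg_eq_self]
    congr 1
    ext x
    rw [inner_neg_left, neg_one_mul]
  have h3 : charFun ρ ξ = ∫ x, ((Real.cos (inner ℝ ξ x) : ℝ) : ℂ) ∂ρ := by
    have h4 : charFun ρ ξ + charFun ρ ξ = 2 * ∫ x, ((Real.cos (inner ℝ ξ x) : ℝ) : ℂ) ∂ρ := by
      nth_rewrite 1 [h1]
      rw [h2, ← integral_add (hi 1) (hi (-1)), ← integral_const_mul]
      congr 1
      ext x
      rw [Complex.ofReal_cos, Complex.two_cos, real_inner_comm]
      push_cast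
      ring_nf
    linear_combination h4 / 2
  have hcos : Integrable (fun x : E d => Real.cos (inner ℝ ξ x)) ρ := by
    refine Integrable.of_bound (C := 1) (Continuous.aestronglyMeasurable (by fun_prop)) ?_
    exact Eventually.of_forall fun x => Real.abs_cos_le_one _
  rw [h3, integral_complex_ofReal, phi, integral_sub (integrable_const _) hcos]
  simp

theorem phi_le_two_mul {d : ℕ} (ρ : Measure (E d)) [IsFiniteMeasure ρ] (ξ : E d) :
    phi ρ ξ ≤ 2 * ρ.real Set.univ := by
  have h : phi ρ ξ ≤ ∫ _, (2 : ℝ) ∂ρ := by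
    refine integral_mono_of_nonneg (Eventually.of_forall fun y => ?_) (integrable_const _)
      (Eventually.of_forall fun y => ?_)
    · have := Real.cos_le_one (inner ℝ ξ y)
      simp only [Pi.zero_apply]; linarith
    · have := Real.neg_one_le_cos (inner ℝ ξ y)
      simp only; linarith
  simpa [mul_comm] using h

theorem isNegInvariant_restrict {d : ℕ} (N : Measure (E d)) [N.IsNegInvariant] {s : Set (E d)}
    (hs : MeasurableSet s) (hneg : ∀ y, y ∈ s ↔ -y ∈ s) : (N.restrict s).IsNegInvariant := by
  constructor
  have h := (Measure.measurePreserving_neg N).restrict_preimage hs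
  have h2 : Neg.neg ⁻¹' s = s := by
    ext y; exact (hneg y).symm
  rw [h2] at h
  exact h.map_eq

/-- The bound obtained from the contour shift with `τ = log (1 + R) / 2`. -/
theorem neg_half_log_mul_add_le {A R : ℝ} (hA : 0 ≤ A) (hR : 0 ≤ R) :
    -(Real.log (1 + R) / 2) * R + A * (Real.log (1 + R) / 2) ^ 2 * Real.exp (Real.log (1 + R) / 2)
      ≤ 2 * A * Real.exp (8 * A) + -(1 / 4 * R * Real.log (1 + R)) := by
  have hL : 0 ≤ Real.log (1 + R) := Real.log_nonneg (by linarith)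
  set τ := Real.log (1 + R) / 2 with hτ
  have hτ0 : 0 ≤ τ := by positivity
  -- From τ² ≤ 2e^τ and e^{2τ} = 1 + R: the cost of the shift is at most linear in R.
  have h1 : τ ^ 2 * Real.exp τ ≤ 2 * (1 + R) := by
    have h2 := Real.quadratic_le_exp_of_nonneg hτ0
    have h3 : Real.exp τ * Real.exp τ = 1 + R := by
      rw [← Real.exp_add, hτ, add_halves, Real.exp_log (by linarith)]
    nlinarith [Real.exp_pos τ]
  have h4 : A * τ ^ 2 * Real.exp τ ≤ 2 * A * (1 + R) := by
    have := mul_le_mul_of_nonneg_left h1 hA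
    nlinarith
  have h5 : Real.log (1 + R) = 2 * τ := by rw [hτ]; ring
  rw [h5]
  have h7 : 1 ≤ Real.exp (8 * A) := Real.one_le_exp (by positivity)
  -- For τ ≥ 4A half of the gain τR absorbs the linear cost; otherwise 1 + R ≤ e^{8A} and the whole
  -- cost is a constant.
  rcases le_total (4 * A) τ with h6 | h6
  · have h8 : 2 * A ≤ 2 * A * Real.exp (8 * A) := le_mul_of_one_le_right (by positivity) h7
    nlinarith [mul_le_mul_of_nonneg_right h6 hR]
  · have h8 : 1 + R ≤ Real.exp (8 * A) := by
      rw [← Real.exp_log (show 0 < 1 + R by linarith), h5]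
      exact Real.exp_le_exp.mpr (by linarith)
    have h9 : 2 * A * (1 + R) ≤ 2 * A * Real.exp (8 * A) := by gcongr
    nlinarith [mul_nonneg hτ0 hR]

/-- Scaled assumptions on a symmetric Lévy measure `N` at the scale `g`: decay of the
characteristic function, the mass of the large jumps, the second moment of the small jumps, and the
mass of balls away from the origin. -/
structure ScaleBounds {d : ℕ} (N : Measure (E d)) (A γ : ℝ) (M : ℕ) (g : ℝ) (H : ℝ → ℝ) :
    Prop where
  pos : 0 < g
  decay : ∀ ξ, Real.exp (-phi N ξ) ≤ A * ((1 + g * ‖ξ‖) ^ (d + 1))⁻¹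
  large : N {y | g ≤ ‖y‖} ≤ ENNReal.ofReal A
  small : ∫⁻ y in {y | ‖y‖ < g}, ENNReal.ofReal (‖y‖ ^ 2) ∂N ≤ ENNReal.ofReal (A * g ^ 2)
  ball : ∀ w ρ r, 0 < ρ → 0 < r →
    N (Metric.ball w ρ ∩ {y | r ≤ ‖y‖}) ≤ ENNReal.ofReal (H r * ρ ^ γ)
  nonneg : ∀ r, 0 < r → 0 ≤ H r
  scaling : ∀ r b, 0 < r → 1 ≤ b → H (r / b) ≤ b ^ M * H r

namespace ScaleBounds

variable {d : ℕ} {N : Measure (E d)} {A γ g : ℝ} {M : ℕ} {H : ℝ → ℝ}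

theorem A_nonneg (hN : ScaleBounds N A γ M g H) : 0 ≤ A := by
  have h := hN.decay 0
  simp only [norm_zero, mul_zero, add_zero, one_pow, inv_one, mul_one] at h
  exact (Real.exp_pos _).le.trans h

theorem isFiniteMeasure_large (hN : ScaleBounds N A γ M g H) :
    IsFiniteMeasure (N.restrict {y | g ≤ ‖y‖}) :=
  ⟨by rw [Measure.restrict_apply_univ]; exact hN.large.trans_lt ENNReal.ofReal_lt_top⟩

theorem ae_small : ∀ᵐ y ∂(N.restrict {y | ‖y‖ < g}), ‖y‖ ≤ g := by
  filter_upwards [ae_restrict_mem (measurableSet_lt measurable_norm measurable_const)] with y hy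
    using le_of_lt hy

theorem integrable_sq (hN : ScaleBounds N A γ M g H) :
    Integrable (fun y : E d => ‖y‖ ^ 2) (N.restrict {y | ‖y‖ < g}) := by
  refine ⟨Continuous.aestronglyMeasurable (by fun_prop), ?_⟩
  rw [hasFiniteIntegral_iff_ofReal (Eventually.of_forall fun y => by
    simp only [Pi.zero_apply]; positivity)]
  exact hN.small.trans_lt ENNReal.ofReal_lt_top

theorem integral_sq_le (hN : ScaleBounds N A γ M g H) :
    ∫ y, ‖y‖ ^ 2 ∂(N.restrict {y | ‖y‖ < g}) ≤ A * g ^ 2 := by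
  have hA := hN.A_nonneg
  rw [integral_eq_lintegral_of_nonneg_ae (Eventually.of_forall fun y => by
    simp only [Pi.zero_apply]; positivity) (Continuous.aestronglyMeasurable (by fun_prop))]
  exact ENNReal.toReal_le_of_le_ofReal (by positivity) hN.small

theorem phi_eq_add (hN : ScaleBounds N A γ M g H) (ξ : E d) :
    phi N ξ = phi (N.restrict {y | ‖y‖ < g}) ξ + phi (N.restrict {y | g ≤ ‖y‖}) ξ := by
  have hfin := hN.isFiniteMeasure_large
  have h1 : N = N.restrict {y | ‖y‖ < g} + N.restrict {y | g ≤ ‖y‖} := by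
    have h2 : {y : E d | g ≤ ‖y‖} = {y : E d | ‖y‖ < g}ᶜ := by ext y; simp
    rw [h2, Measure.restrict_add_restrict_compl]
    exact measurableSet_lt measurable_norm measurable_const
  nth_rewrite 1 [phi, h1]
  refine integral_add_measure (integrable_one_sub_cos_real ae_small hN.integrable_sq ξ) ?_
  refine Integrable.of_bound (C := 2) (Continuous.aestronglyMeasurable (by fun_prop)) ?_
  refine Eventually.of_forall fun y => ?_
  rw [Real.norm_eq_abs, abs_le]
  have := Real.neg_one_le_cos (inner ℝ ξ y)
  have := Real.cos_le_one (inner ℝ ξ y)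
  constructor <;> linarith

/-- The jumps of norm at least g contribute at most twice their mass, hence at most 2A, to the
exponent; removing them costs the factor e^{2A}. -/
theorem decay_small (hN : ScaleBounds N A γ M g H) (ξ : E d) :
    Real.exp (-phi (N.restrict {y | ‖y‖ < g}) ξ)
      ≤ A * Real.exp (2 * A) * ((1 + g * ‖ξ‖) ^ (d + 1))⁻¹ := by
  have hfin := hN.isFiniteMeasure_large
  have h1 := phi_le_two_mul (N.restrict {y | g ≤ ‖y‖}) ξ
  have h2 : (N.restrict {y | g ≤ ‖y‖}).real Set.univ ≤ A := by
    rw [measureReal_def, Measure.restrict_apply_univ]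
    exact ENNReal.toReal_le_of_le_ofReal hN.A_nonneg hN.large
  have h3 := hN.phi_eq_add ξ
  calc _ ≤ Real.exp (-phi N ξ + 2 * A) := Real.exp_le_exp.mpr (by linarith)
    _ = Real.exp (-phi N ξ) * Real.exp (2 * A) := Real.exp_add _ _
    _ ≤ (A * ((1 + g * ‖ξ‖) ^ (d + 1))⁻¹) * Real.exp (2 * A) := by
        gcongr
        exact hN.decay ξ
    _ = _ := by ring

variable [SFinite N]

theorem integrable_charFun (hN : ScaleBounds N A γ M g H) {P : Measure (E d)}
    (hP : ∀ ξ, charFun P ξ = ((Real.exp (-phi N ξ) : ℝ) : ℂ)) :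
    Integrable fun v => charFun P ((2 * Real.pi) • v) := by
  simp only [hP]
  exact (integrable_exp_neg_phi hN.pos hN.A_nonneg hN.decay).ofReal

theorem charDensity_le_diag (hN : ScaleBounds N A γ M g H) {P : Measure (E d)}
    (hP : ∀ ξ, charFun P ξ = ((Real.exp (-phi N ξ) : ℝ) : ℂ)) (x : E d) :
    charDensity P x ≤ A * decayMass d * (g ^ d)⁻¹ := by
  have h1 : charDensity P x ≤ ∫ v, ‖charFun P ((2 * Real.pi) • v)‖ := by
    refine (Complex.re_le_norm _).trans ?_
    exact VectorFourier.norm_fourierIntegral_le_integral_norm _ _ _ _ _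
  have h2 := integral_exp_neg_phi_le hN.pos hN.A_nonneg hN.decay
  simp only [hP, Complex.norm_real, Real.norm_of_nonneg (Real.exp_pos _).le] at h1
  refine h1.trans (h2.trans (le_of_eq ?_))
  ring

/-- The exponent is additive over small and large jumps, so the characteristic function factors
through the compound Poisson law; `fourier_charFun_mul` turns the product into an integral of
translates. Absolute values avoid having to show that the small-jump kernel is nonnegative. -/
theorem ofReal_charDensity_le_lintegral [N.IsNegInvariant] (hN : ScaleBounds N A γ M g H)
    {P : Measure (E d)} (hP : ∀ ξ, charFun P ξ = ((Real.exp (-phi N ξ) : ℝ) : ℂ)) (x : E d) :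
    have := hN.isFiniteMeasure_large
    ENNReal.ofReal (charDensity P x) ≤ ∫⁻ y, ENNReal.ofReal ‖𝓕 (fun v =>
      ((Real.exp (-phi (N.restrict {y | ‖y‖ < g}) ((2 * Real.pi) • v)) : ℝ) : ℂ)) (x - y)‖
        ∂(compoundPoisson (N.restrict {y | g ≤ ‖y‖})) := by
  intro hfin
  have hA := hN.A_nonneg
  have hinv : (N.restrict {y | g ≤ ‖y‖}).IsNegInvariant :=
    isNegInvariant_restrict N (measurableSet_le measurable_const measurable_norm)
      fun y => by simp
  have hF := (integrable_exp_neg_phi hN.pos (by positivity) hN.decay_small).ofReal (𝕜 := ℂ)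
  have h1 := fourier_charFun_mul (compoundPoisson (N.restrict {y | g ≤ ‖y‖})) hF x
  have h2 : (fun v => charFun P ((2 * Real.pi) • v)) = fun v =>
      charFun (compoundPoisson (N.restrict {y | g ≤ ‖y‖})) ((2 * Real.pi) • v) *
        ((Real.exp (-phi (N.restrict {y | ‖y‖ < g}) ((2 * Real.pi) • v)) : ℝ) : ℂ) := by
    ext v
    rw [hP, charFun_compoundPoisson, charFun_sub_eq_neg_phi, hN.phi_eq_add, neg_add, Real.exp_add,
      ← Complex.ofReal_exp, mul_comm]
    push_cast
    rfl
  have h3 : charDensity P x ≤ ‖∫ y, 𝓕 (fun v =>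
      ((Real.exp (-phi (N.restrict {y | ‖y‖ < g}) ((2 * Real.pi) • v)) : ℝ) : ℂ)) (x - y)
        ∂(compoundPoisson (N.restrict {y | g ≤ ‖y‖}))‖ := by
    rw [charDensity, h2]
    exact (Complex.re_le_norm _).trans (le_of_eq (congrArg norm h1))
  refine (ENNReal.ofReal_le_ofReal h3).trans ?_
  rw [ofReal_norm]
  refine (enorm_integral_le_lintegral_enorm _).trans (le_of_eq ?_)
  simp only [ofReal_norm]

end ScaleBounds

/-- Heat kernel bound at a scale `g`, with a constant which depends only on the constants of the
scaled assumptions. -/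
theorem ScaleBounds.exists_charDensity_le (d : ℕ) (A γ : ℝ) (M : ℕ) :
    ∃ C : ℝ, 0 < C ∧ ∀ (N : Measure (E d)) [SFinite N] [N.IsNegInvariant] (g : ℝ) (H : ℝ → ℝ)
      (P : Measure (E d)), ScaleBounds N A γ M g H →
      (∀ ξ, charFun P ξ = ((Real.exp (-phi N ξ) : ℝ) : ℂ)) → ∀ x : E d, x ≠ 0 →
      charDensity P x ≤ C * (g ^ d)⁻¹ * (H ‖x‖ * g ^ γ
        + Real.exp (-(1 / 8 * (‖x‖ / g) * Real.log (1 + 1 / 2 * (‖x‖ / g))))) := by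
  -- A₁ is the decay constant of the small-jump part. C₁ comes from the shift τ = 1, C₂ from τ =
  -- log(1+R)/2 and T from the sum over the number of jumps; none of them depends on g.
  let A₁ := A * Real.exp (2 * A)
  let C₁ := Real.exp (A₁ * Real.exp 1) * (A₁ * decayMass d)
  let C₂ := Real.exp (2 * A₁ * Real.exp (8 * A₁)) * (A₁ * decayMass d)
  let T : ℝ≥0∞ := ∑' n : ℕ, ENNReal.ofReal ((2 * (n + 1)) ^ M * A ^ n / (n.factorial : ℝ))
  have hK := decayMass_nonneg d
  refine ⟨|C₁ * (T.toReal * (layerMass γ).toReal)| + |C₂| + 1, by positivity, ?_⟩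
  intro N _ _ g H P hN hP x hx
  have hA := hN.A_nonneg
  have hg := hN.pos
  have hA₁ : 0 ≤ A₁ := by positivity
  have hAA₁ : A ≤ A₁ := le_mul_of_one_le_right hA (Real.one_le_exp (by positivity))
  have hC₁ : 0 ≤ C₁ := by positivity
  have hC₂ : 0 ≤ C₂ := by positivity
  have hxpos : 0 < ‖x‖ := norm_pos_iff.mpr hx
  have hfin := hN.isFiniteMeasure_large
  have hT : T < ∞ := by
    simp only [T]
    rw [← ENNReal.ofReal_tsum_of_nonneg (fun n => by positivity)
      (summable_pow_mul_pow_div_factorial M hA)]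
    exact ENNReal.ofReal_lt_top
  have hS := layerMass_lt_top γ
  have hsq' : ∫ y, ‖y‖ ^ 2 ∂(N.restrict {y | ‖y‖ < g}) ≤ A₁ * g ^ 2 :=
    hN.integral_sq_le.trans (by gcongr)
  have hF : ∀ (z : E d) (τ : ℝ), 0 ≤ τ → ‖𝓕 (fun v =>
      ((Real.exp (-phi (N.restrict {y | ‖y‖ < g}) ((2 * Real.pi) • v)) : ℝ) : ℂ)) z‖
      ≤ Real.exp (-τ * (‖z‖ / g) + A₁ * τ ^ 2 * Real.exp τ)
        * (A₁ * ((g ^ d)⁻¹ * decayMass d)) := fun z τ hτ =>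
    norm_fourier_exp_neg_phi_le_exp ScaleBounds.ae_small hN.integrable_sq hg hA₁ hN.decay_small
      hsq' z hτ
  have hnear : ∀ y : E d, ENNReal.ofReal ‖𝓕 (fun v =>
      ((Real.exp (-phi (N.restrict {y | ‖y‖ < g}) ((2 * Real.pi) • v)) : ℝ) : ℂ)) (x - y)‖
      ≤ ENNReal.ofReal (C₁ * (g ^ d)⁻¹) * ENNReal.ofReal (Real.exp (-(‖x - y‖ / g))) := by
    intro y
    rw [← ENNReal.ofReal_mul (by positivity)]
    refine ENNReal.ofReal_le_ofReal ((hF (x - y) 1 zero_le_one).trans (le_of_eq ?_))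
    rw [Real.exp_add]
    simp only [C₁]
    ring_nf
  set G := Real.exp (-(1 / 8 * (‖x‖ / g) * Real.log (1 + 1 / 2 * (‖x‖ / g)))) with hG
  -- When the large jumps sum to less than |x|/2, the small ones must cover at least |x|/2, whence
  -- the constants 1/8 = (1/4)(1/2) and 1/2 in G.
  have hfar : ∀ y ∈ {y : E d | ‖x‖ / 2 ≤ ‖y‖}ᶜ, ENNReal.ofReal ‖𝓕 (fun v =>
      ((Real.exp (-phi (N.restrict {y | ‖y‖ < g}) ((2 * Real.pi) • v)) : ℝ) : ℂ)) (x - y)‖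
      ≤ ENNReal.ofReal (C₂ * (g ^ d)⁻¹ * G) := by
    intro y hy
    have hy' : ‖y‖ < ‖x‖ / 2 := not_le.mp hy
    have hz : 1 / 2 * (‖x‖ / g) ≤ ‖x - y‖ / g := by
      rw [← mul_div_assoc]
      have := norm_sub_norm_le x y
      gcongr
      linarith
    have hR : 0 ≤ ‖x - y‖ / g := by positivity
    have hL : 0 ≤ Real.log (1 + ‖x - y‖ / g) := Real.log_nonneg (by linarith)
    refine ENNReal.ofReal_le_ofReal ((hF (x - y) _ (by positivity :
      0 ≤ Real.log (1 + ‖x - y‖ / g) / 2)).trans ?_)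
    have h1 := neg_half_log_mul_add_le hA₁ hR
    have h2 : Real.exp (-(1 / 4 * (‖x - y‖ / g) * Real.log (1 + ‖x - y‖ / g))) ≤ G := by
      rw [hG]
      refine Real.exp_le_exp.mpr (neg_le_neg ?_)
      calc _ = 1 / 4 * (1 / 2 * (‖x‖ / g)) * Real.log (1 + 1 / 2 * (‖x‖ / g)) := by ring
        _ ≤ _ := by
          have hR' : 0 ≤ 1 / 2 * (‖x‖ / g) := by positivity
          have hL' : 0 ≤ Real.log (1 + 1 / 2 * (‖x‖ / g)) := Real.log_nonneg (by linarith)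
          gcongr
    calc _ ≤ Real.exp (2 * A₁ * Real.exp (8 * A₁)
          + -(1 / 4 * (‖x - y‖ / g) * Real.log (1 + ‖x - y‖ / g)))
          * (A₁ * ((g ^ d)⁻¹ * decayMass d)) := by gcongr
      _ = Real.exp (2 * A₁ * Real.exp (8 * A₁))
          * Real.exp (-(1 / 4 * (‖x - y‖ / g) * Real.log (1 + ‖x - y‖ / g)))
          * (A₁ * ((g ^ d)⁻¹ * decayMass d)) := by rw [Real.exp_add]
      _ ≤ Real.exp (2 * A₁ * Real.exp (8 * A₁)) * G * (A₁ * ((g ^ d)⁻¹ * decayMass d)) := by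
          gcongr
      _ = _ := by simp only [C₂]; ring
  have hms : MeasurableSet {y : E d | ‖x‖ / 2 ≤ ‖y‖} :=
    measurableSet_le measurable_const measurable_norm
  have hqm : Measurable fun z : E d => ENNReal.ofReal (Real.exp (-(‖z‖ / g))) := by fun_prop
  have hjump : ∫⁻ y in {y | ‖x‖ / 2 ≤ ‖y‖}, ENNReal.ofReal (Real.exp (-(‖x - y‖ / g)))
      ∂(compoundPoisson (N.restrict {y | g ≤ ‖y‖}))
      ≤ T * (layerMass γ * ENNReal.ofReal (H ‖x‖ * g ^ γ)) := by
    refine lintegral_compoundPoisson_le (N.restrict {y | g ≤ ‖y‖}) hqm hA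
      (by rw [Measure.restrict_apply_univ]; exact hN.large) hx fun n w => ?_
    have hr : 0 < ‖x‖ / (2 * ((n : ℝ) + 1)) := by positivity
    have h1 := lintegral_exp_neg_norm_le (N := N) (r := ‖x‖ / (2 * ((n : ℝ) + 1))) (γ := γ) hg w
      fun ρ hρ => hN.ball w ρ _ hρ hr
    have h2 : H (‖x‖ / (2 * ((n : ℝ) + 1))) ≤ (2 * ((n : ℝ) + 1)) ^ M * H ‖x‖ :=
      hN.scaling _ _ hxpos (by linarith [Nat.cast_nonneg (α := ℝ) n])
    refine (lintegral_mono' (Measure.restrict_mono subset_rfl Measure.restrict_le_self)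
      le_rfl).trans (h1.trans ?_)
    calc _ ≤ layerMass γ * ENNReal.ofReal ((2 * ((n : ℝ) + 1)) ^ M * H ‖x‖ * g ^ γ) := by
          gcongr
      _ = _ := by
          rw [mul_assoc ((2 * ((n : ℝ) + 1)) ^ M), ENNReal.ofReal_mul (by positivity)]
          ring
  have hHg : 0 ≤ H ‖x‖ * g ^ γ := mul_nonneg (hN.nonneg _ hxpos) (by positivity)
  have hGpos : 0 ≤ G := (Real.exp_pos _).le
  have hgd : 0 ≤ (g ^ d)⁻¹ := by positivity
  have main : ENNReal.ofReal (charDensity P x) ≤ ENNReal.ofReal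
      (C₁ * (g ^ d)⁻¹ * (T.toReal * ((layerMass γ).toReal * (H ‖x‖ * g ^ γ)))
        + C₂ * (g ^ d)⁻¹ * G) := by
    -- Split according to the sum of the large jumps: at least |x|/2 yields the ball masses, less
    -- than |x|/2 the Poisson-type decay times a probability at most 1.
    refine (hN.ofReal_charDensity_le_lintegral hP x).trans ?_
    rw [← lintegral_add_compl _ hms, ENNReal.ofReal_add (by positivity) (by positivity)]
    gcongr
    · refine (lintegral_mono fun y => hnear y).trans ?_
      have hqx : Measurable fun y : E d => ENNReal.ofReal (Real.exp (-(‖x - y‖ / g))) :=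
        hqm.comp (measurable_const.sub measurable_id)
      rw [lintegral_const_mul _ hqx,
        ENNReal.ofReal_mul (show 0 ≤ C₁ * (g ^ d)⁻¹ by positivity),
        ENNReal.ofReal_mul ENNReal.toReal_nonneg, ENNReal.ofReal_mul ENNReal.toReal_nonneg,
        ENNReal.ofReal_toReal hT.ne, ENNReal.ofReal_toReal hS.ne]
      gcongr
    · refine (setLIntegral_mono measurable_const hfar).trans ?_
      rw [setLIntegral_const]
      exact mul_le_of_le_one_right' prob_le_one
  have main' := (ENNReal.ofReal_le_ofReal_iff (by positivity)).mp main
  refine main'.trans ?_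
  have e1 : C₁ * (g ^ d)⁻¹ * (T.toReal * ((layerMass γ).toReal * (H ‖x‖ * g ^ γ)))
      = C₁ * (T.toReal * (layerMass γ).toReal) * ((g ^ d)⁻¹ * (H ‖x‖ * g ^ γ)) := by ring
  have e2 : C₂ * (g ^ d)⁻¹ * G = C₂ * ((g ^ d)⁻¹ * G) := by ring
  rw [e1, e2]
  calc _ ≤ (|C₁ * (T.toReal * (layerMass γ).toReal)| + |C₂| + 1) * ((g ^ d)⁻¹ * (H ‖x‖ * g ^ γ))
        + (|C₁ * (T.toReal * (layerMass γ).toReal)| + |C₂| + 1) * ((g ^ d)⁻¹ * G) := by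
        gcongr
        · have := le_abs_self (C₁ * (T.toReal * (layerMass γ).toReal))
          have := abs_nonneg C₂
          linarith
        · have := abs_nonneg (C₁ * (T.toReal * (layerMass γ).toReal))
          have := le_abs_self C₂
          linarith
    _ = _ := by ring

/-! ### Symmetric Lévy measures and their exponents. -/

section Levy

variable {d : ℕ} {ν : Measure (E d)}

theorem IsLevyMeasure.integrable_min (hν : IsLevyMeasure ν) :
    Integrable (fun y : E d => min 1 (‖y‖ ^ 2)) ν := by
  refine ⟨Continuous.aestronglyMeasurable (by fun_prop), ?_⟩
  rw [hasFiniteIntegral_iff_ofReal (Eventually.of_forall fun y => by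
    simp only [Pi.zero_apply]; positivity)]
  exact hν.lintegral_lt_top

/-- The weight min(1,|y|²) makes ν finite and is positive off the origin, which carries no mass; so
ν has a density with respect to a finite measure. -/
theorem IsLevyMeasure.sfinite (hν : IsLevyMeasure ν) : SFinite ν := by
  have hm : Measurable fun y : E d => ENNReal.ofReal (min 1 (‖y‖ ^ 2)) := by fun_prop
  have hfin : IsFiniteMeasure (ν.withDensity fun y : E d => ENNReal.ofReal (min 1 (‖y‖ ^ 2))) :=
    isFiniteMeasure_withDensity hν.lintegral_lt_top.ne
  have hne : ∀ᵐ y ∂ν, ENNReal.ofReal (min 1 (‖y‖ ^ 2)) ≠ 0 := by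
    have h0 : ∀ᵐ y ∂ν, y ∉ ({0} : Set (E d)) := measure_eq_zero_iff_ae_notMem.mp hν.zero_mass
    filter_upwards [h0] with y hy
    have : 0 < ‖y‖ := norm_pos_iff.mpr hy
    have : 0 < min 1 (‖y‖ ^ 2) := by positivity
    exact (ENNReal.ofReal_pos.mpr this).ne'
  rw [← withDensity_inv_same hm hne (Eventually.of_forall fun _ => ENNReal.ofReal_ne_top)]
  infer_instance

theorem one_sub_cos_inner_le (ξ y : E d) :
    1 - Real.cos (inner ℝ ξ y) ≤ (2 + ‖ξ‖ ^ 2) * min 1 (‖y‖ ^ 2) := by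
  have h1 := Real.neg_one_le_cos (inner ℝ ξ y)
  have h3 := Real.one_sub_sq_div_two_le_cos (x := inner ℝ ξ y)
  have h4 : (inner ℝ ξ y) ^ 2 ≤ ‖ξ‖ ^ 2 * ‖y‖ ^ 2 := by
    rw [← mul_pow, ← sq_abs]
    exact pow_le_pow_left₀ (abs_nonneg _) (abs_real_inner_le_norm ξ y) 2
  rcases le_total 1 (‖y‖ ^ 2) with h | h
  · rw [min_eq_left h]
    nlinarith [sq_nonneg ‖ξ‖]
  · rw [min_eq_right h]
    nlinarith [sq_nonneg ‖y‖, sq_nonneg (inner ℝ ξ y)]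

theorem IsLevyMeasure.integrable_one_sub_cos (hν : IsLevyMeasure ν) (ξ : E d) :
    Integrable (fun y => 1 - Real.cos (inner ℝ ξ y)) ν := by
  refine (hν.integrable_min.const_mul (2 + ‖ξ‖ ^ 2)).mono'
    (Continuous.aestronglyMeasurable (by fun_prop)) (Eventually.of_forall fun y => ?_)
  have h2 := Real.cos_le_one (inner ℝ ξ y)
  rw [Real.norm_of_nonneg (by linarith)]
  exact one_sub_cos_inner_le ξ y

theorem IsLevyMeasure.integrable_compensated (hν : IsLevyMeasure ν) (ξ : E d) :
    Integrable (fun y => Complex.exp (Complex.I * ((inner ℝ ξ y : ℝ) : ℂ)) - 1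
      - (Metric.ball (0 : E d) 1).indicator
          (fun z => Complex.I * ((inner ℝ ξ z : ℝ) : ℂ)) y) ν := by
  have hm : Measurable (fun y => Complex.exp (Complex.I * ((inner ℝ ξ y : ℝ) : ℂ)) - 1
      - (Metric.ball (0 : E d) 1).indicator
          (fun z => Complex.I * ((inner ℝ ξ z : ℝ) : ℂ)) y) := by
    refine Measurable.sub (Continuous.measurable (by fun_prop)) ?_
    exact (Continuous.measurable (by fun_prop)).indicator Metric.isOpen_ball.measurableSet
  refine (hν.integrable_min.const_mul (2 + ‖ξ‖ ^ 2 * Real.exp ‖ξ‖)).mono'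
    hm.aestronglyMeasurable (Eventually.of_forall fun y => ?_)
  have hn : ‖Complex.I * ((inner ℝ ξ y : ℝ) : ℂ)‖ ≤ ‖ξ‖ * ‖y‖ := by
    rw [norm_mul, Complex.norm_I, one_mul, Complex.norm_real]
    exact norm_inner_le_norm ξ y
  have hE : 0 ≤ ‖ξ‖ ^ 2 * Real.exp ‖ξ‖ := by positivity
  by_cases hy : y ∈ Metric.ball (0 : E d) 1
  · rw [Set.indicator_of_mem hy]
    have hy1 : ‖y‖ < 1 := by simpa using hy
    have h1 := Complex.norm_exp_sub_sum_le_norm_mul_exp (Complex.I * ((inner ℝ ξ y : ℝ) : ℂ)) 2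
    simp only [Finset.sum_range_succ, Finset.sum_range_zero, pow_zero, pow_one, zero_add,
      Nat.factorial, Nat.cast_one, div_one, mul_one] at h1
    rw [min_eq_right (by nlinarith [norm_nonneg y]), sub_sub]
    refine h1.trans ?_
    calc _ ≤ (‖ξ‖ * ‖y‖) ^ 2 * Real.exp (‖ξ‖ * 1) := by
          gcongr
          exact hn.trans (by gcongr)
      _ = ‖ξ‖ ^ 2 * Real.exp ‖ξ‖ * ‖y‖ ^ 2 := by rw [mul_one]; ring
      _ ≤ _ := by gcongr; linarith
  · rw [Set.indicator_of_notMem hy, sub_zero]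
    have hy1 : 1 ≤ ‖y‖ := by simpa using hy
    rw [min_eq_left (by nlinarith), mul_one]
    refine (norm_sub_le _ _).trans ?_
    rw [mul_comm, Complex.norm_exp_ofReal_mul_I, norm_one]
    linarith

theorem IsSymmetric.isNegInvariant (hs : IsSymmetric ν) : ν.IsNegInvariant := by
  constructor
  ext A hA
  rw [Measure.neg, Measure.map_apply measurable_neg hA]
  exact hs A hA

/-- For symmetric Lévy measures without drift the characteristic exponent is real. -/
theorem IsLevyMeasure.charExponent_eq (hν : IsLevyMeasure ν) (hs : IsSymmetric ν) (ξ : E d) :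
    charExponent ν 0 ξ = (phi ν ξ : ℂ) := by
  have hinv := hs.isNegInvariant
  have hi := hν.integrable_compensated ξ
  set F : E d → ℂ := fun y => Complex.exp (Complex.I * ((inner ℝ ξ y : ℝ) : ℂ)) - 1
      - (Metric.ball (0 : E d) 1).indicator
          (fun z => Complex.I * ((inner ℝ ξ z : ℝ) : ℂ)) y with hF
  have h1 : ∫ y, F (-y) ∂ν = ∫ y, F y ∂ν := integral_neg_eq_self F ν
  -- Adding the integrand at y and at -y cancels the compensator and the sine, since the unit ball
  -- is symmetric.
  have h2 : ∀ y, F y + F (-y) = -2 * ((1 - Real.cos (inner ℝ ξ y) : ℝ) : ℂ) := by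
    intro y
    have h3 : (-y ∈ Metric.ball (0 : E d) 1) ↔ y ∈ Metric.ball (0 : E d) 1 := by simp
    have h4 := Complex.two_cos ((inner ℝ ξ y : ℝ) : ℂ)
    simp only [hF, inner_neg_right]
    push_cast
    by_cases hy : y ∈ Metric.ball (0 : E d) 1
    · rw [Set.indicator_of_mem hy, Set.indicator_of_mem (h3.mpr hy)]
      simp only [inner_neg_right]
      push_cast
      rw [mul_neg, mul_comm Complex.I, ← neg_mul]
      linear_combination -h4
    · rw [Set.indicator_of_notMem hy, Set.indicator_of_notMem (fun h => hy (h3.mp h))]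
      rw [mul_neg, mul_comm Complex.I, ← neg_mul]
      linear_combination -h4
  have h5 : ∫ y, F y ∂ν + ∫ y, F (-y) ∂ν = -2 * (phi ν ξ : ℂ) := by
    rw [← integral_add hi hi.comp_neg, phi, ← integral_complex_ofReal, ← integral_const_mul]
    exact integral_congr_ae (Eventually.of_forall h2)
  rw [charExponent, inner_zero_right]
  rw [h1] at h5
  push_cast
  linear_combination -h5 / 2

theorem phi_smul (ν : Measure (E d)) {t : ℝ} (ht : 0 ≤ t) (ξ : E d) :
    phi (ENNReal.ofReal t • ν) ξ = t * phi ν ξ := by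
  rw [phi, integral_smul_measure, ENNReal.toReal_ofReal ht, smul_eq_mul, phi]

theorem isNegInvariant_smul (ν : Measure (E d)) [ν.IsNegInvariant] (c : ℝ≥0∞) :
    (c • ν).IsNegInvariant := by
  constructor
  rw [Measure.neg, Measure.map_smul, Measure.map_neg_eq_self]

end Levy

/-! ### Polar measures and nondegeneracy of the angular part. -/

section Polar

variable {d : ℕ} {μ : Measure (S d)}

/-- A ball of radius 3 around any point of the sphere contains the whole sphere; an empty sphere is
trivial. -/
theorem IsSphericalMeasureOfOrder.isFiniteMeasure {a : ℝ} (h : IsSphericalMeasureOfOrder μ a) :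
    IsFiniteMeasure μ := by
  obtain ⟨c, hc, h⟩ := h
  rcases isEmpty_or_nonempty (S d) with he | ⟨⟨θ⟩⟩
  · exact ⟨by rw [Set.univ_eq_empty_iff.mpr he]; simp⟩
  · refine ⟨lt_of_le_of_lt (measure_mono fun x _ => ?_) ((h θ 3 (by norm_num)).trans_lt
      ENNReal.ofReal_lt_top)⟩
    have h1 : ‖(x : E d)‖ = 1 := by simp
    have h2 : ‖(θ : E d)‖ = 1 := by simp
    rw [Metric.mem_ball, Subtype.dist_eq, dist_eq_norm]
    have := norm_sub_le (x : E d) (θ : E d)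
    linarith

theorem norm_coe_sphere (θ : S d) : ‖(θ : E d)‖ = 1 := by simp

/-- The measure with polar decomposition `Q(s) ds μ(dθ)`. -/
noncomputable def polarMeasure (μ : Measure (S d)) (Q : ℝ → ℝ) : Measure (E d) :=
  Measure.map (fun p : S d × ℝ => p.2 • (p.1 : E d))
    (μ.prod ((volume.restrict (Set.Ioi (0 : ℝ))).withDensity fun s => ENNReal.ofReal (Q s)))

theorem lintegral_polarMeasure {Q : ℝ → ℝ} (hQ : Measurable Q)
    {f : E d → ℝ≥0∞} (hf : Measurable f) :
    ∫⁻ y, f y ∂(polarMeasure μ Q)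
      = ∫⁻ θ : S d, ∫⁻ s in Set.Ioi (0 : ℝ), f (s • (θ : E d)) * ENNReal.ofReal (Q s) ∂volume ∂μ := by
  have hm : Measurable fun p : S d × ℝ => p.2 • (p.1 : E d) := by fun_prop
  have hfm : Measurable fun p : S d × ℝ => f (p.2 • (p.1 : E d)) := hf.comp hm
  rw [polarMeasure, lintegral_map hf hm, lintegral_prod _ hfm.aemeasurable]
  congr 1
  ext θ
  have hfθ : Measurable fun s : ℝ => f (s • (θ : E d)) :=
    hf.comp (by fun_prop : Measurable fun s : ℝ => s • (θ : E d))
  rw [lintegral_withDensity_eq_lintegral_mul _ hQ.ennreal_ofReal hfθ]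
  simp only [Pi.mul_apply, mul_comm]

theorem polarMeasure_apply {Q : ℝ → ℝ} (hQ : Measurable Q) {A : Set (E d)}
    (hA : MeasurableSet A) : polarMeasure μ Q A = polarMass μ Q A := by
  rw [← lintegral_indicator_one hA, lintegral_polarMeasure hQ (measurable_one.indicator hA)]
  rfl

theorem IsComparableToPolar.exists_le {ν : Measure (E d)} {Q : ℝ → ℝ}
    (h : IsComparableToPolar ν μ Q) (hQ : Measurable Q) :
    ∃ c : ℝ, 0 < c ∧ ENNReal.ofReal c⁻¹ • polarMeasure μ Q ≤ ν ∧
      ν ≤ ENNReal.ofReal c • polarMeasure μ Q := by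
  obtain ⟨c, hc, h⟩ := h
  refine ⟨c, hc, ?_, ?_⟩
  · refine Measure.le_iff.mpr fun A hA => ?_
    rw [Measure.smul_apply, polarMeasure_apply hQ hA]
    exact (h A hA).1
  · refine Measure.le_iff.mpr fun A hA => ?_
    rw [Measure.smul_apply, polarMeasure_apply hQ hA]
    exact (h A hA).2

theorem continuous_integral_inner_sq (μ : Measure (S d)) [IsFiniteMeasure μ] :
    Continuous fun ξ : E d => ∫ θ : S d, (inner ℝ ξ (θ : E d)) ^ 2 ∂μ := by
  refine continuous_iff_continuousAt.mpr fun ξ₀ => ?_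
  refine continuousAt_of_dominated (bound := fun _ => (‖ξ₀‖ + 1) ^ 2)
    (Eventually.of_forall fun ξ => Continuous.aestronglyMeasurable (by fun_prop)) ?_
    (integrable_const _) (Eventually.of_forall fun θ => Continuous.continuousAt (by fun_prop))
  filter_upwards [Metric.ball_mem_nhds ξ₀ one_pos] with ξ hξ
  refine Eventually.of_forall fun θ => ?_
  have h1 := abs_real_inner_le_norm ξ (θ : E d)
  rw [norm_coe_sphere, mul_one] at h1
  have h2 : ‖ξ - ξ₀‖ < 1 := by simpa [dist_eq_norm] using hξ
  have h3 := norm_le_norm_add_norm_sub' ξ ξ₀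
  rw [norm_pow, Real.norm_eq_abs]
  gcongr
  linarith

/-- If the quadratic form vanished at some ξ ≠ 0, the support of μ would lie in the hyperplane
orthogonal to ξ. Being positive and continuous, the form has a positive minimum on the compact
sphere, and homogeneity does the rest. -/
theorem IsNondegenerate.exists_le_integral [IsFiniteMeasure μ] (hμ : IsNondegenerate μ) :
    ∃ a : ℝ, 0 < a ∧ ∀ ξ : E d, a * ‖ξ‖ ^ 2 ≤ ∫ θ : S d, (inner ℝ ξ (θ : E d)) ^ 2 ∂μ := by
  have hint : ∀ ξ : E d, Integrable (fun θ : S d => (inner ℝ ξ (θ : E d)) ^ 2) μ := by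
    intro ξ
    refine Integrable.of_bound (C := ‖ξ‖ ^ 2) (Continuous.aestronglyMeasurable (by fun_prop))
      (Eventually.of_forall fun θ => ?_)
    have h1 := abs_real_inner_le_norm ξ (θ : E d)
    rw [norm_coe_sphere, mul_one] at h1
    rw [norm_pow, Real.norm_eq_abs]
    gcongr
  have hpos : ∀ ξ : E d, ξ ≠ 0 → 0 < ∫ θ : S d, (inner ℝ ξ (θ : E d)) ^ 2 ∂μ := by
    intro ξ hξ
    refine lt_of_le_of_ne (integral_nonneg fun θ => sq_nonneg _) fun h0 => hξ ?_
    rw [eq_comm, integral_eq_zero_iff_of_nonneg (fun θ => sq_nonneg _) (hint ξ)] at h0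
    have hcl : IsClosed {θ : S d | inner ℝ ξ (θ : E d) = 0} :=
      isClosed_eq (by fun_prop) continuous_const
    have hsub : μ.support ⊆ {θ : S d | inner ℝ ξ (θ : E d) = 0} := by
      refine Measure.support_subset_of_isClosed hcl ?_
      filter_upwards [h0] with θ hθ
      simpa using hθ
    have htop := hμ (LinearMap.ker (innerₗ (E d) ξ)) (by
      rintro _ ⟨θ, hθ, rfl⟩
      exact hsub hθ)
    have h1 : ξ ∈ LinearMap.ker (innerₗ (E d) ξ) := by rw [htop]; trivial
    have h2 : inner ℝ ξ ξ = 0 := h1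
    exact inner_self_eq_zero.mp h2
  rcases (Metric.sphere (0 : E d) 1).eq_empty_or_nonempty with he | hne
  · refine ⟨1, one_pos, fun ξ => ?_⟩
    have : ξ = 0 := by
      by_contra h
      have : ‖ξ‖⁻¹ • ξ ∈ Metric.sphere (0 : E d) 1 := by
        simp [norm_smul, inv_mul_cancel₀ (norm_ne_zero_iff.mpr h)]
      rw [he] at this
      exact this
    simp [this]
  · obtain ⟨ξ₀, hξ₀, hmin⟩ := (isCompact_sphere (0 : E d) 1).exists_isMinOn hne
      (continuous_integral_inner_sq μ).continuousOn
    have hξ₀' : ‖ξ₀‖ = 1 := by simpa using hξ₀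
    refine ⟨_, hpos ξ₀ (by rintro rfl; simp at hξ₀'), fun ξ => ?_⟩
    rcases eq_or_ne ξ 0 with rfl | hξ
    · simp
    · have hn : ‖ξ‖ ≠ 0 := norm_ne_zero_iff.mpr hξ
      have h1 : ‖ξ‖⁻¹ • ξ ∈ Metric.sphere (0 : E d) 1 := by
        simp [norm_smul, inv_mul_cancel₀ hn]
      have h2 := isMinOn_iff.mp hmin _ h1
      simp only [inner_smul_left, conj_trivial, mul_pow, integral_const_mul] at h2
      calc _ ≤ (‖ξ‖⁻¹ ^ 2 * ∫ θ : S d, (inner ℝ ξ (θ : E d)) ^ 2 ∂μ) * ‖ξ‖ ^ 2 := by gcongr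
        _ = _ := by field_simp

end Polar

/-! ### Radial profiles: tails and truncated second moments. -/

/-- Positive radial profiles with lower and upper power bounds. -/
structure RadialProfile (Q : ℝ → ℝ) (δ₁ δ₂ : ℝ) : Prop where
  measurable : Measurable Q
  pos : ∀ s, 0 < s → 0 < Q s
  index_pos : 0 < δ₁
  upper : ∀ s b, 0 < s → 1 ≤ b → Q (b * s) ≤ b ^ (-1 - δ₁) * Q s
  lower : ∀ s b, 0 < s → 1 ≤ b → b ^ (-1 - δ₂) * Q s ≤ Q (b * s)

/-- The truncated second moment `∫_0^s u² Q(u) du`. -/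
noncomputable def truncMoment (Q : ℝ → ℝ) (s : ℝ) : ℝ≥0∞ :=
  ∫⁻ u in Set.Ioo 0 s, ENNReal.ofReal (u ^ 2 * Q u)

namespace RadialProfile

variable {Q : ℝ → ℝ} {δ₁ δ₂ : ℝ}

theorem anti (hQ : RadialProfile Q δ₁ δ₂) {r s : ℝ} (hr : 0 < r) (hrs : r ≤ s) : Q s ≤ Q r := by
  have h1 : 1 ≤ s / r := (one_le_div hr).mpr hrs
  have h := hQ.upper r (s / r) hr h1
  rw [div_mul_cancel₀ _ hr.ne'] at h
  refine h.trans (mul_le_of_le_one_left (hQ.pos r hr).le ?_)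
  exact Real.rpow_le_one_of_one_le_of_nonpos h1 (by linarith [hQ.index_pos])

theorem lintegral_tail_le (hQ : RadialProfile Q δ₁ δ₂) {r : ℝ} (hr : 0 < r) :
    ∫⁻ s in Set.Ici r, ENNReal.ofReal (Q s) ≤ ENNReal.ofReal (r * Q r / δ₁) := by
  have hδ := hQ.index_pos
  have hq := hQ.pos r hr
  have hlt : -1 - δ₁ < -1 := by linarith
  rw [setLIntegral_congr Ioi_ae_eq_Ici.symm]
  calc _ ≤ ∫⁻ s in Set.Ioi r, ENNReal.ofReal (r ^ (1 + δ₁) * Q r * s ^ (-1 - δ₁)) := by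
        refine setLIntegral_mono (by fun_prop) fun s hs => ENNReal.ofReal_le_ofReal ?_
        have hs' : r < s := hs
        have h := hQ.upper r (s / r) hr ((one_le_div hr).mpr hs'.le)
        rw [div_mul_cancel₀ _ hr.ne', Real.div_rpow (hr.trans hs').le hr.le] at h
        refine h.trans (le_of_eq ?_)
        rw [show -1 - δ₁ = -(1 + δ₁) by ring, Real.rpow_neg hr.le]
        field_simp
    _ = ENNReal.ofReal (∫ s in Set.Ioi r, r ^ (1 + δ₁) * Q r * s ^ (-1 - δ₁)) := by
        rw [ofReal_integral_eq_lintegral_ofReal]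
        · exact (integrableOn_Ioi_rpow_of_lt hlt hr).const_mul _
        · filter_upwards [ae_restrict_mem measurableSet_Ioi] with s hs
          have hs' : r < s := hs
          have : 0 < s := hr.trans hs'
          simp only [Pi.zero_apply]
          positivity
    _ = _ := by
        rw [integral_const_mul, integral_Ioi_rpow_of_lt hlt hr]
        congr 1
        rw [show -1 - δ₁ + 1 = -δ₁ by ring, Real.rpow_neg hr.le, Real.rpow_add hr, Real.rpow_one]
        field_simp

/-- Keep only the upper half of the interval, where Q is at least Q(s) by monotonicity. -/
theorem le_truncMoment (hQ : RadialProfile Q δ₁ δ₂) {s : ℝ} (hs : 0 < s) :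
    ENNReal.ofReal (s ^ 3 * Q s / 8) ≤ truncMoment Q s := by
  have hq := hQ.pos s hs
  calc _ = ∫⁻ _ in Set.Ioo (s / 2) s, ENNReal.ofReal ((s / 2) ^ 2 * Q s) := by
        rw [setLIntegral_const, Real.volume_Ioo, ← ENNReal.ofReal_mul (by positivity)]
        congr 1
        ring
    _ ≤ ∫⁻ u in Set.Ioo (s / 2) s, ENNReal.ofReal (u ^ 2 * Q u) := by
        refine setLIntegral_mono ?_ fun u hu => ENNReal.ofReal_le_ofReal ?_
        · have := hQ.measurable
          fun_prop
        · have hu0 : 0 < u := lt_trans (by positivity) hu.1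
          have h1 := hQ.anti hu0 hu.2.le
          have h2 := hu.1.le
          gcongr
    _ ≤ _ := lintegral_mono_set (Set.Ioo_subset_Ioo_left (by positivity))

/-- The lower power bound compares Q(u) with a multiple of u^{-1-δ₂}. The resulting u^{1-δ₂} is
integrable at 0 exactly because δ₂ < 2, which is the condition that fails in the critical case. -/
theorem truncMoment_le (hQ : RadialProfile Q δ₁ δ₂) (hδ : δ₂ < 2) {s : ℝ} (hs : 0 < s) :
    truncMoment Q s ≤ ENNReal.ofReal (s ^ 3 * Q s / (2 - δ₂)) := by
  have hq := hQ.pos s hs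
  have hlt : -1 < 1 - δ₂ := by linarith
  have hint : IntervalIntegrable (fun u : ℝ => u ^ (1 - δ₂)) volume 0 s :=
    intervalIntegral.intervalIntegrable_rpow' hlt
  rw [truncMoment, setLIntegral_congr Ioo_ae_eq_Ioc]
  calc _ ≤ ∫⁻ u in Set.Ioc 0 s, ENNReal.ofReal (s ^ (1 + δ₂) * Q s * u ^ (1 - δ₂)) := by
        refine setLIntegral_mono (by fun_prop) fun u hu => ENNReal.ofReal_le_ofReal ?_
        have hu0 : 0 < u := hu.1
        have h := hQ.lower u (s / u) hu0 ((one_le_div hu0).mpr hu.2)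
        rw [div_mul_cancel₀ _ hu0.ne', Real.div_rpow hs.le hu0.le,
          show -1 - δ₂ = -(1 + δ₂) by ring, Real.rpow_neg hs.le, Real.rpow_neg hu0.le] at h
        have h1 : u ^ (1 - δ₂) = u ^ 2 * (u ^ (1 + δ₂))⁻¹ := by
          rw [← Real.rpow_neg hu0.le, ← Real.rpow_natCast u 2, ← Real.rpow_add hu0]
          congr 1
          push_cast
          ring
        rw [h1]
        have h2 : Q u ≤ s ^ (1 + δ₂) * Q s * (u ^ (1 + δ₂))⁻¹ := by
          have h3 : 0 < s ^ (1 + δ₂) := by positivity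
          have h4 : 0 < u ^ (1 + δ₂) := by positivity
          have h5 : Q u = s ^ (1 + δ₂) * ((s ^ (1 + δ₂))⁻¹ / (u ^ (1 + δ₂))⁻¹ * Q u)
              * (u ^ (1 + δ₂))⁻¹ := by
            field_simp
          rw [h5]
          gcongr
        calc _ ≤ u ^ 2 * (s ^ (1 + δ₂) * Q s * (u ^ (1 + δ₂))⁻¹) := by gcongr
          _ = _ := by ring
    _ = ENNReal.ofReal (∫ u in (0)..s, s ^ (1 + δ₂) * Q s * u ^ (1 - δ₂)) := by
        rw [intervalIntegral.integral_of_le hs.le, ofReal_integral_eq_lintegral_ofReal]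
        · exact ((intervalIntegrable_iff_integrableOn_Ioc_of_le hs.le).mp hint).const_mul _
        · filter_upwards [ae_restrict_mem measurableSet_Ioc] with u hu
          have : 0 < u := hu.1
          simp only [Pi.zero_apply]
          positivity
    _ = _ := by
        rw [intervalIntegral.integral_const_mul, integral_rpow (Or.inl hlt),
          Real.zero_rpow (by linarith), sub_zero, show 1 - δ₂ + 1 = 2 - δ₂ by ring]
        congr 1
        have h1 : s ^ (1 + δ₂) * s ^ (2 - δ₂) = s ^ 3 := by
          rw [← Real.rpow_add hs, ← Real.rpow_natCast s 3]
          congr 1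
          push_cast
          ring
        rw [← h1]
        ring

end RadialProfile

/-! ### Estimates for polar measures: tails, balls and the exponent. -/

section PolarBounds

variable {d : ℕ} {μ : Measure (S d)} {ν : Measure (E d)} {Q : ℝ → ℝ}

theorem norm_smul_coe_sphere {s : ℝ} (hs : 0 < s) (θ : S d) : ‖s • (θ : E d)‖ = s := by
  rw [norm_smul, norm_coe_sphere, mul_one, Real.norm_of_nonneg hs.le]

theorem lintegral_polarMeasure_radial (hQ : Measurable Q) {F : ℝ → ℝ≥0∞} (hF : Measurable F) :
    ∫⁻ y, F ‖y‖ ∂(polarMeasure μ Q)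
      = (∫⁻ s in Set.Ioi (0 : ℝ), F s * ENNReal.ofReal (Q s)) * μ Set.univ := by
  have hFn : Measurable fun y : E d => F ‖y‖ := hF.comp measurable_norm
  rw [lintegral_polarMeasure hQ hFn]
  have : ∀ θ : S d, ∫⁻ s in Set.Ioi (0 : ℝ), F ‖s • (θ : E d)‖ * ENNReal.ofReal (Q s)
      = ∫⁻ s in Set.Ioi (0 : ℝ), F s * ENNReal.ofReal (Q s) := fun θ =>
    setLIntegral_congr_fun measurableSet_Ioi fun s hs => by
      rw [norm_smul_coe_sphere hs]
  simp only [this, lintegral_const]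

theorem polarMeasure_large (hQ : Measurable Q) {g : ℝ} (hg : 0 < g) :
    polarMeasure μ Q {y | g ≤ ‖y‖} = (∫⁻ s in Set.Ici g, ENNReal.ofReal (Q s)) * μ Set.univ := by
  have hms : MeasurableSet {y : E d | g ≤ ‖y‖} := measurableSet_le measurable_const measurable_norm
  have h := lintegral_polarMeasure_radial (μ := μ) hQ
    (F := (Set.Ici g).indicator 1) (measurable_one.indicator measurableSet_Ici)
  have h1 : ∀ y : E d, (Set.Ici g).indicator (1 : ℝ → ℝ≥0∞) ‖y‖
      = {y : E d | g ≤ ‖y‖}.indicator 1 y := fun y => rfl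
  simp only [h1] at h
  rw [lintegral_indicator_one hms] at h
  rw [h]
  congr 1
  have h2 : ∀ s, (Set.Ici g).indicator (1 : ℝ → ℝ≥0∞) s * ENNReal.ofReal (Q s)
      = (Set.Ici g).indicator (fun s => ENNReal.ofReal (Q s)) s := by
    intro s
    by_cases hs : s ∈ Set.Ici g <;> simp [hs]
  simp only [h2]
  rw [lintegral_indicator measurableSet_Ici, Measure.restrict_restrict measurableSet_Ici,
    Set.inter_eq_left.mpr (Set.Ici_subset_Ioi.mpr hg)]

theorem polarMeasure_small (hQ : Measurable Q) (g : ℝ) :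
    ∫⁻ y in {y | ‖y‖ < g}, ENNReal.ofReal (‖y‖ ^ 2) ∂(polarMeasure μ Q)
      = truncMoment Q g * μ Set.univ := by
  have hms : MeasurableSet {y : E d | ‖y‖ < g} := measurableSet_lt measurable_norm measurable_const
  have h := lintegral_polarMeasure_radial (μ := μ) hQ
    (F := (Set.Iio g).indicator fun s => ENNReal.ofReal (s ^ 2))
    (Measurable.indicator (by fun_prop) measurableSet_Iio)
  have h1 : ∀ y : E d, (Set.Iio g).indicator (fun s => ENNReal.ofReal (s ^ 2)) ‖y‖
      = {y : E d | ‖y‖ < g}.indicator (fun y => ENNReal.ofReal (‖y‖ ^ 2)) y := fun y => rfl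
  simp only [h1] at h
  rw [lintegral_indicator hms] at h
  rw [h, truncMoment]
  congr 1
  have h2 : ∀ s, (Set.Iio g).indicator (fun s => ENNReal.ofReal (s ^ 2)) s * ENNReal.ofReal (Q s)
      = (Set.Iio g).indicator (fun s => ENNReal.ofReal (s ^ 2 * Q s)) s := by
    intro s
    by_cases hs : s ∈ Set.Iio g
    · simp only [Set.indicator_of_mem hs]
      rw [← ENNReal.ofReal_mul (sq_nonneg s)]
    · simp [Set.indicator_of_notMem hs]
  simp only [h2]
  rw [lintegral_indicator measurableSet_Iio, Measure.restrict_restrict measurableSet_Iio,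
    Set.inter_comm, Set.Ioi_inter_Iio]

/-- A ball with ρ > r/4 is bounded by the whole tail beyond r. A smaller one lies in a cone over a
spherical cap of radius 3ρ/r, with radial coordinate in an interval of length 2ρ where Q is at most
Q(r); the cap brings (ρ/r)^{γ-1} and the interval the last power of ρ. -/
theorem polarMeasure_ball_le {δ₁ δ₂ : ℝ} (hQ : RadialProfile Q δ₁ δ₂) {γ c m : ℝ} (hγ : 1 ≤ γ)
    (hc : 0 ≤ c) (hm : μ Set.univ ≤ ENNReal.ofReal m) (hm0 : 0 ≤ m)
    (hμ : ∀ (θ : S d) (ρ : ℝ), 0 < ρ → μ (Metric.ball θ ρ) ≤ ENNReal.ofReal (c * ρ ^ (γ - 1)))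
    (w : E d) {ρ r : ℝ} (hρ : 0 < ρ) (hr : 0 < r) :
    polarMeasure μ Q (Metric.ball w ρ ∩ {y | r ≤ ‖y‖})
      ≤ ENNReal.ofReal ((4 ^ γ * m / δ₁ + 2 * c * 3 ^ (γ - 1)) * (r ^ (1 - γ) * Q r) * ρ ^ γ) := by
  have hδ := hQ.index_pos
  have hq := hQ.pos r hr
  have hms : MeasurableSet (Metric.ball w ρ ∩ {y : E d | r ≤ ‖y‖}) :=
    Metric.isOpen_ball.measurableSet.inter (measurableSet_le measurable_const measurable_norm)
  rcases lt_or_ge (r / 4) ρ with hcase | hcase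
  · calc _ ≤ polarMeasure μ Q {y | r ≤ ‖y‖} := measure_mono Set.inter_subset_right
      _ ≤ ENNReal.ofReal (r * Q r / δ₁) * ENNReal.ofReal m := by
          rw [polarMeasure_large hQ.measurable hr]
          gcongr
          exact hQ.lintegral_tail_le hr
      _ ≤ _ := by
          rw [← ENNReal.ofReal_mul (by positivity)]
          refine ENNReal.ofReal_le_ofReal ?_
          have h1 : r ^ γ ≤ 4 ^ γ * ρ ^ γ := by
            rw [← Real.mul_rpow (by norm_num) hρ.le]
            exact Real.rpow_le_rpow hr.le (by linarith) (by linarith)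
          have h2 : r ^ (1 - γ) * r ^ γ = r := by
            rw [← Real.rpow_add hr]; simp
          calc r * Q r / δ₁ * m = r ^ (1 - γ) * r ^ γ * Q r / δ₁ * m := by rw [h2]
            _ = m / δ₁ * (r ^ (1 - γ) * Q r) * r ^ γ := by ring
            _ ≤ m / δ₁ * (r ^ (1 - γ) * Q r) * (4 ^ γ * ρ ^ γ) := by gcongr
            _ = (4 ^ γ * m / δ₁ + 0) * (r ^ (1 - γ) * Q r) * ρ ^ γ := by ring
            _ ≤ _ := by gcongr; positivity
  -- For ρ ≤ r/4, a centre closer to the origin than 3r/4 leaves the intersection empty.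
  · by_cases hw : 3 / 4 * r ≤ ‖w‖
    · have hw0 : 0 < ‖w‖ := lt_of_lt_of_le (by positivity) hw
      let θ₀ : S d := ⟨‖w‖⁻¹ • w, by simp [norm_smul, inv_mul_cancel₀ hw0.ne']⟩
      have hpt : ∀ (θ : S d) (s : ℝ), 0 < s →
          (Metric.ball w ρ ∩ {y : E d | r ≤ ‖y‖}).indicator (1 : E d → ℝ≥0∞) (s • (θ : E d))
            * ENNReal.ofReal (Q s)
          ≤ (Metric.ball θ₀ (3 * (ρ / r))).indicator (1 : S d → ℝ≥0∞) θ
            * (Set.Ioo (‖w‖ - ρ) (‖w‖ + ρ)).indicator (fun _ => ENNReal.ofReal (Q r)) s := by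
        intro θ s hs
        by_cases hmem : s • (θ : E d) ∈ Metric.ball w ρ ∩ {y : E d | r ≤ ‖y‖}
        · have hrs : r ≤ s := by
            have := hmem.2
            rwa [Set.mem_ofPred_eq, norm_smul_coe_sphere hs] at this
          have hd : ‖s • (θ : E d) - w‖ < ρ := by
            have := hmem.1
            rwa [Metric.mem_ball, dist_eq_norm] at this
          have habs : |s - ‖w‖| < ρ := by
            have := abs_norm_sub_norm_le (s • (θ : E d)) w
            rw [norm_smul_coe_sphere hs] at this
            linarith
          have hsI : s ∈ Set.Ioo (‖w‖ - ρ) (‖w‖ + ρ) := by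
            rw [abs_lt] at habs
            constructor <;> linarith
          have hθ : θ ∈ Metric.ball θ₀ (3 * (ρ / r)) := by
            rw [Metric.mem_ball, Subtype.dist_eq, dist_eq_norm]
            have h1 : ‖w‖ * ‖(θ : E d) - ‖w‖⁻¹ • w‖ < 2 * ρ := by
              have h2 : ‖w‖ * ‖(θ : E d) - ‖w‖⁻¹ • w‖ = ‖‖w‖ • (θ : E d) - w‖ := by
                rw [← norm_norm w, ← norm_smul, norm_norm, smul_sub, smul_smul,
                  mul_inv_cancel₀ hw0.ne', one_smul]
              have h3 : ‖w‖ • (θ : E d) - w = (‖w‖ - s) • (θ : E d) + (s • (θ : E d) - w) := by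
                rw [sub_smul]; abel
              rw [h2, h3]
              refine (norm_add_le _ _).trans_lt ?_
              rw [norm_smul, norm_coe_sphere, mul_one, Real.norm_eq_abs, abs_sub_comm]
              linarith
            have h4 : 3 / 4 * r * ‖(θ : E d) - ‖w‖⁻¹ • w‖ < 2 * ρ :=
              lt_of_le_of_lt (by gcongr) h1
            have h5 : 3 * (ρ / r) = 3 * ρ / r := by ring
            rw [h5, lt_div_iff₀ hr]
            linarith
          rw [Set.indicator_of_mem hmem, Set.indicator_of_mem hsI, Set.indicator_of_mem hθ]
          simp only [Pi.one_apply]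
          gcongr
          exact hQ.anti hr hrs
        · rw [Set.indicator_of_notMem hmem, zero_mul]
          exact zero_le
      have hI : MeasurableSet (Set.Ioo (‖w‖ - ρ) (‖w‖ + ρ)) := measurableSet_Ioo
      calc _ = ∫⁻ θ : S d, ∫⁻ s in Set.Ioi (0 : ℝ),
            (Metric.ball w ρ ∩ {y : E d | r ≤ ‖y‖}).indicator (1 : E d → ℝ≥0∞) (s • (θ : E d))
              * ENNReal.ofReal (Q s) ∂volume ∂μ := by
            rw [← lintegral_indicator_one hms,
              lintegral_polarMeasure hQ.measurable (measurable_one.indicator hms)]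
        _ ≤ ∫⁻ θ : S d, ∫⁻ s : ℝ,
            (Metric.ball θ₀ (3 * (ρ / r))).indicator (1 : S d → ℝ≥0∞) θ
            * (Set.Ioo (‖w‖ - ρ) (‖w‖ + ρ)).indicator (fun _ => ENNReal.ofReal (Q r)) s
              ∂volume ∂μ := by
            refine lintegral_mono fun θ => ?_
            refine (setLIntegral_mono ?_ fun s hs => hpt θ s hs).trans
              (setLIntegral_le_lintegral _ _)
            exact (measurable_const.indicator hI).const_mul _
        _ = μ (Metric.ball θ₀ (3 * (ρ / r))) * (ENNReal.ofReal (Q r) * ENNReal.ofReal (2 * ρ)) := by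
            simp only [lintegral_const_mul _ (measurable_const.indicator hI),
              lintegral_indicator_const hI, Real.volume_Ioo]
            rw [lintegral_mul_const _ (measurable_one.indicator Metric.isOpen_ball.measurableSet),
              lintegral_indicator_one Metric.isOpen_ball.measurableSet]
            congr 3
            ring
        _ ≤ ENNReal.ofReal (c * (3 * (ρ / r)) ^ (γ - 1))
            * (ENNReal.ofReal (Q r) * ENNReal.ofReal (2 * ρ)) := by
            gcongr
            exact hμ θ₀ _ (by positivity)
        _ ≤ _ := by
            rw [← ENNReal.ofReal_mul (by positivity), ← ENNReal.ofReal_mul (by positivity)]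
            refine ENNReal.ofReal_le_ofReal ?_
            have h1 : ρ ^ (γ - 1) * ρ = ρ ^ γ := by
              rw [← Real.rpow_add_one hρ.ne']; congr 1; ring
            have h2 : (r ^ (γ - 1))⁻¹ = r ^ (1 - γ) := by
              rw [← Real.rpow_neg hr.le]; congr 1; ring
            rw [Real.mul_rpow (by norm_num) (by positivity), Real.div_rpow hρ.le hr.le]
            calc _ = (0 + 2 * c * 3 ^ (γ - 1)) * ((r ^ (γ - 1))⁻¹ * Q r) * (ρ ^ (γ - 1) * ρ) := by
                  ring
              _ = (0 + 2 * c * 3 ^ (γ - 1)) * (r ^ (1 - γ) * Q r) * ρ ^ γ := by rw [h1, h2]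
              _ ≤ _ := by gcongr; positivity
    · have hempty : Metric.ball w ρ ∩ {y : E d | r ≤ ‖y‖} = ∅ := by
        refine Set.eq_empty_of_forall_notMem fun y hy => hw ?_
        have h1 : ‖y - w‖ < ρ := by
          have := hy.1
          rwa [Metric.mem_ball, dist_eq_norm] at this
        have h2 : r ≤ ‖y‖ := hy.2
        have h3 := norm_le_norm_add_norm_sub' y w
        linarith
      rw [hempty, measure_empty]
      exact zero_le

theorem ofReal_phi_eq {ν : Measure (E d)} (hν : IsLevyMeasure ν) (ξ : E d) :
    ENNReal.ofReal (phi ν ξ) = ∫⁻ y, ENNReal.ofReal (1 - Real.cos (inner ℝ ξ y)) ∂ν := by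
  rw [phi, ofReal_integral_eq_lintegral_ofReal (hν.integrable_one_sub_cos ξ)]
  refine Eventually.of_forall fun y => ?_
  have := Real.cos_le_one (inner ℝ ξ y)
  simp only [Pi.zero_apply]; linarith

theorem sq_div_five_le_one_sub_cos {u : ℝ} (hu : |u| ≤ 1) : u ^ 2 / 5 ≤ 1 - Real.cos u := by
  have hpi := Real.pi_gt_three
  have hpi' := Real.pi_lt_d2
  have h1 := Real.cos_le_one_sub_mul_cos_sq (hu.trans (by linarith))
  have h2 : 1 / 5 ≤ 2 / Real.pi ^ 2 := by
    rw [div_le_div_iff₀ (by norm_num) (by positivity)]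
    nlinarith
  nlinarith [sq_nonneg u]

/-- For s < 1/|ξ| the phase is at most 1 in modulus and 1 - cos is comparable to its square. The
radial and angular variables separate into the truncated moment and the nondegenerate quadratic
form. -/
theorem polarMeasure_phi_ge [IsFiniteMeasure μ] {a : ℝ} (hQ : Measurable Q)
    (ha : ∀ ξ : E d, a * ‖ξ‖ ^ 2 ≤ ∫ θ : S d, (inner ℝ ξ (θ : E d)) ^ 2 ∂μ)
    {ξ : E d} (hξ : ξ ≠ 0) :
    ENNReal.ofReal (a * ‖ξ‖ ^ 2 / 5) * truncMoment Q ‖ξ‖⁻¹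
      ≤ ∫⁻ y, ENNReal.ofReal (1 - Real.cos (inner ℝ ξ y)) ∂(polarMeasure μ Q) := by
  have hn : 0 < ‖ξ‖ := norm_pos_iff.mpr hξ
  rw [lintegral_polarMeasure hQ (by fun_prop)]
  have hint : Integrable (fun θ : S d => (inner ℝ ξ (θ : E d)) ^ 2) μ := by
    refine Integrable.of_bound (C := ‖ξ‖ ^ 2) (Continuous.aestronglyMeasurable (by fun_prop))
      (Eventually.of_forall fun θ => ?_)
    have h1 := abs_real_inner_le_norm ξ (θ : E d)
    rw [norm_coe_sphere, mul_one] at h1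
    rw [norm_pow, Real.norm_eq_abs]
    gcongr
  have hm : Measurable fun u : ℝ => ENNReal.ofReal (u ^ 2 * Q u) := by fun_prop
  calc _ ≤ ENNReal.ofReal (∫ θ : S d, (inner ℝ ξ (θ : E d)) ^ 2 / 5 ∂μ)
        * truncMoment Q ‖ξ‖⁻¹ := by
        gcongr
        rw [integral_div]
        have := ha ξ
        linarith
    _ = ∫⁻ θ : S d, ∫⁻ s in Set.Ioo 0 ‖ξ‖⁻¹, ENNReal.ofReal ((inner ℝ ξ (θ : E d)) ^ 2 / 5)
        * ENNReal.ofReal (s ^ 2 * Q s) ∂volume ∂μ := by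
        rw [ofReal_integral_eq_lintegral_ofReal (hint.div_const 5)
          (Eventually.of_forall fun θ => by simp only [Pi.zero_apply]; positivity),
          ← lintegral_mul_const _ (by fun_prop)]
        congr 1
        ext θ
        rw [lintegral_const_mul _ hm, truncMoment]
    _ ≤ ∫⁻ θ : S d, ∫⁻ s in Set.Ioo 0 ‖ξ‖⁻¹,
        ENNReal.ofReal (1 - Real.cos (inner ℝ ξ (s • (θ : E d)))) * ENNReal.ofReal (Q s)
          ∂volume ∂μ := by
        refine lintegral_mono fun θ => setLIntegral_mono (by fun_prop) fun s hs => ?_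
        have hs0 : 0 < s := hs.1
        have hab : |inner ℝ ξ (s • (θ : E d))| ≤ 1 := by
          refine (abs_real_inner_le_norm _ _).trans ?_
          rw [norm_smul_coe_sphere hs0, ← mul_inv_cancel₀ hn.ne']
          gcongr
          exact hs.2.le
        have h1 := sq_div_five_le_one_sub_cos hab
        rw [inner_smul_right] at h1
        rw [ENNReal.ofReal_mul (by positivity), ← mul_assoc, ← ENNReal.ofReal_mul (by positivity),
          inner_smul_right]
        gcongr
        refine le_trans (le_of_eq ?_) h1
        ring
    _ ≤ _ := lintegral_mono fun θ => lintegral_mono_set Set.Ioo_subset_Ioi_self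

end PolarBounds

/-! ### From the Lévy measure to bounds at a scale. -/

/-- Bounds for a Lévy measure which is comparable to a polar measure with radial profile `Q`. -/
structure LevyBounds {d : ℕ} (ν : Measure (E d)) (Q : ℝ → ℝ) (γ A : ℝ) : Prop where
  pos : 0 < A
  large : ∀ g, 0 < g → ν {y | g ≤ ‖y‖} ≤ ENNReal.ofReal (A * (g * Q g))
  small : ∀ g, 0 < g → ∫⁻ y in {y | ‖y‖ < g}, ENNReal.ofReal (‖y‖ ^ 2) ∂ν
    ≤ ENNReal.ofReal A * truncMoment Q g
  ball : ∀ w ρ r, 0 < ρ → 0 < r → ν (Metric.ball w ρ ∩ {y | r ≤ ‖y‖})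
    ≤ ENNReal.ofReal (A * (r ^ (1 - γ) * Q r) * ρ ^ γ)
  phi_ge : ∀ ξ : E d, ξ ≠ 0 →
    ENNReal.ofReal (‖ξ‖ ^ 2) * truncMoment Q ‖ξ‖⁻¹ ≤ ENNReal.ofReal (A * phi ν ξ)

theorem RadialProfile.exists_levyBounds {d : ℕ} {μ : Measure (S d)} {ν : Measure (E d)} {Q : ℝ → ℝ}
    {δ₁ δ₂ γ : ℝ} (hQ : RadialProfile Q δ₁ δ₂) (hγ : 1 ≤ γ) (hν : IsLevyMeasure ν)
    (hμ : IsNondegenerate μ) (hμγ : IsSphericalMeasureOfOrder μ (γ - 1))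
    (hνμ : IsComparableToPolar ν μ Q) : ∃ A, LevyBounds ν Q γ A := by
  have hfin := hμγ.isFiniteMeasure
  obtain ⟨c, hc, hlow, hup⟩ := hνμ.exists_le hQ.measurable
  obtain ⟨a, ha, hnd⟩ := hμ.exists_le_integral
  obtain ⟨b, hb, hball⟩ := hμγ
  have hδ := hQ.index_pos
  set m := μ.real Set.univ with hmdef
  have hm0 : 0 ≤ m := measureReal_nonneg
  have hm : μ Set.univ = ENNReal.ofReal m := by rw [hmdef, ofReal_measureReal]
  set A₁ := c * (m / δ₁)
  set A₂ := c * m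
  set A₃ := c * (4 ^ γ * m / δ₁ + 2 * b * 3 ^ (γ - 1))
  set A₄ := 5 / a * c
  have h1 : 0 ≤ A₁ := by positivity
  have h2 : 0 ≤ A₂ := by positivity
  have h3 : 0 ≤ A₃ := by positivity
  have h4 : 0 < A₄ := by positivity
  refine ⟨A₁ + A₂ + A₃ + A₄, by positivity, fun g hg => ?_, fun g hg => ?_,
    fun w ρ r hρ hr => ?_, fun ξ hξ => ?_⟩
  · have hq := hQ.pos g hg
    calc _ ≤ ENNReal.ofReal c * (ENNReal.ofReal (g * Q g / δ₁) * ENNReal.ofReal m) := by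
          refine (hup _).trans ?_
          rw [Measure.smul_apply, smul_eq_mul, polarMeasure_large hQ.measurable hg, hm]
          gcongr
          exact hQ.lintegral_tail_le hg
      _ = ENNReal.ofReal (A₁ * (g * Q g)) := by
          rw [← ENNReal.ofReal_mul (by positivity), ← ENNReal.ofReal_mul (by positivity)]
          congr 1
          simp only [A₁]
          ring
      _ ≤ _ := by
          gcongr
          linarith
  · calc _ ≤ ENNReal.ofReal c * (truncMoment Q g * ENNReal.ofReal m) := by
          refine (lintegral_mono' (Measure.restrict_mono subset_rfl hup) le_rfl).trans ?_
          rw [Measure.restrict_smul, lintegral_smul_measure, smul_eq_mul,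
            polarMeasure_small hQ.measurable, hm]
      _ = ENNReal.ofReal A₂ * truncMoment Q g := by
          simp only [A₂]
          rw [ENNReal.ofReal_mul hc.le]
          ring
      _ ≤ _ := by
          gcongr
          linarith
  · have hq := hQ.pos r hr
    calc _ ≤ ENNReal.ofReal c * ENNReal.ofReal
          ((4 ^ γ * m / δ₁ + 2 * b * 3 ^ (γ - 1)) * (r ^ (1 - γ) * Q r) * ρ ^ γ) := by
          refine (hup _).trans ?_
          rw [Measure.smul_apply, smul_eq_mul]
          gcongr
          exact polarMeasure_ball_le hQ hγ hb.le hm.le hm0 hball w hρ hr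
      _ = ENNReal.ofReal (A₃ * (r ^ (1 - γ) * Q r) * ρ ^ γ) := by
          rw [← ENNReal.ofReal_mul hc.le]
          congr 1
          simp only [A₃]
          ring
      _ ≤ _ := by
          gcongr
          linarith
  · have hphi := phi_nonneg ν ξ
    have hge := polarMeasure_phi_ge hQ.measurable hnd hξ
    have hle : ∫⁻ y, ENNReal.ofReal (1 - Real.cos (inner ℝ ξ y)) ∂(polarMeasure μ Q)
        ≤ ENNReal.ofReal c * ENNReal.ofReal (phi ν ξ) := by
      have h5 := lintegral_mono' hlow
        (le_refl fun y : E d => ENNReal.ofReal (1 - Real.cos (inner ℝ ξ y)))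
      rw [lintegral_smul_measure, smul_eq_mul, ← ofReal_phi_eq hν] at h5
      refine le_trans (le_of_eq ?_) (mul_le_mul_right h5 (ENNReal.ofReal c))
      rw [← mul_assoc, ← ENNReal.ofReal_mul hc.le, mul_inv_cancel₀ hc.ne', ENNReal.ofReal_one,
        one_mul]
    calc _ = ENNReal.ofReal (5 / a) * (ENNReal.ofReal (a * ‖ξ‖ ^ 2 / 5)
          * truncMoment Q ‖ξ‖⁻¹) := by
          rw [← mul_assoc, ← ENNReal.ofReal_mul (by positivity)]
          congr 2
          field_simp
      _ ≤ ENNReal.ofReal (5 / a) * (ENNReal.ofReal c * ENNReal.ofReal (phi ν ξ)) := by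
          exact mul_le_mul_right (hge.trans hle) _
      _ = ENNReal.ofReal (A₄ * phi ν ξ) := by
          rw [← ENNReal.ofReal_mul hc.le, ← ENNReal.ofReal_mul (by positivity), ← mul_assoc]
      _ ≤ _ := by
          gcongr
          linarith

/-- A single term of the exponential series suffices, of order m ≥ n/a so that (u^a)^m dominates
u^n. -/
theorem exists_exp_neg_rpow_le (n : ℕ) {c a : ℝ} (hc : 0 < c) (ha : 0 < a) :
    ∃ C : ℝ, 1 ≤ C ∧ ∀ u : ℝ, 1 ≤ u → Real.exp (-(c * u ^ a)) ≤ C * ((1 + u) ^ n)⁻¹ := by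
  obtain ⟨m, hm⟩ := exists_nat_ge ((n : ℝ) / a)
  refine ⟨2 ^ n * ((m.factorial : ℝ) / c ^ m) + 1, by
    have : 0 ≤ (2 : ℝ) ^ n * ((m.factorial : ℝ) / c ^ m) := by positivity
    linarith, fun u hu => ?_⟩
  have hu0 : 0 < u := by linarith
  have hv : 1 ≤ u ^ a := Real.one_le_rpow hu ha.le
  have h1 : u ^ n ≤ (u ^ a) ^ m := by
    rw [← Real.rpow_natCast u n, ← Real.rpow_natCast (u ^ a) m, ← Real.rpow_mul hu0.le]
    refine Real.rpow_le_rpow_of_exponent_le hu ?_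
    rw [div_le_iff₀ ha] at hm
    linarith
  have h2 := Real.pow_div_factorial_le_exp (x := c * u ^ a) (by positivity) m
  rw [div_le_iff₀ (by positivity), mul_pow] at h2
  have h3 : (1 + u) ^ n ≤ 2 ^ n * u ^ n := by
    rw [← mul_pow]
    gcongr
    linarith
  rw [Real.exp_neg, ← div_eq_mul_inv, le_div_iff₀ (by positivity), inv_mul_eq_div,
    div_le_iff₀ (Real.exp_pos _)]
  calc (1 + u) ^ n ≤ 2 ^ n * (u ^ a) ^ m := h3.trans (by gcongr)
    _ = 2 ^ n / c ^ m * (c ^ m * (u ^ a) ^ m) := by field_simp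
    _ ≤ 2 ^ n / c ^ m * (Real.exp (c * u ^ a) * m.factorial) := by gcongr
    _ = 2 ^ n * ((m.factorial : ℝ) / c ^ m) * Real.exp (c * u ^ a) := by ring
    _ ≤ _ := by
        gcongr
        linarith

/-- The constant is chosen before t and g, so the density bound will be uniform in time. For g|ξ| <
1 the decay is trivial, at the price of 2^{d+1}; the scaling exponent γ + δ₂ collects γ - 1 from the
geometry and 1 + δ₂ from the profile. -/
theorem LevyBounds.exists_scaleBounds {d : ℕ} {ν : Measure (E d)} {Q : ℝ → ℝ} {γ A δ₁ δ₂ : ℝ}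
    (hν : LevyBounds ν Q γ A) (hQ : RadialProfile Q δ₁ δ₂) {M : ℕ} (hM : γ + δ₂ ≤ M)
    {B c a : ℝ} (hB : 0 ≤ B) (hc : 0 < c) (ha : 0 < a) :
    ∃ A' : ℝ, ∀ t g : ℝ, 0 < t → 0 < g → t * (g * Q g) ≤ B →
      ENNReal.ofReal t * truncMoment Q g ≤ ENNReal.ofReal (B * g ^ 2) →
      (∀ ξ : E d, 1 ≤ g * ‖ξ‖ → c * (g * ‖ξ‖) ^ a ≤ t * phi ν ξ) →
      ScaleBounds (ENNReal.ofReal t • ν) A' γ M g fun r => A * t * (r ^ (1 - γ) * Q r) := by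
  obtain ⟨C, hC, hexp⟩ := exists_exp_neg_rpow_le (d + 1) hc ha
  have hA := hν.pos
  refine ⟨A * B + 2 ^ (d + 1) * C, fun t g ht hg h1 h2 h3 => ⟨hg, fun ξ => ?_, ?_, ?_, ?_, ?_, ?_⟩⟩
  · rw [phi_smul ν ht.le]
    rcases le_or_gt 1 (g * ‖ξ‖) with h | h
    · calc _ ≤ Real.exp (-(c * (g * ‖ξ‖) ^ a)) :=
            Real.exp_le_exp.mpr (neg_le_neg (h3 ξ h))
        _ ≤ C * ((1 + g * ‖ξ‖) ^ (d + 1))⁻¹ := hexp _ h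
        _ ≤ _ := by
            gcongr
            have h4 : C ≤ 2 ^ (d + 1) * C :=
              le_mul_of_one_le_left (by linarith) (one_le_pow₀ (by norm_num))
            have : 0 ≤ A * B := by positivity
            linarith
    · have h5 : (1 + g * ‖ξ‖) ^ (d + 1) ≤ 2 ^ (d + 1) := by
        gcongr
        linarith
      have h6 : Real.exp (-(t * phi ν ξ)) ≤ 1 := by
        rw [Real.exp_le_one_iff]
        have := mul_nonneg ht.le (phi_nonneg ν ξ)
        linarith
      refine h6.trans ?_
      rw [← div_eq_mul_inv, one_le_div (by positivity)]
      refine h5.trans ?_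
      have : 0 ≤ A * B := by positivity
      have : (2 : ℝ) ^ (d + 1) ≤ 2 ^ (d + 1) * C := le_mul_of_one_le_right (by positivity) hC
      linarith
  · rw [Measure.smul_apply, smul_eq_mul]
    refine (mul_le_mul_right (hν.large g hg) _).trans ?_
    rw [← ENNReal.ofReal_mul ht.le]
    refine ENNReal.ofReal_le_ofReal ?_
    have h4 : 0 ≤ 2 ^ (d + 1) * C := by positivity
    nlinarith [mul_le_mul_of_nonneg_left h1 hA.le]
  · rw [Measure.restrict_smul, lintegral_smul_measure, smul_eq_mul]
    calc _ ≤ ENNReal.ofReal t * (ENNReal.ofReal A * truncMoment Q g) := by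
          gcongr
          exact hν.small g hg
      _ = ENNReal.ofReal A * (ENNReal.ofReal t * truncMoment Q g) := by ring
      _ ≤ ENNReal.ofReal A * ENNReal.ofReal (B * g ^ 2) := by gcongr
      _ ≤ _ := by
          rw [← ENNReal.ofReal_mul hA.le]
          refine ENNReal.ofReal_le_ofReal ?_
          have h4 : 0 ≤ 2 ^ (d + 1) * C * g ^ 2 := by positivity
          linarith
  · intro w ρ r hρ hr
    rw [Measure.smul_apply, smul_eq_mul]
    refine (mul_le_mul_right (hν.ball w ρ r hρ hr) _).trans (le_of_eq ?_)
    rw [← ENNReal.ofReal_mul ht.le]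
    congr 1
    ring
  · intro r hr
    have := hQ.pos r hr
    positivity
  · intro r b hr hb
    have hb0 : 0 < b := by linarith
    have hq := hQ.pos r hr
    have h4 := hQ.lower (r / b) b (by positivity) hb
    rw [mul_div_cancel₀ _ hb0.ne'] at h4
    have h5 : Q (r / b) ≤ b ^ (1 + δ₂) * Q r := by
      rw [show -1 - δ₂ = -(1 + δ₂) by ring, Real.rpow_neg hb0.le,
        inv_mul_le_iff₀ (by positivity)] at h4
      exact h4
    have h6 : (r / b) ^ (1 - γ) = r ^ (1 - γ) * b ^ (γ - 1) := by
      rw [Real.div_rpow hr.le hb0.le, show γ - 1 = -(1 - γ) by ring, Real.rpow_neg hb0.le,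
        div_eq_mul_inv]
    have h7 : b ^ (γ - 1) * b ^ (1 + δ₂) ≤ b ^ M := by
      rw [← Real.rpow_add hb0, ← Real.rpow_natCast b M]
      exact Real.rpow_le_rpow_of_exponent_le hb (by linarith)
    calc A * t * ((r / b) ^ (1 - γ) * Q (r / b))
        ≤ A * t * (r ^ (1 - γ) * b ^ (γ - 1) * (b ^ (1 + δ₂) * Q r)) := by
          rw [h6]
          gcongr
      _ = A * t * (r ^ (1 - γ) * Q r) * (b ^ (γ - 1) * b ^ (1 + δ₂)) := by ring
      _ ≤ A * t * (r ^ (1 - γ) * Q r) * b ^ M := by gcongr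
      _ = _ := by ring

theorem IsLevyMeasure.phi_le {d : ℕ} {ν : Measure (E d)} (hν : IsLevyMeasure ν) (ξ : E d) :
    phi ν ξ ≤ (2 + ‖ξ‖ ^ 2) * ∫ y, min 1 (‖y‖ ^ 2) ∂ν := by
  rw [phi, ← integral_const_mul]
  exact integral_mono (hν.integrable_one_sub_cos ξ) (hν.integrable_min.const_mul _)
    fun y => one_sub_cos_inner_le ξ y

/-- An upper bound for `PsiInv` from a lower bound for the characteristic exponent. -/
theorem PsiInv_le {d : ℕ} (hd : 1 ≤ d) {ν : Measure (E d)} (hν : IsLevyMeasure ν)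
    (hs : IsSymmetric ν) {t g c a : ℝ} (ht : 0 < t) (hg : 0 < g) (hc : 0 < c) (ha : 0 < a)
    (hphi : ∀ ξ : E d, 1 ≤ g * ‖ξ‖ → c * (g * ‖ξ‖) ^ a ≤ t * phi ν ξ) :
    PsiInv ν 0 (1 / t) ≤ (1 + (1 / c) ^ (1 / a)) / g := by
  refine Real.sSup_le (fun r hr => ?_) (by positivity)
  obtain ⟨hr0, hr⟩ := hr
  rw [le_div_iff₀ hg, mul_comm]
  by_contra! hlt
  have hc1 : 0 ≤ (1 / c) ^ (1 / a) := by positivity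
  -- On the level set t Ψ(r) = 1, a frequency of norm r satisfies t Φ ≤ 1, which the lower bound
  -- excludes once g r > (1/c)^{1/a}. Such a frequency exists because d ≥ 1.
  obtain ⟨ξ, hξ⟩ : ∃ ξ : E d, ‖ξ‖ = r :=
    ⟨EuclideanSpace.single (⟨0, hd⟩ : Fin d) r, by simp [abs_of_pos hr0]⟩
  have h1 := hphi ξ (by rw [hξ]; linarith)
  have hI : 0 ≤ ∫ y, min 1 (‖y‖ ^ 2) ∂ν :=
    integral_nonneg fun y => by simp only [Pi.zero_apply]; positivity
  have h2 : phi ν ξ ≤ Psi ν 0 r := by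
    refine le_csSup ?_ ⟨ξ, by simp [hξ], by simp only [hν.charExponent_eq hs, Complex.ofReal_re]⟩
    refine ⟨(2 + r ^ 2) * ∫ y, min 1 (‖y‖ ^ 2) ∂ν, ?_⟩
    rintro _ ⟨ζ, hζ, rfl⟩
    simp only [hν.charExponent_eq hs, Complex.ofReal_re]
    have hζ' : ‖ζ‖ ≤ r := by simpa using hζ
    have hsq : ‖ζ‖ ^ 2 ≤ r ^ 2 := pow_le_pow_left₀ (norm_nonneg _) hζ' 2
    exact (hν.phi_le ζ).trans (mul_le_mul_of_nonneg_right (by linarith) hI)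
  rw [hr] at h2
  have h3 : t * phi ν ξ ≤ 1 := by
    calc _ ≤ t * (1 / t) := by gcongr
      _ = 1 := by field_simp
  rw [hξ] at h1
  have h4 : (g * r) ^ a ≤ 1 / c := by
    rw [le_div_iff₀ hc]; linarith
  have h5 : g * r ≤ (1 / c) ^ (1 / a) := by
    have h6 := Real.rpow_le_rpow (by positivity) h4 (show 0 ≤ 1 / a by positivity)
    rwa [← Real.rpow_mul (by positivity), mul_one_div_cancel ha.ne', Real.rpow_one] at h6
  linarith

theorem IsLevySemigroup.charFun_eq_exp_phi {d : ℕ} {ν : Measure (E d)} {P : ℝ → Measure (E d)}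
    (hP : IsLevySemigroup ν 0 P) (hν : IsLevyMeasure ν) (hs : IsSymmetric ν) {t : ℝ} (ht : 0 < t)
    (ξ : E d) :
    charFun (P t) ξ = ((Real.exp (-phi (ENNReal.ofReal t • ν) ξ) : ℝ) : ℂ) := by
  rw [hP.charFun_eq t ht.le, hν.charExponent_eq hs, phi_smul ν ht.le]
  push_cast
  rfl

/-! ### Density bounds for the semigroup at a controlling scale. -/

/-- The scale `g` controls the semigroup at time `t`, with constants `B`, `c`, `a`. -/
structure IsScale {d : ℕ} (ν : Measure (E d)) (Q : ℝ → ℝ) (B c a t g : ℝ) : Prop where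
  time_pos : 0 < t
  pos : 0 < g
  tail : t * (g * Q g) ≤ B
  moment : ENNReal.ofReal t * truncMoment Q g ≤ ENNReal.ofReal (B * g ^ 2)
  phi_ge : ∀ ξ : E d, 1 ≤ g * ‖ξ‖ → c * (g * ‖ξ‖) ^ a ≤ t * phi ν ξ

section Semigroup

variable {d : ℕ} {ν : Measure (E d)} {P : ℝ → Measure (E d)} {Q : ℝ → ℝ} {A γ δ₁ δ₂ B c a : ℝ}

theorem LevyBounds.exists_density_le (hb : LevyBounds ν Q γ A) (hQ : RadialProfile Q δ₁ δ₂)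
    (hν : IsLevyMeasure ν) (hs : IsSymmetric ν) (hP : IsLevySemigroup ν 0 P)
    (hB : 0 ≤ B) (hc : 0 < c) (ha : 0 < a) :
    ∃ C : ℝ, 0 < C ∧ ∀ t g : ℝ, IsScale ν Q B c a t g →
      (Integrable fun v => charFun (P t) ((2 * Real.pi) • v)) ∧
      ∀ x : E d, charDensity (P t) x ≤ C * (g ^ d)⁻¹ ∧ (x ≠ 0 →
        charDensity (P t) x ≤ C * (g ^ d)⁻¹ * (t * g ^ γ * (‖x‖ ^ (1 - γ) * Q ‖x‖)
          + Real.exp (-(1 / 8 * (‖x‖ / g) * Real.log (1 + 1 / 2 * (‖x‖ / g)))))) := by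
  obtain ⟨M, hM⟩ := exists_nat_ge (γ + δ₂)
  obtain ⟨A', hA'⟩ := hb.exists_scaleBounds hQ hM hB hc ha
  obtain ⟨C, hC, hC'⟩ := ScaleBounds.exists_charDensity_le d A' γ M
  have hinv := hs.isNegInvariant
  have hsf := hν.sfinite
  have hA := hb.pos
  refine ⟨|A' * decayMass d| + C * (A + 1), by positivity, fun t g hg => ?_⟩
  have ht := hg.time_pos
  have hg0 := hg.pos
  have hsc := hA' t g ht hg0 hg.tail hg.moment hg.phi_ge
  have hch := fun ξ => hP.charFun_eq_exp_phi hν hs ht ξ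
  have hinv' : (ENNReal.ofReal t • ν).IsNegInvariant := isNegInvariant_smul ν _
  refine ⟨hsc.integrable_charFun hch, fun x => ⟨?_, fun hx => ?_⟩⟩
  · refine (hsc.charDensity_le_diag hch x).trans ?_
    gcongr
    have := le_abs_self (A' * decayMass d)
    have : 0 ≤ C * (A + 1) := by positivity
    linarith
  · have hq : 0 < Q ‖x‖ := hQ.pos _ (norm_pos_iff.mpr hx)
    refine (hC' _ g _ (P t) hsc hch x hx).trans ?_
    have he := (Real.exp_pos (-(1 / 8 * (‖x‖ / g) * Real.log (1 + 1 / 2 * (‖x‖ / g))))).le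
    set G := Real.exp (-(1 / 8 * (‖x‖ / g) * Real.log (1 + 1 / 2 * (‖x‖ / g))))
    have hF : 0 ≤ t * g ^ γ * (‖x‖ ^ (1 - γ) * Q ‖x‖) := by positivity
    calc _ = C * (g ^ d)⁻¹ * (A * (t * g ^ γ * (‖x‖ ^ (1 - γ) * Q ‖x‖)) + 1 * G) := by ring
      _ ≤ C * (g ^ d)⁻¹ * ((A + 1) * (t * g ^ γ * (‖x‖ ^ (1 - γ) * Q ‖x‖)) + (A + 1) * G) := by
          gcongr <;> linarith
      _ = (0 + C * (A + 1)) * (g ^ d)⁻¹ * (t * g ^ γ * (‖x‖ ^ (1 - γ) * Q ‖x‖) + G) := by ring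
      _ ≤ _ := by
          gcongr
          positivity

theorem exists_exp_neg_mul_log_le (M : ℕ) : ∃ C : ℝ, 0 < C ∧ ∀ R : ℝ, 1 ≤ R →
    Real.exp (-(1 / 8 * R * Real.log (1 + 1 / 2 * R))) ≤ C * (R ^ M)⁻¹ := by
  have hk : 0 < Real.log (1 + 1 / 2) := Real.log_pos (by norm_num)
  obtain ⟨C, hC, h⟩ := exists_exp_neg_rpow_le M
    (show 0 < 1 / 8 * Real.log (1 + 1 / 2) by positivity) one_pos
  refine ⟨C, by linarith, fun R hR => ?_⟩
  have h1 := h R hR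
  rw [Real.rpow_one] at h1
  calc _ ≤ Real.exp (-(1 / 8 * Real.log (1 + 1 / 2) * R)) := by
        refine Real.exp_le_exp.mpr (neg_le_neg ?_)
        calc _ = 1 / 8 * R * Real.log (1 + 1 / 2 * 1) := by ring_nf
          _ ≤ _ := by gcongr
    _ ≤ _ := h1
    _ ≤ _ := by
        gcongr
        linarith

/-- If the profile is not negligible at the scale `g`, the exponential term can be dropped. -/
theorem LevyBounds.exists_density_le_minOne (hb : LevyBounds ν Q γ A) (hQ : RadialProfile Q δ₁ δ₂)
    (hγ : 1 ≤ γ) (hν : IsLevyMeasure ν) (hs : IsSymmetric ν) (hP : IsLevySemigroup ν 0 P)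
    (hB : 0 ≤ B) (hc : 0 < c) (ha : 0 < a) {b : ℝ} (hb0 : 0 < b) :
    ∃ C : ℝ, 0 < C ∧ ∀ t g : ℝ, IsScale ν Q B c a t g → b ≤ t * (g * Q g) →
      ∀ x : E d, charDensity (P t) x ≤ C * (g ^ d)⁻¹
        * minOne x (t * g ^ γ * (‖x‖ ^ (1 - γ) * Q ‖x‖)) := by
  obtain ⟨M, hM⟩ := exists_nat_ge (γ + δ₂)
  obtain ⟨C, hC, hC'⟩ := hb.exists_density_le hQ hν hs hP hB hc ha
  obtain ⟨C₁, hC₁, hexp⟩ := exists_exp_neg_mul_log_le M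
  refine ⟨C * (1 + 1 / b + C₁ / b), by positivity, fun t g hg hbt x => ?_⟩
  have ht := hg.time_pos
  have hg0 := hg.pos
  obtain ⟨-, hx⟩ := hC' t g hg
  obtain ⟨hdiag, hoff⟩ := hx x
  have hgd : 0 < (g ^ d)⁻¹ := by positivity
  rw [minOne]
  split_ifs with hx0
  · refine hdiag.trans ?_
    rw [mul_one]
    gcongr
    refine le_mul_of_one_le_right hC.le ?_
    have : 0 < 1 / b + C₁ / b := by positivity
    linarith
  have hr : 0 < ‖x‖ := norm_pos_iff.mpr hx0
  have hq := hQ.pos _ hr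
  have hqg := hQ.pos _ hg0
  have hoff := hoff hx0
  set v := t * g ^ γ * (‖x‖ ^ (1 - γ) * Q ‖x‖) with hv
  have hv0 : 0 < v := by positivity
  have hgg : t * g ^ γ * (g ^ (1 - γ) * Q g) = t * (g * Q g) := by
    have : g ^ γ * g ^ (1 - γ) = g := by rw [← Real.rpow_add hg0]; simp
    calc _ = t * ((g ^ γ * g ^ (1 - γ)) * Q g) := by ring
      _ = _ := by rw [this]
  have hsecond : charDensity (P t) x ≤ C * (1 + 1 / b + C₁ / b) * (g ^ d)⁻¹ * v := by
    -- Beyond g the profile term decays at most like R^{-M} with R = |x|/g, slower than the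
    -- exponential. Below g it is at least b, because r^{1-γ} and Q are nonincreasing, and the
    -- diagonal bound suffices.
    rcases le_or_gt g ‖x‖ with h | h
    · have hR : 1 ≤ ‖x‖ / g := (one_le_div hg0).mpr h
      have h1 := hQ.lower g (‖x‖ / g) hg0 hR
      rw [div_mul_cancel₀ _ hg0.ne'] at h1
      have h2 : b * ((‖x‖ / g) ^ M)⁻¹ ≤ v := by
        have hRR : 0 < ‖x‖ / g := by positivity
        have h3 : ‖x‖ ^ (1 - γ) = (‖x‖ / g) ^ (1 - γ) * g ^ (1 - γ) := by
          rw [← Real.mul_rpow hRR.le hg0.le, div_mul_cancel₀ _ hg0.ne']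
        have h4 : ((‖x‖ / g) ^ M)⁻¹ ≤ (‖x‖ / g) ^ (1 - γ) * (‖x‖ / g) ^ (-1 - δ₂) := by
          rw [← Real.rpow_add hRR, ← Real.rpow_natCast, ← Real.rpow_neg hRR.le]
          exact Real.rpow_le_rpow_of_exponent_le hR (by linarith)
        calc _ ≤ t * (g * Q g) * ((‖x‖ / g) ^ (1 - γ) * (‖x‖ / g) ^ (-1 - δ₂)) := by gcongr
          _ = t * g ^ γ * ((‖x‖ / g) ^ (1 - γ) * g ^ (1 - γ) * ((‖x‖ / g) ^ (-1 - δ₂) * Q g)) := by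
              rw [← hgg]; ring
          _ ≤ t * g ^ γ * ((‖x‖ / g) ^ (1 - γ) * g ^ (1 - γ) * Q ‖x‖) := by gcongr
          _ = v := by rw [hv, h3]
      have h5 : Real.exp (-(1 / 8 * (‖x‖ / g) * Real.log (1 + 1 / 2 * (‖x‖ / g)))) ≤ C₁ / b * v := by
        refine (hexp _ hR).trans ?_
        calc _ = C₁ / b * (b * ((‖x‖ / g) ^ M)⁻¹) := by field_simp
          _ ≤ _ := by gcongr
      calc _ ≤ C * (g ^ d)⁻¹ * (v + C₁ / b * v) := hoff.trans (by gcongr)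
        _ = C * (1 + 0 + C₁ / b) * (g ^ d)⁻¹ * v := by ring
        _ ≤ _ := by
            gcongr
            positivity
    · have h2 : b ≤ v := by
        refine hbt.trans ?_
        rw [← hgg, hv]
        have h3 : g ^ (1 - γ) ≤ ‖x‖ ^ (1 - γ) :=
          Real.rpow_le_rpow_of_nonpos hr h.le (by linarith)
        have h4 := hQ.anti hr h.le
        gcongr
      calc _ ≤ C * (g ^ d)⁻¹ * 1 := by rw [mul_one]; exact hdiag
        _ ≤ C * (g ^ d)⁻¹ * (1 / b * v) := by
            gcongr
            rw [one_div, inv_mul_eq_div, one_le_div hb0]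
            exact h2
        _ = C * (0 + 1 / b + 0) * (g ^ d)⁻¹ * v := by ring
        _ ≤ _ := by
            gcongr
            · exact zero_le_one
            · positivity
  rw [mul_min_of_nonneg _ _ (by positivity)]
  refine le_min ?_ hsecond
  refine hdiag.trans ?_
  rw [mul_one]
  gcongr
  refine le_mul_of_one_le_right hC.le ?_
  have : 0 < 1 / b + C₁ / b := by positivity
  linarith

/-- The lower bound for the characteristic exponent at a scale where the profile is not
negligible. -/
theorem LevyBounds.le_mul_phi (hb : LevyBounds ν Q γ A) (hQ : RadialProfile Q δ₁ δ₂) {b t g : ℝ}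
    (ht : 0 < t) (hg : 0 < g) (hbt : b ≤ t * (g * Q g)) (ξ : E d) (hξ : 1 ≤ g * ‖ξ‖) :
    b / (8 * A) * (g * ‖ξ‖) ^ δ₁ ≤ t * phi ν ξ := by
  have hA := hb.pos
  have hn : 0 < ‖ξ‖ := by
    by_contra h
    have : ‖ξ‖ = 0 := le_antisymm (not_lt.mp h) (norm_nonneg _)
    rw [this] at hξ
    linarith
  have hq := hQ.pos _ (inv_pos.mpr hn)
  have h1 : Q ‖ξ‖⁻¹ / (8 * ‖ξ‖) ≤ A * phi ν ξ := by
    have h2 := hb.phi_ge ξ (norm_pos_iff.mp hn)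
    have h3 := hQ.le_truncMoment (inv_pos.mpr hn)
    have h4 := (mul_le_mul_right h3 (ENNReal.ofReal (‖ξ‖ ^ 2))).trans h2
    rw [← ENNReal.ofReal_mul (by positivity), ENNReal.ofReal_le_ofReal_iff
      (mul_nonneg hA.le (phi_nonneg ν ξ))] at h4
    refine le_trans (le_of_eq ?_) h4
    field_simp
  have h2 := hQ.upper ‖ξ‖⁻¹ (g * ‖ξ‖) (inv_pos.mpr hn) hξ
  rw [mul_assoc, mul_inv_cancel₀ hn.ne', mul_one] at h2
  have hu : 0 < g * ‖ξ‖ := by positivity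
  have h5 : (g * ‖ξ‖) ^ δ₁ = (g * ‖ξ‖) ^ (1 + δ₁) / (g * ‖ξ‖) := by
    rw [Real.rpow_add hu, Real.rpow_one]; field_simp
  have h6 : (g * ‖ξ‖) ^ (1 + δ₁) * Q g ≤ Q ‖ξ‖⁻¹ := by
    calc _ ≤ (g * ‖ξ‖) ^ (1 + δ₁) * ((g * ‖ξ‖) ^ (-1 - δ₁) * Q ‖ξ‖⁻¹) := by gcongr
      _ = Q ‖ξ‖⁻¹ := by
          rw [← mul_assoc, ← Real.rpow_add hu]
          simp
  calc _ ≤ t * (g * Q g) / (8 * A) * (g * ‖ξ‖) ^ δ₁ := by gcongr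
    _ = t / A * ((g * ‖ξ‖) ^ (1 + δ₁) * Q g / (8 * ‖ξ‖)) := by
        rw [h5]; field_simp
    _ ≤ t / A * (Q ‖ξ‖⁻¹ / (8 * ‖ξ‖)) := by gcongr
    _ ≤ t / A * (A * phi ν ξ) := by gcongr
    _ = _ := by field_simp

end Semigroup

/-! ### The logarithmic profile. -/

/-- `log (1 + s^(-κ))`. -/
noncomputable def logTerm (κ s : ℝ) : ℝ := Real.log (1 + s ^ (-κ))

/-- The radial profile `s^(-1-α) [log (1 + s^(-κ))]^(-β)`. -/
noncomputable def logProfile (α κ β s : ℝ) : ℝ := s ^ (-1 - α) * logFactor κ β s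

theorem logFactor_eq (κ β s : ℝ) : logFactor κ β s = logTerm κ s ^ (-β) := rfl

theorem logTerm_pos (κ : ℝ) {s : ℝ} (hs : 0 < s) : 0 < logTerm κ s := by
  have : 0 < s ^ (-κ) := by positivity
  exact Real.log_pos (by linarith)

theorem log_one_add_mul_le {b u : ℝ} (hb : 1 ≤ b) (hu : 0 ≤ u) :
    Real.log (1 + b * u) ≤ b * Real.log (1 + u) := by
  rw [← Real.log_rpow (by linarith)]
  refine Real.log_le_log (by positivity) ?_
  exact one_add_mul_self_le_rpow_one_add (by linarith) hb

theorem logTerm_anti {κ : ℝ} (hκ : 0 ≤ κ) {r s : ℝ} (hr : 0 < r) (hrs : r ≤ s) :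
    logTerm κ s ≤ logTerm κ r := by
  have hs : 0 < s := hr.trans_le hrs
  have h : s ^ (-κ) ≤ r ^ (-κ) := Real.rpow_le_rpow_of_nonpos hr hrs (by linarith)
  exact Real.log_le_log (by positivity) (by linarith)

/-- Bernoulli's inequality, via `log_one_add_mul_le` with factor b^κ: the logarithm falls no faster
than the power inside it. -/
theorem rpow_neg_mul_logTerm_le {κ : ℝ} (hκ : 0 ≤ κ) {s b : ℝ} (hs : 0 < s) (hb : 1 ≤ b) :
    b ^ (-κ) * logTerm κ s ≤ logTerm κ (b * s) := by
  have hb0 : 0 < b := by linarith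
  have h := log_one_add_mul_le (Real.one_le_rpow hb hκ) (show 0 ≤ (b * s) ^ (-κ) by positivity)
  rw [Real.mul_rpow hb0.le hs.le, ← mul_assoc, ← Real.rpow_add hb0, add_neg_cancel,
    Real.rpow_zero, one_mul, ← Real.mul_rpow hb0.le hs.le] at h
  rw [Real.rpow_neg hb0.le, inv_mul_le_iff₀ (by positivity)]
  exact h

/-- Under dilation by b the logarithmic factor changes by something between 1 and b^{κβ}, in an
order depending on the sign of β. This gives the two indices α and α - κβ. -/
theorem logProfile_radialProfile {α κ β : ℝ} (hα : 0 < α) (hκ : 0 < κ) (hκβ : κ * β < α) :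
    RadialProfile (logProfile α κ β) (min α (α - κ * β)) (max α (α - κ * β)) := by
  have hpow : ∀ s b : ℝ, 0 < s → 1 ≤ b →
      min 1 (b ^ (κ * β)) * logFactor κ β s ≤ logFactor κ β (b * s) ∧
      logFactor κ β (b * s) ≤ max 1 (b ^ (κ * β)) * logFactor κ β s := by
    intro s b hs hb
    have hb0 : 0 < b := by linarith
    have hbs : 0 < b * s := by positivity
    have h0 := logTerm_pos κ hs
    have h0' := logTerm_pos κ hbs
    have h1 := rpow_neg_mul_logTerm_le hκ.le hs hb
    have h2 := logTerm_anti hκ.le hs (le_mul_of_one_le_left hs.le hb)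
    have h3 : (b ^ (-κ) * logTerm κ s) ^ (-β) = b ^ (κ * β) * logTerm κ s ^ (-β) := by
      rw [Real.mul_rpow (by positivity) h0.le, ← Real.rpow_mul hb0.le]
      congr 2
      ring
    simp only [logFactor_eq]
    have hp : 0 ≤ logTerm κ s ^ (-β) := by positivity
    rcases le_total 0 β with hβ | hβ
    · have h4 := Real.rpow_le_rpow_of_nonpos (by positivity) h1 (show -β ≤ 0 by linarith)
      have h5 := Real.rpow_le_rpow_of_nonpos h0' h2 (show -β ≤ 0 by linarith)
      rw [h3] at h4
      exact ⟨(mul_le_of_le_one_left hp (min_le_left _ _)).trans h5,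
        h4.trans (mul_le_mul_of_nonneg_right (le_max_right _ _) hp)⟩
    · have h4 := Real.rpow_le_rpow (by positivity) h1 (show 0 ≤ -β by linarith)
      have h5 := Real.rpow_le_rpow h0'.le h2 (show 0 ≤ -β by linarith)
      rw [h3] at h4
      exact ⟨(mul_le_mul_of_nonneg_right (min_le_right _ _) hp).trans h4,
        h5.trans (le_mul_of_one_le_left hp (le_max_left _ _))⟩
  have hmul : ∀ s b : ℝ, 0 < s → 0 < b → logProfile α κ β (b * s)
      = b ^ (-1 - α) * s ^ (-1 - α) * logFactor κ β (b * s) := by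
    intro s b hs hb
    rw [logProfile, Real.mul_rpow hb.le hs.le]
  refine ⟨?_, fun s hs => ?_, lt_min hα (by linarith), fun s b hs hb => ?_, fun s b hs hb => ?_⟩
  · unfold logProfile logFactor
    fun_prop
  · have := logTerm_pos κ hs
    rw [logProfile, logFactor_eq]
    positivity
  · have hb0 : 0 < b := by linarith
    rw [hmul s b hs hb0, logProfile]
    have h1 : b ^ (-1 - α) * max 1 (b ^ (κ * β)) ≤ b ^ (-1 - min α (α - κ * β)) := by
      rw [mul_max_of_nonneg _ _ (by positivity), mul_one, ← Real.rpow_add hb0]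
      refine max_le (Real.rpow_le_rpow_of_exponent_le hb ?_)
        (Real.rpow_le_rpow_of_exponent_le hb ?_)
      · linarith [min_le_left α (α - κ * β)]
      · linarith [min_le_right α (α - κ * β)]
    have hl : 0 < logFactor κ β s := by
      rw [logFactor_eq]; have := logTerm_pos κ hs; positivity
    calc _ ≤ b ^ (-1 - α) * s ^ (-1 - α) * (max 1 (b ^ (κ * β)) * logFactor κ β s) := by
          gcongr
          exact (hpow s b hs hb).2
      _ = b ^ (-1 - α) * max 1 (b ^ (κ * β)) * (s ^ (-1 - α) * logFactor κ β s) := by ring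
      _ ≤ _ := by gcongr
  · have hb0 : 0 < b := by linarith
    rw [hmul s b hs hb0, logProfile]
    have h1 : b ^ (-1 - max α (α - κ * β)) ≤ b ^ (-1 - α) * min 1 (b ^ (κ * β)) := by
      rw [mul_min_of_nonneg _ _ (by positivity), mul_one, ← Real.rpow_add hb0]
      refine le_min (Real.rpow_le_rpow_of_exponent_le hb ?_)
        (Real.rpow_le_rpow_of_exponent_le hb ?_)
      · linarith [le_max_left α (α - κ * β)]
      · linarith [le_max_right α (α - κ * β)]
    have hl : 0 < logFactor κ β s := by
      rw [logFactor_eq]; have := logTerm_pos κ hs; positivity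
    calc _ ≤ b ^ (-1 - α) * min 1 (b ^ (κ * β)) * (s ^ (-1 - α) * logFactor κ β s) := by gcongr
      _ = b ^ (-1 - α) * s ^ (-1 - α) * (min 1 (b ^ (κ * β)) * logFactor κ β s) := by ring
      _ ≤ _ := by
          gcongr
          exact (hpow s b hs hb).1

/-! ### The critical case: the truncated moment for α = 2. -/

section Critical

variable {κ β : ℝ}

/-- The derivative of `[log (1 + u^(-κ))]^(1-β)`, up to the constant `(β - 1) κ`. -/
theorem hasDerivAt_logTerm_rpow {u : ℝ} (hu : 0 < u) :
    HasDerivAt (fun u => logTerm κ u ^ (1 - β))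
      ((β - 1) * κ * (u ^ 2 * logProfile 2 κ β u / (1 + u ^ κ))) u := by
  have h0 := logTerm_pos κ hu
  have hk : 0 < u ^ κ := by positivity
  have hkn : 0 < u ^ (-κ) := by positivity
  have h1 : HasDerivAt (fun u : ℝ => u ^ (-κ)) (-κ * u ^ (-κ - 1)) u :=
    Real.hasDerivAt_rpow_const (Or.inl hu.ne')
  have h2 : HasDerivAt (logTerm κ) (-κ * u ^ (-κ - 1) / (1 + u ^ (-κ))) u :=
    (h1.const_add 1).log (by positivity)
  have h3 := h2.rpow_const (p := 1 - β) (Or.inl h0.ne')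
  refine h3.congr_deriv ?_
  rw [logProfile, logFactor_eq, show 1 - β - 1 = -β by ring]
  have h4 : u ^ (-κ - 1) = (u ^ κ)⁻¹ * u⁻¹ := by
    rw [sub_eq_add_neg, Real.rpow_add hu, Real.rpow_neg hu.le, Real.rpow_neg_one]
  have h5 : u ^ (-1 - 2 : ℝ) = (u ^ 3)⁻¹ := by
    rw [← Real.rpow_natCast u 3, ← Real.rpow_neg hu.le]
    norm_num
  rw [h4, h5, Real.rpow_neg hu.le κ]
  field_simp
  ring

/-- The conventions 0^{-κ} = 0 and 0^{1-β} = 0 happen to produce the true limit at the origin, where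
the logarithm is infinite and 1 - β < 0. The primitive is thus continuous on the closed half-line.
-/
theorem logTerm_rpow_zero (hκ : 0 < κ) (hβ : 1 < β) : logTerm κ 0 ^ (1 - β) = 0 := by
  rw [logTerm, Real.zero_rpow (by linarith), add_zero, Real.log_one, Real.zero_rpow (by linarith)]

theorem continuousWithinAt_logTerm_rpow_zero (hκ : 0 < κ) (hβ : 1 < β) :
    ContinuousWithinAt (fun u => logTerm κ u ^ (1 - β)) (Set.Ici 0) 0 := by
  rw [← continuousWithinAt_Ioi_iff_Ici, ContinuousWithinAt, logTerm_rpow_zero hκ hβ]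
  have h1 : Tendsto (fun u : ℝ => u ^ (-κ)) (𝓝[>] 0) atTop :=
    tendsto_rpow_neg_nhdsGT_zero (by linarith)
  have h2 : Tendsto (logTerm κ) (𝓝[>] 0) atTop :=
    Real.tendsto_log_atTop.comp (tendsto_atTop_add_const_left _ 1 h1)
  have h3 := (tendsto_rpow_neg_atTop (show 0 < β - 1 by linarith)).comp h2
  refine h3.congr fun u => ?_
  simp only [Function.comp_apply]
  congr 1
  ring

/-- The fundamental theorem of calculus up to the singular endpoint; integrability comes from the
sign of the derivative. The factor 1/(1 + u^κ) lies between 1/(1 + s^κ) and 1 on (0,s), which yields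
both bounds for the truncated moment. -/
theorem lintegral_logProfile_div (hκ : 0 < κ) (hβ : 1 < β) {s : ℝ} (hs : 0 < s) :
    ∫⁻ u in Set.Ioo 0 s, ENNReal.ofReal ((β - 1) * κ * (u ^ 2 * logProfile 2 κ β u / (1 + u ^ κ)))
      = ENNReal.ofReal (logTerm κ s ^ (1 - β)) := by
  have hpos : ∀ u : ℝ, 0 < u →
      0 ≤ (β - 1) * κ * (u ^ 2 * logProfile 2 κ β u / (1 + u ^ κ)) := by
    intro u hu
    have h0 := logTerm_pos κ hu
    have hb : 0 < β - 1 := by linarith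
    rw [logProfile, logFactor_eq]
    positivity
  have hcont : ContinuousOn (fun u => logTerm κ u ^ (1 - β)) (Set.Icc 0 s) := by
    intro u hu
    rcases hu.1.eq_or_lt with rfl | hu0
    · exact (continuousWithinAt_logTerm_rpow_zero hκ hβ).mono Set.Icc_subset_Ici_self
    · exact (hasDerivAt_logTerm_rpow hu0).continuousAt.continuousWithinAt
  have hint := intervalIntegral.integrableOn_deriv_of_nonneg hcont
    (fun u hu => hasDerivAt_logTerm_rpow (κ := κ) (β := β) hu.1) (fun u hu => hpos u hu.1)
  have hftc := intervalIntegral.integral_eq_sub_of_hasDerivAt_of_le hs.le hcont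
    (fun u hu => hasDerivAt_logTerm_rpow (κ := κ) (β := β) hu.1)
    ((intervalIntegrable_iff_integrableOn_Ioc_of_le hs.le).mpr hint)
  rw [logTerm_rpow_zero hκ hβ, sub_zero, intervalIntegral.integral_of_le hs.le] at hftc
  rw [setLIntegral_congr Ioo_ae_eq_Ioc, ← hftc, ofReal_integral_eq_lintegral_ofReal hint]
  filter_upwards [ae_restrict_mem measurableSet_Ioc] with u hu
  exact hpos u hu.1

theorem le_truncMoment_logProfile (hκ : 0 < κ) (hβ : 1 < β) {s : ℝ} (hs : 0 < s) :
    ENNReal.ofReal (logTerm κ s ^ (1 - β) / ((β - 1) * κ)) ≤ truncMoment (logProfile 2 κ β) s := by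
  have hb : 0 < β - 1 := by linarith
  have hbk : 0 < (β - 1) * κ := by positivity
  have hmeas : Measurable (logProfile 2 κ β) := by
    unfold logProfile logFactor
    fun_prop
  rw [div_eq_inv_mul, ENNReal.ofReal_mul (by positivity), ← lintegral_logProfile_div hκ hβ hs,
    ← lintegral_const_mul _ (by fun_prop)]
  refine setLIntegral_mono (by fun_prop) fun u hu => ?_
  have hu0 : 0 < u := hu.1
  have h0 := logTerm_pos κ hu0
  have hq : 0 < logProfile 2 κ β u := by rw [logProfile, logFactor_eq]; positivity
  rw [← ENNReal.ofReal_mul (by positivity), ← mul_assoc, inv_mul_cancel₀ hbk.ne', one_mul]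
  refine ENNReal.ofReal_le_ofReal (div_le_self (by positivity) ?_)
  have : 0 < u ^ κ := by positivity
  linarith

theorem truncMoment_logProfile_le (hκ : 0 < κ) (hβ : 1 < β) {s : ℝ} (hs : 0 < s) :
    truncMoment (logProfile 2 κ β) s
      ≤ ENNReal.ofReal ((1 + s ^ κ) * logTerm κ s ^ (1 - β) / ((β - 1) * κ)) := by
  have hb : 0 < β - 1 := by linarith
  have hbk : 0 < (β - 1) * κ := by positivity
  have hmeas : Measurable (logProfile 2 κ β) := by
    unfold logProfile logFactor
    fun_prop
  have h1 : (1 + s ^ κ) * logTerm κ s ^ (1 - β) / ((β - 1) * κ)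
      = (1 + s ^ κ) / ((β - 1) * κ) * logTerm κ s ^ (1 - β) := by ring
  rw [h1, ENNReal.ofReal_mul (by positivity), ← lintegral_logProfile_div hκ hβ hs,
    ← lintegral_const_mul _ (by fun_prop)]
  refine setLIntegral_mono (by fun_prop) fun u hu => ?_
  have hu0 : 0 < u := hu.1
  have h0 := logTerm_pos κ hu0
  have hq : 0 < logProfile 2 κ β u := by rw [logProfile, logFactor_eq]; positivity
  rw [← ENNReal.ofReal_mul (by positivity)]
  refine ENNReal.ofReal_le_ofReal ?_
  have h2 : u ^ κ ≤ s ^ κ := Real.rpow_le_rpow hu0.le hu.2.le hκ.le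
  have h3 : 0 < 1 + u ^ κ := by positivity
  have h4 : (1 + s ^ κ) / ((β - 1) * κ) *
      ((β - 1) * κ * (u ^ 2 * logProfile 2 κ β u / (1 + u ^ κ)))
      = (1 + s ^ κ) / (1 + u ^ κ) * (u ^ 2 * logProfile 2 κ β u) := by
    field_simp
  rw [h4]
  refine le_mul_of_one_le_left (by positivity) ?_
  rw [one_le_div h3]
  linarith

end Critical

/-! ### Asymptotics of the logarithmic term along the scales. -/

theorem rpow_bounds {c C : ℝ} (hc : 0 < c) (q : ℝ) {x : ℝ} (hx : c ≤ x) (hx' : x ≤ C) :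
    min (c ^ q) (C ^ q) ≤ x ^ q ∧ x ^ q ≤ max (c ^ q) (C ^ q) := by
  have hx0 : 0 < x := hc.trans_le hx
  rcases le_total 0 q with h | h
  · exact ⟨(min_le_left _ _).trans (Real.rpow_le_rpow hc.le hx h),
      (Real.rpow_le_rpow hx0.le hx' h).trans (le_max_right _ _)⟩
  · exact ⟨(min_le_right _ _).trans (Real.rpow_le_rpow_of_nonpos hx0 hx' h),
      (Real.rpow_le_rpow_of_nonpos hc hx h).trans (le_max_left _ _)⟩

theorem log_two_le {t : ℝ} (ht : 0 < t) (ht1 : t < 1) : Real.log 2 ≤ Real.log (1 + 1 / t) := by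
  have : 1 ≤ 1 / t := (one_le_div ht).mpr ht1.le
  exact Real.log_le_log (by norm_num) (by linarith)

/-- The logarithm grows slower than any power. -/
theorem log_one_add_le {u ε : ℝ} (hu : 1 ≤ u) (hε : 0 < ε) :
    Real.log (1 + u) ≤ 2 ^ ε / ε * u ^ ε := by
  refine (Real.log_le_rpow_div (by linarith) hε).trans ?_
  rw [div_mul_eq_mul_div, ← Real.mul_rpow (by norm_num) (by linarith)]
  gcongr
  linarith

theorem exists_log_rpow_bounds (R : ℝ) {ε : ℝ} (hε : 0 < ε) :
    ∃ c C : ℝ, 0 < c ∧ 0 < C ∧ ∀ u : ℝ, 1 ≤ u →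
      c * u ^ (-ε) ≤ Real.log (1 + u) ^ R ∧ Real.log (1 + u) ^ R ≤ C * u ^ ε := by
  have hl2 : 0 < Real.log 2 := Real.log_pos (by norm_num)
  -- The 1 in the denominator keeps η defined at R = 0, and η|R| ≤ ε still holds.
  set η := ε / (|R| + 1) with hη
  have hη0 : 0 < η := by positivity
  have hηR : η * |R| ≤ ε := by
    rw [hη, div_mul_eq_mul_div, div_le_iff₀ (by positivity)]
    nlinarith [abs_nonneg R]
  set D := (2 : ℝ) ^ η / η with hD
  have hD0 : 0 < D := by positivity
  have hlog : ∀ u : ℝ, 1 ≤ u → Real.log 2 ≤ Real.log (1 + u) := fun u hu =>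
    Real.log_le_log (by norm_num) (by linarith)
  have hup : ∀ u : ℝ, 1 ≤ u → Real.log (1 + u) ^ |R| ≤ D ^ |R| * u ^ ε := by
    intro u hu
    have hu0 : 0 < u := by linarith
    have h1 := Real.rpow_le_rpow (hl2.le.trans (hlog u hu)) (log_one_add_le hu hη0) (abs_nonneg R)
    refine h1.trans ?_
    rw [Real.mul_rpow hD0.le (by positivity), ← Real.rpow_mul hu0.le]
    gcongr
  have hlow : ∀ u : ℝ, 1 ≤ u → Real.log 2 ^ |R| * u ^ (-ε) ≤ Real.log (1 + u) ^ |R| := by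
    intro u hu
    have h1 := Real.rpow_le_rpow hl2.le (hlog u hu) (abs_nonneg R)
    refine le_trans (mul_le_of_le_one_right (by positivity) ?_) h1
    exact Real.rpow_le_one_of_one_le_of_nonpos hu (by linarith)
  rcases le_total 0 R with h | h
  · rw [abs_of_nonneg h] at hup hlow
    exact ⟨Real.log 2 ^ R, D ^ R, by positivity, by positivity, fun u hu => ⟨hlow u hu, hup u hu⟩⟩
  · rw [abs_of_nonpos h] at hup hlow
    refine ⟨(D ^ (-R))⁻¹, (Real.log 2 ^ (-R))⁻¹, by positivity, by positivity, fun u hu => ?_⟩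
    have hu0 : 0 < u := by linarith
    have hl : 0 < Real.log (1 + u) := hl2.trans_le (hlog u hu)
    have h1 := hup u hu
    have h2 := hlow u hu
    rw [Real.rpow_neg hl.le] at h1 h2
    have hlR : 0 < Real.log (1 + u) ^ R := by positivity
    constructor
    · rw [Real.rpow_neg hu0.le, ← mul_inv]
      exact (inv_le_comm₀ hlR (by positivity)).mp h1
    · have h3 : (Real.log 2 ^ (-R))⁻¹ * u ^ ε = (Real.log 2 ^ (-R) * u ^ (-ε))⁻¹ := by
        rw [mul_inv, Real.rpow_neg hu0.le ε, inv_inv]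
      rw [h3]
      exact (le_inv_comm₀ hlR (by positivity)).mpr h2

/-- At the scale `t^p (log (1 + 1/t))^q` the logarithmic term is comparable to `log (1 + 1/t)`. -/
theorem exists_logTerm_bounds {p κ : ℝ} (q : ℝ) (hp : 0 < p) (hκ : 0 < κ) :
    ∃ c C : ℝ, 0 < c ∧ 0 < C ∧ ∀ t : ℝ, 0 < t → t < 1 →
      c * Real.log (1 + 1 / t) ≤ logTerm κ (t ^ p * Real.log (1 + 1 / t) ^ q) ∧
      logTerm κ (t ^ p * Real.log (1 + 1 / t) ^ q) ≤ C * Real.log (1 + 1 / t) := by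
  have hl2 : 0 < Real.log 2 := Real.log_pos (by norm_num)
  -- At this scale s^{-κ} is u^{2k} times a power of log(1+u), with u = 1/t. That power lies between
  -- multiples of u^{-k} and u^k, so s^{-κ} lies between multiples of u^k and u^{3k}, and its
  -- logarithm is comparable to log(1+u).
  set k := p * κ / 2 with hk
  have hk0 : 0 < k := by positivity
  obtain ⟨c₀, C₀, hc₀, hC₀, hb⟩ := exists_log_rpow_bounds (q * -κ) hk0
  set c₁ := min c₀ 1 with hc₁
  have hc₁0 : 0 < c₁ := lt_min hc₀ one_pos
  refine ⟨c₁ * min k 1, Real.log (1 + C₀) / Real.log 2 + 3 * k, by positivity, by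
    have : 0 < Real.log (1 + C₀) := Real.log_pos (by linarith)
    positivity, fun t ht ht1 => ?_⟩
  have hL := log_two_le ht ht1
  obtain ⟨u, hu⟩ : ∃ u, u = 1 / t := ⟨_, rfl⟩
  have hu1 : 1 ≤ u := by rw [hu]; exact (one_le_div ht).mpr ht1.le
  have hu0 : 0 < u := by linarith
  obtain ⟨hb1, hb2⟩ := hb u hu1
  have htu : t = u⁻¹ := by rw [hu]; simp
  rw [← hu] at hL ⊢
  have hL0 : 0 < Real.log (1 + u) := hl2.trans_le hL
  have hpow : (t ^ p * Real.log (1 + u) ^ q) ^ (-κ) = u ^ (2 * k) * Real.log (1 + u) ^ (q * -κ) := by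
    rw [Real.mul_rpow (by positivity) (by positivity), ← Real.rpow_mul ht.le,
      ← Real.rpow_mul hL0.le, htu, Real.inv_rpow hu0.le, ← Real.rpow_neg hu0.le, hk]
    congr 2
    ring
  rw [logTerm, hpow]
  constructor
  · have h1 : c₁ * u ^ k ≤ u ^ (2 * k) * Real.log (1 + u) ^ (q * -κ) := by
      calc _ ≤ c₀ * u ^ k := by
            gcongr
            exact min_le_left _ _
        _ = u ^ (2 * k) * (c₀ * u ^ (-k)) := by
            rw [mul_left_comm, ← Real.rpow_add hu0]
            congr 2
            ring
        _ ≤ _ := by gcongr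
    have h2 := log_one_add_mul_le (b := c₁⁻¹) (u := c₁ * u ^ k)
      ((one_le_inv₀ hc₁0).mpr (min_le_right _ _)) (by positivity)
    rw [← mul_assoc, inv_mul_cancel₀ hc₁0.ne', one_mul, inv_mul_eq_div, le_div_iff₀ hc₁0] at h2
    have h3 : min k 1 * Real.log (1 + u) ≤ Real.log (1 + u ^ k) := by
      rw [← Real.log_rpow (by linarith)]
      refine Real.log_le_log (by positivity) ?_
      refine (Real.rpow_add_le_add_rpow zero_le_one hu0.le (by positivity)
        (min_le_right _ _)).trans ?_
      rw [Real.one_rpow]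
      gcongr
      exact min_le_left _ _
    calc _ = c₁ * (min k 1 * Real.log (1 + u)) := by ring
      _ ≤ c₁ * Real.log (1 + u ^ k) := by gcongr
      _ = Real.log (1 + u ^ k) * c₁ := mul_comm _ _
      _ ≤ Real.log (1 + c₁ * u ^ k) := h2
      _ ≤ _ := Real.log_le_log (by positivity) (by linarith)
  · have h1 : u ^ (2 * k) * Real.log (1 + u) ^ (q * -κ) ≤ C₀ * u ^ (3 * k) := by
      calc _ ≤ u ^ (2 * k) * (C₀ * u ^ k) := by gcongr
        _ = _ := by
            rw [mul_left_comm, ← Real.rpow_add hu0]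
            congr 2
            ring
    have h2 : 1 + C₀ * u ^ (3 * k) ≤ (1 + C₀) * (1 + u) ^ (3 * k) := by
      have h3 : u ^ (3 * k) ≤ (1 + u) ^ (3 * k) :=
        Real.rpow_le_rpow hu0.le (by linarith) (by positivity)
      have h4 : 1 ≤ (1 + u) ^ (3 * k) := Real.one_le_rpow (by linarith) (by positivity)
      nlinarith
    have hlogC : 0 ≤ Real.log (1 + C₀) := Real.log_nonneg (by linarith)
    calc _ ≤ Real.log ((1 + C₀) * (1 + u) ^ (3 * k)) :=
          Real.log_le_log (by positivity) (by linarith)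
      _ = Real.log (1 + C₀) + 3 * k * Real.log (1 + u) := by
          rw [Real.log_mul (by positivity) (by positivity), Real.log_rpow (by linarith)]
      _ ≤ Real.log (1 + C₀) / Real.log 2 * Real.log (1 + u) + 3 * k * Real.log (1 + u) := by
          gcongr
          rw [div_mul_eq_mul_div, le_div_iff₀ hl2]
          gcongr
      _ = _ := by ring

/-- With w = s^κ ≥ 1, log(1 + 1/w) lies between 1/(w+1) and 1/w: at large scales the logarithm acts
as the power s^{-κ}, whence the index α - κβ. -/
theorem logTerm_bounds_of_one_le {κ s : ℝ} (hκ : 0 < κ) (hs : 1 ≤ s) :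
    1 / 2 ≤ logTerm κ s * s ^ κ ∧ logTerm κ s * s ^ κ ≤ 1 := by
  have hs0 : 0 < s := by linarith
  have h1 : 1 ≤ s ^ κ := Real.one_le_rpow hs hκ.le
  rw [logTerm, Real.rpow_neg hs0.le]
  set w := s ^ κ
  have hw : 0 < w := by positivity
  constructor
  · have h2 := Real.one_sub_inv_le_log_of_pos (x := 1 + w⁻¹) (by positivity)
    have h3 : 1 - (1 + w⁻¹)⁻¹ = 1 / (w + 1) := by field_simp; ring
    rw [h3] at h2
    calc (1 : ℝ) / 2 ≤ 1 / (w + 1) * w := by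
          rw [div_mul_eq_mul_div, div_le_div_iff₀ (by norm_num) (by positivity)]
          linarith
      _ ≤ _ := by gcongr
  · have h2 := Real.log_le_sub_one_of_pos (x := 1 + w⁻¹) (by positivity)
    calc _ ≤ w⁻¹ * w := by
          gcongr
          linarith
      _ = 1 := inv_mul_cancel₀ hw.ne'

/-! ### Choice of the scale g(t). -/

section Scales

variable {d : ℕ} {ν : Measure (E d)} {α κ β γ A : ℝ}

/-- The scale conditions where the profile is not negligible, for indices below two. -/
theorem LevyBounds.isScale_of_lt_two {Q : ℝ → ℝ} {δ₁ δ₂ b B t g : ℝ} (hb : LevyBounds ν Q γ A)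
    (hQ : RadialProfile Q δ₁ δ₂) (hδ : δ₂ < 2) (ht : 0 < t) (hg : 0 < g)
    (h1 : b ≤ t * (g * Q g)) (h2 : t * (g * Q g) ≤ B) :
    IsScale ν Q (B + B / (2 - δ₂)) (b / (8 * A)) δ₁ t g := by
  have hq := hQ.pos g hg
  have h3 : 0 < 2 - δ₂ := by linarith
  have hB : 0 ≤ B := le_trans (by positivity) h2
  have hB' : 0 ≤ B / (2 - δ₂) := by positivity
  refine ⟨ht, hg, by linarith, ?_, hb.le_mul_phi hQ ht hg h1⟩
  calc _ ≤ ENNReal.ofReal t * ENNReal.ofReal (g ^ 3 * Q g / (2 - δ₂)) := by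
        gcongr
        exact hQ.truncMoment_le hδ hg
    _ = ENNReal.ofReal (t * (g * Q g) / (2 - δ₂) * g ^ 2) := by
        rw [← ENNReal.ofReal_mul ht.le]
        congr 1
        ring
    _ ≤ _ := by
        gcongr
        have : t * (g * Q g) / (2 - δ₂) ≤ B / (2 - δ₂) := by gcongr
        linarith

theorem mul_logProfile {g : ℝ} (hg : 0 < g) :
    g * logProfile α κ β g = g ^ (-α) * logTerm κ g ^ (-β) := by
  rw [logProfile, logFactor_eq, ← mul_assoc]
  congr 1
  rw [show -α = 1 + (-1 - α) by ring, Real.rpow_add hg, Real.rpow_one]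

/-- For this g the quantity t g Q(g) is exactly the ratio of `logTerm` at g to L, raised to the
power -β; the ratio lies between two positive constants by `exists_logTerm_bounds`. -/
theorem exists_small_scale_bounds (hα : 0 < α) (hκ : 0 < κ) :
    ∃ b B : ℝ, 0 < b ∧ 0 ≤ B ∧ ∀ t : ℝ, 0 < t → t < 1 →
      let g := t ^ (1 / α) * Real.log (1 + 1 / t) ^ (-β / α)
      b ≤ t * (g * logProfile α κ β g) ∧ t * (g * logProfile α κ β g) ≤ B := by
  obtain ⟨c, C, hc, hC, h⟩ := exists_logTerm_bounds (-β / α) (show 0 < 1 / α by positivity) hκ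
  refine ⟨min (c ^ (-β)) (C ^ (-β)), max (c ^ (-β)) (C ^ (-β)), by positivity, by positivity,
    fun t ht ht1 => ?_⟩
  intro g
  have hL : 0 < Real.log (1 + 1 / t) :=
    (Real.log_pos (by norm_num)).trans_le (log_two_le ht ht1)
  have hg : 0 < g := by simp only [g]; positivity
  obtain ⟨h1, h2⟩ := h t ht ht1
  set L := Real.log (1 + 1 / t)
  have key : t * (g * logProfile α κ β g) = (logTerm κ g / L) ^ (-β) := by
    have h3 : g ^ (-α) = t⁻¹ * L ^ β := by
      simp only [g]
      rw [Real.mul_rpow (by positivity) (by positivity), ← Real.rpow_mul ht.le,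
        ← Real.rpow_mul hL.le, ← Real.rpow_neg_one]
      congr 2 <;> field_simp
    rw [mul_logProfile hg, h3, Real.div_rpow (logTerm_pos κ hg).le hL.le, Real.rpow_neg hL.le,
      div_inv_eq_mul]
    field_simp
  rw [key]
  exact rpow_bounds hc _ ((le_div_iff₀ hL).mpr h1) ((div_le_iff₀ hL).mpr h2)

theorem large_scale_bounds (hκβ : κ * β < α) {t : ℝ} (ht : 1 ≤ t) :
    let g := t ^ (1 / (α - κ * β))
    1 ≤ g ∧ t * (g * logProfile α κ β g) = (logTerm κ g * g ^ κ) ^ (-β) := by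
  intro g
  have hδ : 0 < α - κ * β := by linarith
  have ht0 : 0 < t := by linarith
  have hg1 : 1 ≤ g := Real.one_le_rpow ht (by positivity)
  have hg : 0 < g := by linarith
  have hgt : g ^ (α - κ * β) = t := by
    simp only [g]
    rw [← Real.rpow_mul ht0.le, one_div_mul_cancel hδ.ne', Real.rpow_one]
  refine ⟨hg1, ?_⟩
  rw [mul_logProfile hg, Real.mul_rpow (logTerm_pos κ hg).le (by positivity), ← Real.rpow_mul hg.le]
  nth_rewrite 1 [← hgt]
  rw [← mul_assoc, ← Real.rpow_add hg, mul_comm]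
  congr 2
  ring

/-- For α < 2 both indices are below 2 and the general moment bound applies. For α = 2 the upper
index is 2, so the moment is taken from its explicit primitive; at large scales it is nevertheless a
multiple of g²/t, and t g Q(g) stays bounded below. -/
theorem exists_large_scale (hα : 0 < α) (hα2 : α ≤ 2) (hκ : 0 < κ) (hκβ : κ * β < α)
    (hκβ' : α - 2 < κ * β) (hβ : α = 2 → 1 < β) (hb : LevyBounds ν (logProfile α κ β) γ A) :
    ∃ b B c : ℝ, 0 < b ∧ 0 ≤ B ∧ 0 < c ∧ ∀ t : ℝ, 1 ≤ t →
      let g := t ^ (1 / (α - κ * β))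
      b ≤ t * (g * logProfile α κ β g) ∧
        IsScale ν (logProfile α κ β) B c (min α (α - κ * β)) t g := by
  have hQ := logProfile_radialProfile (β := β) hα hκ hκβ
  have hA := hb.pos
  have hδ : 0 < α - κ * β := by linarith
  obtain ⟨b, hbdef⟩ : ∃ b : ℝ, b = min ((1 / 2 : ℝ) ^ (-β)) (1 ^ (-β)) := ⟨_, rfl⟩
  obtain ⟨B, hBdef⟩ : ∃ B : ℝ, B = max ((1 / 2 : ℝ) ^ (-β)) (1 ^ (-β)) := ⟨_, rfl⟩
  have hb0 : 0 < b := by rw [hbdef]; positivity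
  have hB0 : 0 ≤ B := by rw [hBdef]; positivity
  have hbB : ∀ t : ℝ, 1 ≤ t →
      b ≤ t * (t ^ (1 / (α - κ * β)) * logProfile α κ β (t ^ (1 / (α - κ * β)))) ∧
      t * (t ^ (1 / (α - κ * β)) * logProfile α κ β (t ^ (1 / (α - κ * β)))) ≤ B := by
    intro t ht
    obtain ⟨hg1, hg⟩ := large_scale_bounds hκβ ht
    obtain ⟨h1, h2⟩ := logTerm_bounds_of_one_le hκ hg1
    rw [hg, hbdef, hBdef]
    exact rpow_bounds (by norm_num) _ h1 h2
  rcases lt_or_eq_of_le hα2 with hlt | heq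
  · have hδ2 : max α (α - κ * β) < 2 := max_lt hlt (by linarith)
    have h2δ : 0 < 2 - max α (α - κ * β) := by linarith
    refine ⟨b, _, b / (8 * A), hb0, ?_, by positivity, fun t ht => ⟨(hbB t ht).1,
      hb.isScale_of_lt_two hQ hδ2 (by linarith) (by positivity) (hbB t ht).1 (hbB t ht).2⟩⟩
    positivity
  · have hβ1 := hβ heq
    subst heq
    have hβ0 : 0 < β - 1 := by linarith
    set D := 2 * (1 / 2 : ℝ) ^ (1 - β) / ((β - 1) * κ) with hD
    have hD0 : 0 < D := by positivity
    refine ⟨b, B + D, b / (8 * A), hb0, by positivity, by positivity, fun t ht => ⟨(hbB t ht).1,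
      ?_⟩⟩
    obtain ⟨hg1, -⟩ := large_scale_bounds (α := 2) hκβ ht
    obtain ⟨h1, h2⟩ := logTerm_bounds_of_one_le hκ hg1
    have ht0 : 0 < t := by linarith
    have hgt : (t ^ (1 / (2 - κ * β))) ^ (2 - κ * β) = t := by
      rw [← Real.rpow_mul ht0.le, one_div_mul_cancel hδ.ne', Real.rpow_one]
    have hg : 0 < t ^ (1 / (2 - κ * β)) := by positivity
    have hbBt := hbB t ht
    set g := t ^ (1 / (2 - κ * β))
    refine ⟨ht0, hg, by linarith [hbBt.2], ?_,
      hb.le_mul_phi hQ ht0 hg hbBt.1⟩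
    calc _ ≤ ENNReal.ofReal t
          * ENNReal.ofReal ((1 + g ^ κ) * logTerm κ g ^ (1 - β) / ((β - 1) * κ)) := by
          gcongr
          exact truncMoment_logProfile_le hκ hβ1 hg
      _ ≤ ENNReal.ofReal (D * g ^ 2) := by
          rw [← ENNReal.ofReal_mul ht0.le]
          refine ENNReal.ofReal_le_ofReal ?_
          have h3 : (logTerm κ g * g ^ κ) ^ (1 - β) ≤ (1 / 2 : ℝ) ^ (1 - β) :=
            Real.rpow_le_rpow_of_nonpos (by norm_num) h1 (by linarith)
          have hl := logTerm_pos κ hg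
          have h4 : logTerm κ g ^ (1 - β) = (logTerm κ g * g ^ κ) ^ (1 - β) * g ^ (κ * (β - 1)) := by
            rw [Real.mul_rpow hl.le (by positivity), ← Real.rpow_mul hg.le, mul_assoc,
              ← Real.rpow_add hg]
            ring_nf
            simp
          have h5 : 1 + g ^ κ ≤ 2 * g ^ κ := by
            have := Real.one_le_rpow hg1 hκ.le
            linarith
          have h6 : t * (g ^ κ * g ^ (κ * (β - 1))) = g ^ 2 := by
            nth_rewrite 1 [← hgt]
            rw [← Real.rpow_add hg, ← Real.rpow_add hg, ← Real.rpow_natCast g 2]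
            congr 1
            push_cast
            ring
          calc _ ≤ t * (2 * g ^ κ * ((1 / 2 : ℝ) ^ (1 - β) * g ^ (κ * (β - 1)))
                / ((β - 1) * κ)) := by
                rw [h4]
                gcongr
            _ = D * (t * (g ^ κ * g ^ (κ * (β - 1)))) := by rw [hD]; ring
            _ = _ := by rw [h6]
      _ ≤ _ := by
          gcongr
          linarith

/-- The scale solves g² = t L^{1-β}, which balances t times the truncated moment with g². The tail t
g Q(g) is then of order 1/L, bounded above only. In the lower bound for the exponent, u² comes from
|ξ|² and u^{κ(1-β)} from comparing `logTerm` at 1/|ξ| with its value at g, where u = g|ξ|. -/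
theorem exists_critical_scale (hκ : 0 < κ) (hβ : 1 < β)
    (hb : LevyBounds ν (logProfile 2 κ β) γ A) :
    ∃ B c : ℝ, 0 ≤ B ∧ 0 < c ∧ ∀ t : ℝ, 0 < t → t < 1 →
      IsScale ν (logProfile 2 κ β) B c (2 - κ * β + κ) t
        (t ^ (1 / 2 : ℝ) * Real.log (1 + 1 / t) ^ (-(β - 1) / 2)) := by
  have hA := hb.pos
  have hβ0 : 0 < β - 1 := by linarith
  have hl2 : 0 < Real.log 2 := Real.log_pos (by norm_num)
  obtain ⟨c, C, hc, hC, h⟩ := exists_logTerm_bounds (-(β - 1) / 2)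
    (show (0 : ℝ) < 1 / 2 by norm_num) hκ
  set B₁ := max (c ^ (-β)) (C ^ (-β)) / Real.log 2 with hB₁
  set G := Real.log 2 ^ (-(β - 1) / 2) with hG
  set B₂ := (1 + G ^ κ) * c ^ (1 - β) / ((β - 1) * κ) with hB₂
  have hB₁0 : 0 < B₁ := by positivity
  have hB₂0 : 0 < B₂ := by positivity
  refine ⟨B₁ + B₂, C ^ (1 - β) / ((β - 1) * κ * A), by positivity, by positivity,
    fun t ht ht1 => ?_⟩
  have hL2 := log_two_le ht ht1
  obtain ⟨h1, h2⟩ := h t ht ht1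
  set L := Real.log (1 + 1 / t)
  have hL : 0 < L := hl2.trans_le hL2
  set g := t ^ (1 / 2 : ℝ) * L ^ (-(β - 1) / 2) with hgdef
  have hg : 0 < g := by positivity
  have hl := logTerm_pos κ hg
  have hg2 : g ^ 2 = t * L ^ (1 - β) := by
    rw [← Real.rpow_natCast g 2, hgdef, Real.mul_rpow (by positivity) (by positivity),
      ← Real.rpow_mul ht.le, ← Real.rpow_mul hL.le]
    norm_num
  have hr1 : c ≤ logTerm κ g / L := (le_div_iff₀ hL).mpr h1
  have hr2 : logTerm κ g / L ≤ C := (div_le_iff₀ hL).mpr h2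
  refine ⟨ht, hg, ?_, ?_, fun ξ hξ => ?_⟩
  · have h3 : t * (g * logProfile 2 κ β g) = (logTerm κ g / L) ^ (-β) / L := by
      have h4 : g ^ (-2 : ℝ) = (t * L ^ (1 - β))⁻¹ := by
        rw [← hg2, Real.rpow_neg hg.le]
        norm_num
      rw [mul_logProfile hg, h4, Real.div_rpow hl.le hL.le, show 1 - β = -β + 1 by ring,
        Real.rpow_add hL, Real.rpow_one]
      field_simp
    rw [h3]
    calc _ ≤ max (c ^ (-β)) (C ^ (-β)) / L := by
          gcongr
          exact (rpow_bounds hc _ hr1 hr2).2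
      _ ≤ B₁ := by rw [hB₁]; gcongr
      _ ≤ _ := by linarith
  · calc _ ≤ ENNReal.ofReal t
          * ENNReal.ofReal ((1 + g ^ κ) * logTerm κ g ^ (1 - β) / ((β - 1) * κ)) := by
          gcongr
          exact truncMoment_logProfile_le hκ hβ hg
      _ ≤ ENNReal.ofReal (B₂ * g ^ 2) := by
          rw [← ENNReal.ofReal_mul ht.le]
          refine ENNReal.ofReal_le_ofReal ?_
          have hgG : g ≤ G := by
            rw [hgdef, hG]
            calc _ ≤ 1 * Real.log 2 ^ (-(β - 1) / 2) := by
                  gcongr ?_ * ?_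
                  · exact Real.rpow_le_one ht.le ht1.le (by norm_num)
                  · exact Real.rpow_le_rpow_of_nonpos hl2 hL2 (by linarith)
              _ = _ := one_mul _
          have h3 : logTerm κ g ^ (1 - β) ≤ (c * L) ^ (1 - β) :=
            Real.rpow_le_rpow_of_nonpos (by positivity) h1 (by linarith)
          rw [Real.mul_rpow hc.le hL.le] at h3
          calc _ ≤ t * ((1 + G ^ κ) * (c ^ (1 - β) * L ^ (1 - β)) / ((β - 1) * κ)) := by gcongr
            _ = B₂ * g ^ 2 := by rw [hg2, hB₂]; ring
      _ ≤ _ := by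
          gcongr
          linarith
  · have hn : 0 < ‖ξ‖ := by
      by_contra h0
      have : ‖ξ‖ = 0 := le_antisymm (not_lt.mp h0) (norm_nonneg _)
      rw [this] at hξ
      linarith
    have hni := inv_pos.mpr hn
    have hln := logTerm_pos κ hni
    have h3 : ‖ξ‖ ^ 2 * (logTerm κ ‖ξ‖⁻¹ ^ (1 - β) / ((β - 1) * κ)) ≤ A * phi ν ξ := by
      have h4 := (mul_le_mul_right (le_truncMoment_logProfile hκ hβ hni)
        (ENNReal.ofReal (‖ξ‖ ^ 2))).trans (hb.phi_ge ξ (norm_pos_iff.mp hn))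
      rwa [← ENNReal.ofReal_mul (by positivity), ENNReal.ofReal_le_ofReal_iff
        (mul_nonneg hA.le (phi_nonneg ν ξ))] at h4
    set u := g * ‖ξ‖ with hu
    have hu0 : 0 < u := by positivity
    have h5 : logTerm κ ‖ξ‖⁻¹ ≤ u ^ κ * (C * L) := by
      have h6 := rpow_neg_mul_logTerm_le hκ.le hni hξ
      have h7 : u * ‖ξ‖⁻¹ = g := by rw [hu]; field_simp
      rw [h7, Real.rpow_neg hu0.le, inv_mul_le_iff₀ (by positivity)] at h6
      exact h6.trans (by gcongr)
    have h6 := Real.rpow_le_rpow_of_nonpos hln h5 (show 1 - β ≤ 0 by linarith)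
    rw [Real.mul_rpow (by positivity) (by positivity), Real.mul_rpow hC.le hL.le,
      ← Real.rpow_mul hu0.le] at h6
    have h7 : u ^ (2 - κ * β + κ) = u ^ 2 * u ^ (κ * (1 - β)) := by
      rw [← Real.rpow_natCast u 2, ← Real.rpow_add hu0]
      congr 1
      push_cast
      ring
    have h8 : u ^ 2 = t * L ^ (1 - β) * ‖ξ‖ ^ 2 := by rw [hu, mul_pow, hg2]
    calc _ = t / A * (‖ξ‖ ^ 2 * (u ^ (κ * (1 - β)) * (C ^ (1 - β) * L ^ (1 - β))
          / ((β - 1) * κ))) := by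
          rw [h7, h8]
          field_simp
      _ ≤ t / A * (‖ξ‖ ^ 2 * (logTerm κ ‖ξ‖⁻¹ ^ (1 - β) / ((β - 1) * κ))) := by gcongr
      _ ≤ t / A * (A * phi ν ξ) := by gcongr
      _ = _ := by field_simp

end Scales
-- The density estimates in explicit form.
theorem rpow_mul_logProfile (α κ β γ : ℝ) {r : ℝ} (hr : 0 < r) :
    r ^ (1 - γ) * logProfile α κ β r = r ^ (-γ - α) * logFactor κ β r := by
  rw [logProfile, ← mul_assoc, ← Real.rpow_add hr]
  congr 2
  ring

theorem minOne_congr {d : ℕ} {x : E d} {u v : ℝ} (huv : x ≠ 0 → u = v) :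
    minOne x u = minOne x v := by
  unfold minOne
  split_ifs with hx
  · rfl
  · rw [huv hx]

theorem h_nonneg {d : ℕ} (ν : Measure (E d)) (b : E d) (t : ℝ) : 0 ≤ h ν b t :=
  div_nonneg zero_le_one (Real.sSup_nonneg fun _ hr => hr.1.le)

section Density

variable {d : ℕ} {ν : Measure (E d)} {P : ℝ → Measure (E d)} {α κ β γ A : ℝ}

theorem density_le_minOne_of_lt_two (hb : LevyBounds ν (logProfile α κ β) γ A) (hγ : 1 ≤ γ)
    (hν : IsLevyMeasure ν) (hs : IsSymmetric ν) (hP : IsLevySemigroup ν 0 P)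
    (hα : 0 < α) (hα2 : α < 2) (hκ : 0 < κ) (hκβ : κ * β < α) (hκβ' : α - 2 < κ * β) :
    (∀ t : ℝ, 0 < t → t < 1 → Integrable fun v => charFun (P t) ((2 * Real.pi) • v)) ∧
    ∃ C : ℝ, 0 < C ∧ ∀ t : ℝ, 0 < t → t < 1 → ∀ x : E d,
      charDensity (P t) x ≤ C * t ^ (-d / α) * Real.log (1 + 1 / t) ^ (d * β / α) *
        minOne x (t ^ (1 + γ / α) * logFactor κ β ‖x‖ /
          (Real.log (1 + 1 / t) ^ (γ * β / α) * ‖x‖ ^ (γ + α))) := by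
  have hQ := logProfile_radialProfile (β := β) hα hκ hκβ
  have hA := hb.pos
  have hδ2 : max α (α - κ * β) < 2 := max_lt hα2 (by linarith)
  have h2δ : 0 < 2 - max α (α - κ * β) := by linarith
  have ha : 0 < min α (α - κ * β) := lt_min hα (by linarith)
  obtain ⟨b, B, hb0, hB, hbB⟩ := exists_small_scale_bounds (β := β) hα hκ
  have hL : ∀ t : ℝ, 0 < t → t < 1 → 0 < Real.log (1 + 1 / t) := fun t ht ht1 =>
    (Real.log_pos (by norm_num)).trans_le (log_two_le ht ht1)
  have hscale : ∀ t : ℝ, 0 < t → t < 1 → IsScale ν (logProfile α κ β)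
      (B + B / (2 - max α (α - κ * β))) (b / (8 * A)) (min α (α - κ * β)) t
      (t ^ (1 / α) * Real.log (1 + 1 / t) ^ (-β / α)) := by
    intro t ht ht1
    have := hL t ht ht1
    exact hb.isScale_of_lt_two hQ hδ2 ht (by positivity) (hbB t ht ht1).1 (hbB t ht ht1).2
  have hB' : 0 ≤ B + B / (2 - max α (α - κ * β)) := by positivity
  have hc : 0 < b / (8 * A) := by positivity
  constructor
  · obtain ⟨C, -, hC⟩ := hb.exists_density_le hQ hν hs hP hB' hc ha
    exact fun t ht ht1 => (hC t _ (hscale t ht ht1)).1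
  · obtain ⟨C, hC0, hC⟩ := hb.exists_density_le_minOne hQ hγ hν hs hP hB' hc ha hb0
    refine ⟨C, hC0, fun t ht ht1 x => ?_⟩
    refine (hC t _ (hscale t ht ht1) (hbB t ht ht1).1 x).trans_eq ?_
    have hL0 := hL t ht ht1
    set L := Real.log (1 + 1 / t)
    have hg : ∀ q : ℝ, (t ^ (1 / α) * L ^ (-β / α)) ^ q = t ^ (q / α) * L ^ (-(q * β / α)) := by
      intro q
      rw [Real.mul_rpow (by positivity) (by positivity), ← Real.rpow_mul ht.le,
        ← Real.rpow_mul hL0.le]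
      congr 2 <;> ring
    congr 1
    · rw [← Real.rpow_natCast, ← Real.rpow_neg (by positivity), hg, mul_assoc]
      congr 3
      ring
    · refine minOne_congr fun hx => ?_
      have hr := norm_pos_iff.mpr hx
      rw [rpow_mul_logProfile _ _ _ _ hr, hg, Real.rpow_neg hL0.le, Real.rpow_add ht,
        Real.rpow_one, show -γ - α = -(γ + α) by ring, Real.rpow_neg hr.le]
      field_simp

theorem density_le_minOne_of_eq_two (hb : LevyBounds ν (logProfile 2 κ β) γ A) (hd : 1 ≤ d)
    (hν : IsLevyMeasure ν) (hs : IsSymmetric ν) (hP : IsLevySemigroup ν 0 P)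
    (hκ : 0 < κ) (hκβ : κ * β < 2) (hβ : 1 < β) :
    (∀ t : ℝ, 0 < t → t < 1 → Integrable fun v => charFun (P t) ((2 * Real.pi) • v)) ∧
    ∃ C₁ C₂ C₃ : ℝ, 0 < C₁ ∧ 0 < C₂ ∧ 0 < C₃ ∧ ∀ t : ℝ, 0 < t → t < 1 → ∀ x : E d,
      charDensity (P t) x ≤
        C₁ * t ^ (-(d : ℝ) / 2) * Real.log (1 + 1 / t) ^ (d * (β - 1) / 2) *
          minOne x (t ^ (1 + γ / 2) * logFactor κ β ‖x‖ /
              (Real.log (1 + 1 / t) ^ (γ * (β - 1) / 2) * ‖x‖ ^ (γ + 2))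
            + Real.exp (-C₂ * ‖x‖ / h ν 0 t * Real.log (1 + C₃ * ‖x‖ / h ν 0 t))) := by
  have hQ := logProfile_radialProfile (β := β) two_pos hκ hκβ
  obtain ⟨B, c, hB, hc, hscale⟩ := exists_critical_scale hκ hβ hb
  have ha : 0 < 2 - κ * β + κ := by linarith
  obtain ⟨C, hC0, hC⟩ := hb.exists_density_le hQ hν hs hP hB hc ha
  refine ⟨fun t ht ht1 => (hC t _ (hscale t ht ht1)).1, ?_⟩
  set D := 1 + (1 / c) ^ (1 / (2 - κ * β + κ)) with hD
  have hD0 : 0 < D := by positivity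
  -- D is the constant in h(t) ≥ g/D; dividing 1/8 and 1/2 by D allows g to be replaced by h(t) in
  -- the exponent.
  refine ⟨C, 1 / (8 * D), 1 / (2 * D), hC0, by positivity, by positivity, fun t ht ht1 x => ?_⟩
  have hsc := hscale t ht ht1
  obtain ⟨hdiag, hoff⟩ := (hC t _ hsc).2 x
  have hh := PsiInv_le hd hν hs ht hsc.pos hc ha hsc.phi_ge
  rw [← hD] at hh
  have hL0 : 0 < Real.log (1 + 1 / t) :=
    (Real.log_pos (by norm_num)).trans_le (log_two_le ht ht1)
  set L := Real.log (1 + 1 / t)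
  have hg : ∀ q : ℝ, (t ^ (1 / 2 : ℝ) * L ^ (-(β - 1) / 2)) ^ q
      = t ^ (q / 2) * L ^ (-(q * (β - 1) / 2)) := by
    intro q
    rw [Real.mul_rpow (by positivity) (by positivity), ← Real.rpow_mul ht.le,
      ← Real.rpow_mul hL0.le]
    congr 2 <;> ring
  have hgd : ((t ^ (1 / 2 : ℝ) * L ^ (-(β - 1) / 2)) ^ d)⁻¹
      = t ^ (-(d : ℝ) / 2) * L ^ (d * (β - 1) / 2) := by
    rw [← Real.rpow_natCast, ← Real.rpow_neg (by positivity), hg]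
    congr 2
    ring
  rw [hgd] at hdiag hoff
  rw [mul_assoc C]
  by_cases hx : x = 0
  · rw [minOne, if_pos hx, mul_one]
    exact hdiag
  have hr := norm_pos_iff.mpr hx
  rw [minOne, if_neg hx, mul_min_of_nonneg _ _ (by positivity), mul_one]
  refine le_min hdiag ((hoff hx).trans ?_)
  have hdiv : ‖x‖ / h ν 0 t ≤ D * (‖x‖ / (t ^ (1 / 2 : ℝ) * L ^ (-(β - 1) / 2))) := by
    -- Here |x|/h is |x| times the generalised inverse, valid also when that inverse is 0; an upper
    -- bound for the inverse is thus all that is needed.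
    rw [h, div_div_eq_mul_div, div_one]
    calc _ ≤ ‖x‖ * (D / (t ^ (1 / 2 : ℝ) * L ^ (-(β - 1) / 2))) := by gcongr
      _ = _ := by ring
  have hdiv0 : 0 ≤ ‖x‖ / h ν 0 t := div_nonneg hr.le (h_nonneg ν 0 t)
  gcongr C * _ * (?_ + Real.exp ?_)
  · refine le_of_eq ?_
    rw [rpow_mul_logProfile _ _ _ _ hr, hg, Real.rpow_neg hL0.le, Real.rpow_add ht,
      Real.rpow_one, show -γ - 2 = -(γ + 2) by ring, Real.rpow_neg hr.le]
    field_simp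
  · rw [mul_div_assoc (-_), mul_div_assoc (1 / (2 * D)), neg_mul, neg_mul, neg_le_neg_iff]
    have h1 : 1 / (8 * D) * (‖x‖ / h ν 0 t)
        ≤ 1 / 8 * (‖x‖ / (t ^ (1 / 2 : ℝ) * L ^ (-(β - 1) / 2))) := by
      calc _ ≤ 1 / (8 * D) * (D * (‖x‖ / (t ^ (1 / 2 : ℝ) * L ^ (-(β - 1) / 2)))) := by gcongr
        _ = _ := by field_simp
    have h2 : 1 / (2 * D) * (‖x‖ / h ν 0 t)
        ≤ 1 / 2 * (‖x‖ / (t ^ (1 / 2 : ℝ) * L ^ (-(β - 1) / 2))) := by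
      calc _ ≤ 1 / (2 * D) * (D * (‖x‖ / (t ^ (1 / 2 : ℝ) * L ^ (-(β - 1) / 2)))) := by gcongr
        _ = _ := by field_simp
    have h3 : 0 ≤ 1 / (2 * D) * (‖x‖ / h ν 0 t) := by positivity
    exact mul_le_mul h1 (Real.log_le_log (by linarith) (by linarith))
      (Real.log_nonneg (by linarith)) (by positivity)

theorem density_le_minOne_of_one_le (hb : LevyBounds ν (logProfile α κ β) γ A) (hγ : 1 ≤ γ)
    (hν : IsLevyMeasure ν) (hs : IsSymmetric ν) (hP : IsLevySemigroup ν 0 P)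
    (hα : 0 < α) (hα2 : α ≤ 2) (hκ : 0 < κ) (hκβ : κ * β < α) (hκβ' : α - 2 < κ * β)
    (hβ : α = 2 → 1 < β) :
    (∀ t : ℝ, 1 ≤ t → Integrable fun v => charFun (P t) ((2 * Real.pi) • v)) ∧
    ∃ C : ℝ, 0 < C ∧ ∀ t : ℝ, 1 ≤ t → ∀ x : E d,
      charDensity (P t) x ≤ C * t ^ (-d / (α - κ * β)) *
        minOne x (t ^ (1 + γ / (α - κ * β)) * ‖x‖ ^ (-γ - α) * logFactor κ β ‖x‖) := by
  have hQ := logProfile_radialProfile (β := β) hα hκ hκβ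
  have hδ : 0 < α - κ * β := by linarith
  obtain ⟨b, B, c, hb0, hB, hc, hscale⟩ := exists_large_scale hα hα2 hκ hκβ hκβ' hβ hb
  have ha : 0 < min α (α - κ * β) := lt_min hα hδ
  constructor
  · obtain ⟨C, -, hC⟩ := hb.exists_density_le hQ hν hs hP hB hc ha
    exact fun t ht => (hC t _ (hscale t ht).2).1
  · obtain ⟨C, hC0, hC⟩ := hb.exists_density_le_minOne hQ hγ hν hs hP hB hc ha hb0
    refine ⟨C, hC0, fun t ht x => (hC t _ (hscale t ht).2 (hscale t ht).1 x).trans_eq ?_⟩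
    have ht0 : 0 < t := by linarith
    have hg : ∀ q : ℝ, (t ^ (1 / (α - κ * β))) ^ q = t ^ (q / (α - κ * β)) := by
      intro q
      rw [← Real.rpow_mul ht0.le]
      congr 1
      ring
    congr 1
    · rw [← Real.rpow_natCast, ← Real.rpow_neg (by positivity), hg]
    · refine minOne_congr fun hx => ?_
      rw [rpow_mul_logProfile _ _ _ _ (norm_pos_iff.mpr hx), hg, Real.rpow_add ht0, Real.rpow_one]
      ring

end Density

end LevyDensity

/-! ### Assembly over the ranges of α and t. -/

theorem mainTheorem4 (d : ℕ) (α β κ γ : ℝ)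
    (hα0 : 0 < α) (hα2 : α ≤ 2) (hκ : 0 < κ)
    (hκβ : κ * β < α) (hκβ' : α - 2 < κ * β) (hβ : α = 2 → 1 < β)
    (hγ1 : 1 ≤ γ) (hγd : γ ≤ d)
    (ν : Measure (E d)) (hν : IsLevyMeasure ν) (hsymm : IsSymmetric ν)
    (μ : Measure (S d)) (hμ : IsNondegenerate μ)
    (hμγ : IsSphericalMeasureOfOrder μ (γ - 1))
    (hνμ : IsComparableToPolar ν μ (fun s => s ^ (-1 - α) * logFactor κ β s))
    (P : ℝ → Measure (E d)) (hP : IsLevySemigroup ν 0 P) :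
    (∀ t : ℝ, 0 < t → P t ≪ volume) ∧
    ∃ p : ℝ → E d → ℝ,
      (∀ t : ℝ, 0 < t → Continuous (p t) ∧ (∀ x, 0 ≤ p t x) ∧
        P t = volume.withDensity (fun x => ENNReal.ofReal (p t x))) ∧
      (α < 2 → ∃ C₂₀ : ℝ, 0 < C₂₀ ∧ ∀ t : ℝ, 0 < t → t < 1 → ∀ x : E d,
        p t x ≤ C₂₀ * t ^ (-d / α) * Real.log (1 + 1 / t) ^ (d * β / α) *
          minOne x (t ^ (1 + γ / α) * logFactor κ β ‖x‖ /
            (Real.log (1 + 1 / t) ^ (γ * β / α) * ‖x‖ ^ (γ + α)))) ∧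
      (α = 2 → ∃ C₂₁ C₂₂ C₂₃ : ℝ, 0 < C₂₁ ∧ 0 < C₂₂ ∧ 0 < C₂₃ ∧
        ∀ t : ℝ, 0 < t → t < 1 → ∀ x : E d,
          p t x ≤ C₂₁ * t ^ (-(d : ℝ) / 2) * Real.log (1 + 1 / t) ^ (d * (β - 1) / 2) *
            minOne x (t ^ (1 + γ / 2) * logFactor κ β ‖x‖ /
                (Real.log (1 + 1 / t) ^ (γ * (β - 1) / 2) * ‖x‖ ^ (γ + 2))
              + Real.exp (-C₂₂ * ‖x‖ / h ν 0 t * Real.log (1 + C₂₃ * ‖x‖ / h ν 0 t)))) ∧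
      (∃ C₂₄ : ℝ, 0 < C₂₄ ∧ ∀ t : ℝ, 1 < t → ∀ x : E d,
        p t x ≤ C₂₄ * t ^ (-d / (α - κ * β)) *
          minOne x (t ^ (1 + γ / (α - κ * β)) * ‖x‖ ^ (-γ - α) * logFactor κ β ‖x‖)) := by
  have hd : 1 ≤ d := by exact_mod_cast hγ1.trans hγd
  have hQ := logProfile_radialProfile (β := β) hα0 hκ hκβ
  obtain ⟨A, hb⟩ := hQ.exists_levyBounds hγ1 hν hμ hμγ hνμ
  obtain ⟨hlarge, hlarge'⟩ :=
    density_le_minOne_of_one_le hb hγ1 hν hsymm hP hα0 hα2 hκ hκβ hκβ' hβ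
  have hint : ∀ t : ℝ, 0 < t → Integrable fun v => charFun (P t) ((2 * Real.pi) • v) := by
    intro t ht
    rcases lt_or_ge t 1 with ht1 | ht1
    · rcases lt_or_eq_of_le hα2 with hlt | heq
      · exact (density_le_minOne_of_lt_two hb hγ1 hν hsymm hP hα0 hlt hκ hκβ hκβ').1 t ht ht1
      · have hβ1 := hβ heq
        subst heq
        exact (density_le_minOne_of_eq_two hb hd hν hsymm hP hκ hκβ hβ1).1 t ht ht1
    · exact hlarge t ht1
  have hdens : ∀ t : ℝ, 0 < t →
      P t = volume.withDensity (fun x => ENNReal.ofReal (charDensity (P t) x)) := by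
    intro t ht
    have := hP.isProbabilityMeasure t ht.le
    exact eq_withDensity_charDensity (hint t ht)
  refine ⟨fun t ht => ?_, fun t => charDensity (P t), fun t ht => ?_, fun hlt => ?_, fun heq => ?_,
    ?_⟩
  · rw [hdens t ht]
    exact withDensity_absolutelyContinuous _ _
  · have := hP.isProbabilityMeasure t ht.le
    exact ⟨continuous_charDensity (hint t ht), charDensity_nonneg (hint t ht), hdens t ht⟩
  · exact (density_le_minOne_of_lt_two hb hγ1 hν hsymm hP hα0 hlt hκ hκβ hκβ').2
  · have hβ1 := hβ heq
    subst heq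
    exact (density_le_minOne_of_eq_two hb hd hν hsymm hP hκ hκβ hβ1).2
  · obtain ⟨C, hC0, hC⟩ := hlarge'
    exact ⟨C, hC0, fun t ht x => hC t ht.le x⟩
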